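/- Let $\mathbb F$ be $\mathbb R$ or $\mathbb C$, let $m,n_1,\dots,n_m$ be positive integers, $N=n_1\cdots n_m$, $V=\mathbb F^{n_1}\otimes\dots\otimes\mathbb F^{n_m}$, let $X=\{x_1\otimes\dots\otimes x_m : x_i\in\mathbb F^{n_i}\}\subseteq V$ be the set of product tensors, and let $$B=\frac{\binom{N+1}{2}-\prod_{i}\binom{n_i+1}{2}}{N}=\frac{N+1}{2}-\frac{(n_1+1)\cdots(n_m+1)}{2^m}.$$ (There is a universal constant $c>0$ with $B\ge cN$ whenever at least two of the $n_i$ are at least $2$.) The set $X$ is cut out by $p=\binom{N+1}{2}-\prod_i\binom{n_i+1}{2}$ linearly independent homogeneous quadratic polynomials on $V$; let $f_1,\dots,f_p$ be any such polynomials. Regard them as elements of $S^2(V^*)$, and let $I_2^\perp\subseteq S^2(V)$ be the space of symmetric tensors that they annihilate. Since $X$ is irreducible, Algorithm 2 for $X$ is the following procedure. The input is $f_1,\dots,f_p$ and a basis $u_1,\dots,u_R$ of a subspace $U\subseteq V$. (1) Compute a basis $P_1,\dots,P_s$ of $S^2(U)\cap I_2^\perp$. If $s=0$, output "$U$ trivially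 intersects $X$". If $s>R$, output "Fail". (2) Otherwise run simultaneous diagonalization on $T=\sum_i e_i\otimes P_i\in\mathbb F^s\otimes V\otimes V$: choose $\varphi,\gamma\in(\mathbb F^s)^*$ at random (from an absolutely continuous distribution). With ${}^+$ the Moore–Penrose inverse, diagonalize $T(\varphi)T(\gamma)^+$ and the transpose of $T(\varphi)^+T(\gamma)$. Fail unless these are diagonalizable over $\mathbb F$ with simple nonzero eigenvalues $\lambda_1,\dots,\lambda_r$ and $\lambda_1^{-1},\dots,\lambda_r^{-1}$ respectively; let $v_a$, $w_a$ be corresponding eigenvectors. Choose functionals $h_a$ dual to the $v_a\otimes w_a$ and set $y_a=T(h_a)$. Fail if $y_a\in\operatorname{span}\{y_b\}$ for some $a\ne b$. (3) If the $y_a\otimes v_a\otimes w_a$ are the terms of a decomposition of $T$ of the form $T=\sum_{a=1}^s z_a\otimes v_a\otimes v_a$ with $z_1,\dots,z_s$ linearly independent and $v_1,\dots,v_s$ linearly independent, output $v_1,\dots,v_s$; otherwise output "Fail". Then: 1. (Correctness on every input.) If Algorithm 2 outputs "$U$ trivially intersects $X$", then $U\cap X=\{0\}$; if it outputs vectors,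 there is at least one and all of them are nonzero elements of $U\cap X$. 2. (Generic subspace.) For every integer $0\le R\le B$ there is a Zariski open dense subset $\mathcal A\subseteq V^{R}$ such that for all $(v_1,\dots,v_R)\in\mathcal A$ the space $U=\operatorname{span}\{v_1,\dots,v_R\}$ has dimension $R$ and $U\cap X=\{0\}$, and on input any basis of $U$ Algorithm 2 outputs "$U$ trivially intersects $X$". 3. (Planted product tensor.) For every integer $1\le R\le B$ there is a Zariski open dense subset $\mathcal B\subseteq X\times V^{R-1}$ such that for all $(v_1,\dots,v_R)\in\mathcal B$ the space $U=\operatorname{span}\{v_1,\dots,v_R\}$ has dimension $R$, and on input any basis of $U$ Algorithm 2, with probability one, outputs exactly one vector, a nonzero scalar multiple of $v_1$. 4. (Running time.) Algorithm 2 runs in time $N^{O(1)}$: there are a random access program with exact arithmetic in $\mathbb F$ at unit cost, which may call an oracle for the diagonalization of matrices, and a constant $C$, both independent of $m,n_1,\dots,n_m,R$ and the input, such that on every input the program carries out Algorithm 2 in at most $C\,N^{C}$ steps with at most $C$ oracle calls. -/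

import Mathlib

open Matrix MeasureTheory

namespace EntangledSubspace

/-! ## Tensors, product tensors, quadrics -/

/-- Coordinate tensors, i.e. elements of `𝕜^{n 0} ⊗ ⋯ ⊗ 𝕜^{n (m-1)}` written in the standard basis:
a tensor is the array of its coordinates. -/
abbrev Tensor (𝕜 : Type*) {m : ℕ} (n : Fin m → ℕ) : Type _ := (∀ i, Fin (n i)) → 𝕜

/-- The total dimension `n 0 ⋯ n (m-1)`. -/
def totalDim {m : ℕ} (n : Fin m → ℕ) : ℕ := ∏ i, n i

/-- The product tensor `x 0 ⊗ ⋯ ⊗ x (m-1)`. -/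
def productTensor {𝕜 : Type*} [CommSemiring 𝕜] {m : ℕ} {n : Fin m → ℕ}
    (x : ∀ i, Fin (n i) → 𝕜) : Tensor 𝕜 n :=
  fun j => ∏ i, x i (j i)

/-- The set of product (separable) tensors. -/
def productTensors (𝕜 : Type*) [CommSemiring 𝕜] {m : ℕ} (n : Fin m → ℕ) : Set (Tensor 𝕜 n) :=
  Set.range productTensor

/-- The number `C(N+1, 2) - ∏ C(n i + 1, 2)`, with `N = ∏ n i`. (The subtraction never truncates
when all `n i` are positive.) -/
def numQuadrics {m : ℕ} (n : Fin m → ℕ) : ℕ :=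
  (totalDim n + 1).choose 2 - ∏ i, (n i + 1).choose 2

/-- The bound `(N + 1) / 2 - (n 0 + 1) ⋯ (n (m-1) + 1) / 2 ^ m` on the dimension. -/
noncomputable def dimBound {m : ℕ} (n : Fin m → ℕ) : ℝ :=
  ((totalDim n : ℝ) + 1) / 2 - (∏ i, ((n i : ℝ) + 1)) / 2 ^ m

/-- `f` is a linearly independent list of quadrics (homogeneous polynomials of degree two) which
cuts out the set `X`. -/
structure CutsOutByQuadrics {𝕜 ι : Type*} [Field 𝕜] {p : ℕ}
    (f : Fin p → MvPolynomial ι 𝕜) (X : Set (ι → 𝕜)) : Prop where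
  homogeneous : ∀ i, (f i).IsHomogeneous 2
  linearIndependent : LinearIndependent 𝕜 f
  zeroSet : {x : ι → 𝕜 | ∀ i, MvPolynomial.eval x (f i) = 0} = X

/-! ## Zariski topology and genericity -/

section Zariski

variable {𝕜 ι : Type*} [Field 𝕜] {R : ℕ}

/-- Zariski closed subsets of the space of `R`-tuples of vectors. -/
def IsZariskiClosed (Z : Set (Fin R → ι → 𝕜)) : Prop :=
  ∃ S : Set (MvPolynomial (Fin R × ι) 𝕜),
    Z = {v | ∀ q ∈ S, MvPolynomial.eval (fun x => v x.1 x.2) q = 0}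

/-- `A` is an open and dense subset of `Y` in the topology on `Y` induced by the Zariski
topology. -/
def IsZariskiOpenDenseIn (A Y : Set (Fin R → ι → 𝕜)) : Prop :=
  (∃ Z, IsZariskiClosed Z ∧ A = Y \ Z) ∧ ∀ Z, IsZariskiClosed Z → A ⊆ Z → Y ⊆ Z

/-- The property `Q` holds for a generically chosen element of `Y`. -/
def HoldsGenerically (Y : Set (Fin R → ι → 𝕜)) (Q : (Fin R → ι → 𝕜) → Prop) : Prop :=
  ∃ A, IsZariskiOpenDenseIn A Y ∧ ∀ v ∈ A, Q v

end Zariski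

/-! ## The algorithms

Each algorithm is given by the relation "`out` is a possible output", because the text of the
algorithms leaves some choices open (the basis, the scaling of eigenvectors, the dual functionals).
Elements of `V ⊗ V` are square matrices, and `x ⊗ y` is `vecMulVec x y`. -/

section Algorithms

variable {𝕜 : Type*} [RCLike 𝕜]

/-- `B` is the Moore-Penrose pseudoinverse of `A`. -/
structure IsPseudoinverse {κ ν : Type*} [Fintype κ] [Fintype ν]
    (A : Matrix κ ν 𝕜) (B : Matrix ν κ 𝕜) : Prop where
  mul_mul_left : A * B * A = A
  mul_mul_right : B * A * B = B
  isHermitian_left : (A * B).IsHermitian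
  isHermitian_right : (B * A).IsHermitian

/-- `A` has rank `r`, and it has `r` distinct nonzero eigenvalues `l 0, …, l (r-1)` in `𝕜`, with
eigenvectors `x 0, …, x (r-1)`. Thus the `l a` are all the nonzero eigenvalues, none of them is
repeated, and `A` is diagonalizable over `𝕜`. -/
structure HasSimpleNonzeroSpectrum {κ : Type*} [Fintype κ] [DecidableEq κ] (A : Matrix κ κ 𝕜)
    {r : ℕ} (l : Fin r → 𝕜) (x : Fin r → κ → 𝕜) : Prop where
  rank_eq : A.rank = r
  injective : Function.Injective l
  ne_zero : ∀ a, l a ≠ 0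
  vec_ne_zero : ∀ a, x a ≠ 0
  eigen : ∀ a, A *ᵥ x a = l a • x a

/-- The contraction `T(φ)` of a `3`-mode tensor with a functional in the first mode. -/
def contract {α κ ν : Type*} [Fintype α] (T : α → Matrix κ ν 𝕜) (φ : α → 𝕜) : Matrix κ ν 𝕜 :=
  ∑ i, φ i • T i

/-- The contraction `T(h)` of a `3`-mode tensor with a functional in the last two modes. -/
def contract₂₃ {α κ ν : Type*} [Fintype κ] [Fintype ν] (T : α → Matrix κ ν 𝕜)
    (h : Matrix κ ν 𝕜) : α → 𝕜 :=
  fun i => ∑ j, ∑ k, h j k * T i j k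

/-- The simultaneous diagonalization algorithm, on input a `3`-mode tensor `T`, with `φ` and `γ`
the random functionals chosen in its first step. The output is `none` ("Fail") or the list of the
triples `(u a, v a, w a)` of a decomposition `T = ∑ a, u a ⊗ v a ⊗ w a`. The second family of
eigenvectors consists of vectors of the third factor `ν → 𝕜`, so it is read off from the transpose
of `T(φ)⁺ T(γ)`, which is an endomorphism of that factor. -/
inductive SimDiagRun {α κ ν : Type*} [Fintype α] [Fintype κ] [DecidableEq κ] [Fintype ν]
    [DecidableEq ν] (T : α → Matrix κ ν 𝕜) (φ γ : α → 𝕜) :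
    Option (List ((α → 𝕜) × (κ → 𝕜) × (ν → 𝕜))) → Prop
  /-- The nonzero eigenvalues of `T(φ) T(γ)⁺` are repeated or not all in `𝕜`. -/
  | failLeft (Y : Matrix ν κ 𝕜) (hY : IsPseudoinverse (contract T γ) Y)
      (hA : ¬ ∃ (r : ℕ) (l : Fin r → 𝕜) (v : Fin r → κ → 𝕜),
        HasSimpleNonzeroSpectrum (contract T φ * Y) l v) :
      SimDiagRun T φ γ none
  /-- The nonzero eigenvalues of `T(φ)⁺ T(γ)` are not the inverses of those of `T(φ) T(γ)⁺`. -/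
  | failRight (X Y : Matrix ν κ 𝕜) (hX : IsPseudoinverse (contract T φ) X)
      (hY : IsPseudoinverse (contract T γ) Y)
      (r : ℕ) (l : Fin r → 𝕜) (v : Fin r → κ → 𝕜)
      (hA : HasSimpleNonzeroSpectrum (contract T φ * Y) l v)
      (hB : ¬ ∃ w : Fin r → ν → 𝕜,
        HasSimpleNonzeroSpectrum (X * contract T γ)ᵀ (fun a => (l a)⁻¹) w) :
      SimDiagRun T φ γ none
  /-- Two of the vectors `u a = T(h a)` are parallel. -/
  | failParallel (X Y : Matrix ν κ 𝕜) (hX : IsPseudoinverse (contract T φ) X)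
      (hY : IsPseudoinverse (contract T γ) Y)
      (r : ℕ) (l : Fin r → 𝕜) (v : Fin r → κ → 𝕜) (w : Fin r → ν → 𝕜)
      (hA : HasSimpleNonzeroSpectrum (contract T φ * Y) l v)
      (hB : HasSimpleNonzeroSpectrum (X * contract T γ)ᵀ (fun a => (l a)⁻¹) w)
      (h : Fin r → Matrix κ ν 𝕜)
      (hdual : ∀ a b, ∑ j, ∑ k, h a j k * (v b j * w b k) = if a = b then 1 else 0)
      (hpar : ∃ a b, a ≠ b ∧
        contract₂₃ T (h a) ∈ Submodule.span 𝕜 {contract₂₃ T (h b)}) :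
      SimDiagRun T φ γ none
  | success (X Y : Matrix ν κ 𝕜) (hX : IsPseudoinverse (contract T φ) X)
      (hY : IsPseudoinverse (contract T γ) Y)
      (r : ℕ) (l : Fin r → 𝕜) (v : Fin r → κ → 𝕜) (w : Fin r → ν → 𝕜)
      (hA : HasSimpleNonzeroSpectrum (contract T φ * Y) l v)
      (hB : HasSimpleNonzeroSpectrum (X * contract T γ)ᵀ (fun a => (l a)⁻¹) w)
      (h : Fin r → Matrix κ ν 𝕜)
      (hdual : ∀ a b, ∑ j, ∑ k, h a j k * (v b j * w b k) = if a = b then 1 else 0)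
      (hpar : ¬ ∃ a b, a ≠ b ∧
        contract₂₃ T (h a) ∈ Submodule.span 𝕜 {contract₂₃ T (h b)}) :
      SimDiagRun T φ γ (some (List.ofFn fun a => (contract₂₃ T (h a), v a, w a)))

/-- The possible outcomes of the algorithms: "`U` trivially intersects `X`", a list of elements of
`U ∩ X`, or "Fail". -/
inductive Outcome (V : Type*)
  | trivial
  | found (l : List V)
  | fail

/-- The vectors that an outcome exhibits. -/
def Outcome.vectors {V : Type*} : Outcome V → List V
  | .found l => l
  | _ => []

/-- Whether the outcome is "`U` trivially intersects `X`". -/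
def Outcome.isTrivial {V : Type*} : Outcome V → Bool
  | .trivial => true
  | _ => false

variable {ι : Type*}

/-- The coefficient of the monomial `x_j x_k` of a quadric. -/
noncomputable def quadCoeff (q : MvPolynomial ι 𝕜) (j k : ι) : 𝕜 :=
  MvPolynomial.coeff (Finsupp.single j 1 + Finsupp.single k 1) q

/-- The symmetric matrix of a quadric, i.e. the quadric as an element of `S²(V*)`. -/
noncomputable def quadMatrix [DecidableEq ι] (q : MvPolynomial ι 𝕜) : Matrix ι ι 𝕜 :=
  fun j k => if j = k then quadCoeff q j k else quadCoeff q j k / 2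

/-- The symmetric square `S²(U) ⊆ S²(V)`, spanned by the squares `x ⊗ x` with `x ∈ U`. -/
def symSquare (U : Submodule 𝕜 (ι → 𝕜)) : Submodule 𝕜 (Matrix ι ι 𝕜) :=
  Submodule.span 𝕜 {M | ∃ x ∈ U, M = vecMulVec x x}

/-- The matrices that are annihilated by all the quadrics `f i`. -/
def quadricsPerp [Fintype ι] [DecidableEq ι] {p : ℕ} (f : Fin p → MvPolynomial ι 𝕜) :
    Submodule 𝕜 (Matrix ι ι 𝕜) where
  carrier := {M | ∀ i, ∑ j, ∑ k, quadMatrix (f i) j k * M j k = 0}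
  add_mem' := by
    intro M M' h h' i
    simp only [Matrix.add_apply, mul_add, Finset.sum_add_distrib]
    rw [h i, h' i, add_zero]
  zero_mem' := by intro i; simp
  smul_mem' := by
    intro c M h i
    have := congrArg (c * ·) (h i)
    simp only [Finset.mul_sum, mul_zero] at this
    rw [← this]
    refine Finset.sum_congr rfl fun j _ => Finset.sum_congr rfl fun k _ => ?_
    simp only [Matrix.smul_apply, smul_eq_mul]
    ring

/-- The space `S²(U) ∩ I₂^⊥` for `U` the span of `u`, and `I₂` the span of `f`. -/
def certSpace [Fintype ι] [DecidableEq ι] {R p : ℕ} (u : Fin R → ι → 𝕜)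
    (f : Fin p → MvPolynomial ι 𝕜) : Submodule 𝕜 (Matrix ι ι 𝕜) :=
  symSquare (Submodule.span 𝕜 (Set.range u)) ⊓ quadricsPerp f

/-- The rank-one tensor `x ⊗ y ⊗ z` in coordinates. -/
def rankOne {α κ ν : Type*} (t : (α → 𝕜) × (κ → 𝕜) × (ν → 𝕜)) : α → κ → ν → 𝕜 :=
  fun i j k => t.1 i * t.2.1 j * t.2.2 k

/-- The list `L` of triples is a decomposition of the tensor `T` into the rank-one tensors
`z a ⊗ v a ⊗ v a`, with `z` and `v` linearly independent. -/
structure IsSquareDecomposition {s : ℕ} (T : Fin s → Matrix ι ι 𝕜)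
    (L : List ((Fin s → 𝕜) × (ι → 𝕜) × (ι → 𝕜))) (z : Fin s → Fin s → 𝕜)
    (v : Fin s → ι → 𝕜) : Prop where
  terms : L.map rankOne = List.ofFn fun a => rankOne (z a, v a, v a)
  sum_eq : ∀ i, T i = ∑ a, z a i • vecMulVec (v a) (v a)
  left_independent : LinearIndependent 𝕜 z
  right_independent : LinearIndependent 𝕜 v

/-- Algorithm 1 for quadrics: on input a basis `u` of `U` and quadrics `f` cutting out `X`, compute
`U ∩ X`. The random functionals used by the simultaneous diagonalization algorithm are the first
coordinates of `φ` and `γ`. -/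
inductive Alg1Run [Fintype ι] [DecidableEq ι] {R p : ℕ} (u : Fin R → ι → 𝕜)
    (f : Fin p → MvPolynomial ι 𝕜) (φ γ : Fin R → 𝕜) : Outcome (ι → 𝕜) → Prop
  | trivial (h : certSpace u f = ⊥) : Alg1Run u f φ γ .trivial
  | tooLarge (h : R < Module.finrank 𝕜 (certSpace u f)) : Alg1Run u f φ γ .fail
  | found (h : certSpace u f ≠ ⊥) (s : ℕ) (hs : s ≤ R) (P : Module.Basis (Fin s) 𝕜 (certSpace u f))
      (L : List ((Fin s → 𝕜) × (ι → 𝕜) × (ι → 𝕜)))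
      (hL : SimDiagRun (fun i => (P i : Matrix ι ι 𝕜)) (fun i => φ (Fin.castLE hs i))
        (fun i => γ (Fin.castLE hs i)) (some L))
      (z : Fin s → Fin s → 𝕜) (v : Fin s → ι → 𝕜)
      (hdec : IsSquareDecomposition (fun i => (P i : Matrix ι ι 𝕜)) L z v) :
      Alg1Run u f φ γ (.found (List.ofFn v))
  | fail (h : certSpace u f ≠ ⊥) (s : ℕ) (hs : s ≤ R) (P : Module.Basis (Fin s) 𝕜 (certSpace u f))
      (o : Option (List ((Fin s → 𝕜) × (ι → 𝕜) × (ι → 𝕜))))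
      (ho : SimDiagRun (fun i => (P i : Matrix ι ι 𝕜)) (fun i => φ (Fin.castLE hs i))
        (fun i => γ (Fin.castLE hs i)) o)
      (hdec : ¬ ∃ L z v, o = some L ∧
        IsSquareDecomposition (fun i => (P i : Matrix ι ι 𝕜)) L z v) :
      Alg1Run u f φ γ .fail

/-- How Algorithm 2 combines the outcomes for the irreducible components: it outputs the elements
that were found, if any; otherwise "trivially intersects" if this was the outcome for every
component; otherwise "Fail". -/
def combineOutcomes {V : Type*} (l : List (Outcome V)) : Outcome V :=
  match l.flatMap Outcome.vectors with
  | [] => if l.all Outcome.isTrivial then .trivial else .fail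
  | x :: xs => .found (x :: xs)

/-- Algorithm 2: run Algorithm 1 on each of the `k` irreducible components of `X`, the `i`-th of
which is cut out by the quadrics `f i`, and combine the outcomes. -/
def Alg2Run [Fintype ι] [DecidableEq ι] {R k : ℕ} (u : Fin R → ι → 𝕜) (p : Fin k → ℕ)
    (f : ∀ i, Fin (p i) → MvPolynomial ι 𝕜) (φ γ : Fin k → Fin R → 𝕜)
    (out : Outcome (ι → 𝕜)) : Prop :=
  ∃ o : Fin k → Outcome (ι → 𝕜),
    (∀ i, Alg1Run u (f i) (φ i) (γ i) (o i)) ∧ out = combineOutcomes (List.ofFn o)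

/-- Algorithm 2 for an irreducible variety, which has the single component cut out by `f`. -/
def Alg2RunIrreducible [Fintype ι] [DecidableEq ι] {R p : ℕ} (u : Fin R → ι → 𝕜)
    (f : Fin p → MvPolynomial ι 𝕜) (φ γ : Fin R → 𝕜) (out : Outcome (ι → 𝕜)) : Prop :=
  Alg2Run (k := 1) u (fun _ => p) (fun _ => f) (fun _ => φ) (fun _ => γ) out

/-- Lebesgue measure on the pairs `(φ, γ)` of functionals. "Almost surely" over the random choices
of the algorithm means: outside a null set of this measure, hence with probability one for every
absolutely continuous distribution. -/
noncomputable def seedMeasure (𝕜 : Type*) [RCLike 𝕜] (R : ℕ) :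
    Measure ((Fin R → 𝕜) × (Fin R → 𝕜)) :=
  (Measure.pi fun _ : Fin R => (Measure.addHaar : Measure 𝕜)).prod
    (Measure.pi fun _ : Fin R => (Measure.addHaar : Measure 𝕜))

end Algorithms

/-! ## The model of computation

Random access programs over `𝕜` with exact arithmetic at unit cost ("real model of computation"),
with counters in `ℕ`, arrays of scalars, and an oracle for the diagonalization of matrices. A program
is a finite text that mentions no scalar constants but `0` and `1`; it works for all input sizes.
All loops are bounded, so every program halts. -/

section Machine

/-- Index expressions: constants, counters, sums and truncated differences. -/
inductive NExp
  | const (c : ℕ)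
  | var (x : ℕ)
  | add (a b : NExp)
  | sub (a b : NExp)

/-- A cell of an array: the name of the array and the list of its indices. -/
structure Cell where
  array : ℕ
  index : List NExp

/-- The arithmetic operations. -/
inductive ArithOp
  | add
  | sub
  | mul
  | div

/-- Programs. -/
inductive Prog
  | skip
  | seq (c d : Prog)
  /-- Assign the value of an index expression to the counter `x`. -/
  | setNat (x : ℕ) (e : NExp)
  /-- Write the scalar `0`. -/
  | setZero (t : Cell)
  /-- Write the scalar `1`. -/
  | setOne (t : Cell)
  | copy (t a : Cell)
  /-- Complex conjugation (which does nothing over the reals). -/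
  | conj (t a : Cell)
  /-- Write the result of an arithmetic operation on the contents of the cells `a`, `b` to `t`. -/
  | arith (o : ArithOp) (t a b : Cell)
  /-- Branch on `e < e'`. -/
  | ifLt (e e' : NExp) (c d : Prog)
  /-- Branch on whether the content of a cell is zero. -/
  | ifZero (a : Cell) (c d : Prog)
  /-- Run `c` for `x = 0, …, e - 1`, with `e` evaluated before the loop. -/
  | loop (x : ℕ) (e : NExp) (c : Prog)
  /-- Call the oracle on the `e × e` matrix in array `a`; write the matrix of eigenvectors to array
  `v`, the eigenvalues to array `l`, and the inverse of the matrix of eigenvectors to array `w`. -/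
  | diagonalize (e : NExp) (a v l w : ℕ)

variable {𝕜 : Type*}

/-- `A = P diag(l) P⁻¹`. -/
def Diagonalizes [Field 𝕜] {k : ℕ} (A P : Matrix (Fin k) (Fin k) 𝕜) (l : Fin k → 𝕜)
    (Q : Matrix (Fin k) (Fin k) 𝕜) : Prop :=
  P * Q = 1 ∧ A = P * Matrix.diagonal l * Q

/-- A diagonalization oracle. For every diagonalizable matrix it returns a diagonalization; nothing
is known about its answers for other matrices. -/
structure DiagOracle (𝕜 : Type*) [Field 𝕜] where
  vectors : ∀ k : ℕ, Matrix (Fin k) (Fin k) 𝕜 → Matrix (Fin k) (Fin k) 𝕜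
  values : ∀ k : ℕ, Matrix (Fin k) (Fin k) 𝕜 → Fin k → 𝕜
  inverse : ∀ k : ℕ, Matrix (Fin k) (Fin k) 𝕜 → Matrix (Fin k) (Fin k) 𝕜
  spec : ∀ (k : ℕ) (A : Matrix (Fin k) (Fin k) 𝕜), (∃ P l Q, Diagonalizes A P l Q) →
    Diagonalizes A (vectors k A) (values k A) (inverse k A)

/-- The memory, the number of steps so far, and the number of oracle calls so far. -/
structure Config (𝕜 : Type*) where
  nat : ℕ → ℕ
  arr : ℕ → List ℕ → 𝕜
  steps : ℕ
  calls : ℕ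

def NExp.eval (ν : ℕ → ℕ) : NExp → ℕ
  | .const c => c
  | .var x => ν x
  | .add a b => a.eval ν + b.eval ν
  | .sub a b => a.eval ν - b.eval ν

def ArithOp.apply [Field 𝕜] : ArithOp → 𝕜 → 𝕜 → 𝕜
  | .add, x, y => x + y
  | .sub, x, y => x - y
  | .mul, x, y => x * y
  | .div, x, y => x / y

namespace Config

/-- Count `t` steps. -/
def tick (s : Config 𝕜) (t : ℕ) : Config 𝕜 := { s with steps := s.steps + t }

def setNat (s : Config 𝕜) (x c : ℕ) : Config 𝕜 :=
  { s with nat := Function.update s.nat x c }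

def read (s : Config 𝕜) (a : Cell) : 𝕜 :=
  s.arr a.array (a.index.map (NExp.eval s.nat))

def write (s : Config 𝕜) (t : Cell) (c : 𝕜) : Config 𝕜 :=
  let idx := t.index.map (NExp.eval s.nat)
  { s with arr := Function.update s.arr t.array (Function.update (s.arr t.array) idx c) }

/-- The `k × k` matrix stored in array `a`. -/
def readMatrix (s : Config 𝕜) (k a : ℕ) : Matrix (Fin k) (Fin k) 𝕜 :=
  fun i j => s.arr a [(i : ℕ), (j : ℕ)]

/-- Store a matrix in array `a`; all other cells are unchanged. -/
def writeMatrix (s : Config 𝕜) {k : ℕ} (a : ℕ) (M : Matrix (Fin k) (Fin k) 𝕜) : Config 𝕜 :=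
  { s with arr := Function.update s.arr a fun idx =>
      match idx with
      | [i, j] => if h : i < k ∧ j < k then M ⟨i, h.1⟩ ⟨j, h.2⟩ else s.arr a [i, j]
      | other => s.arr a other }

/-- Store a vector in array `a`; all other cells are unchanged. -/
def writeVector (s : Config 𝕜) {k : ℕ} (a : ℕ) (x : Fin k → 𝕜) : Config 𝕜 :=
  { s with arr := Function.update s.arr a fun idx =>
      match idx with
      | [i] => if h : i < k then x ⟨i, h⟩ else s.arr a [i]
      | other => s.arr a other }

end Config

open Classical in
/-- Execution of a program. Every elementary instruction, every test and every pass through a loop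
costs one step; an oracle call for a `k × k` matrix costs `1 + k + 3 k ^ 2` steps (the number of
scalars that are moved, plus one) and is also counted as a call. -/
noncomputable def Prog.exec [RCLike 𝕜] (O : DiagOracle 𝕜) : Prog → Config 𝕜 → Config 𝕜
  | .skip, s => s.tick 1
  | .seq c d, s => d.exec O (c.exec O s)
  | .setNat x e, s => (s.setNat x (e.eval s.nat)).tick 1
  | .setZero t, s => (s.write t 0).tick 1
  | .setOne t, s => (s.write t 1).tick 1
  | .copy t a, s => (s.write t (s.read a)).tick 1
  | .conj t a, s => (s.write t (star (s.read a))).tick 1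
  | .arith o t a b, s => (s.write t (o.apply (s.read a) (s.read b))).tick 1
  | .ifLt e e' c d, s =>
      if e.eval s.nat < e'.eval s.nat then c.exec O (s.tick 1) else d.exec O (s.tick 1)
  | .ifZero a c d, s =>
      if s.read a = 0 then c.exec O (s.tick 1) else d.exec O (s.tick 1)
  | .loop x e c, s =>
      (List.range (e.eval s.nat)).foldl (fun s' i => c.exec O ((s'.setNat x i).tick 1)) (s.tick 1)
  | .diagonalize e a v l w, s =>
      let k := e.eval s.nat
      let A := s.readMatrix k a
      let s₁ := (((s.writeMatrix v (O.vectors k A)).writeVector l (O.values k A)).writeMatrix w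
        (O.inverse k A)).tick (1 + k + 3 * k ^ 2)
      { s₁ with calls := s₁.calls + 1 }

/-- The initial configuration on input `R` vectors `u` in `𝕜 ^ N`, `p` quadrics with coefficients `c`
and the random functionals `φ`, `γ`. The counters `0, 1, 2` hold `N, R, p`, and the arrays
`0, 1, 2, 3` hold `u, c, φ, γ`; everything else is zero. -/
def inputConfig [Field 𝕜] {N R p : ℕ} (u : Fin R → Fin N → 𝕜) (c : Fin p → Fin N → Fin N → 𝕜)
    (φ γ : Fin R → 𝕜) : Config 𝕜 where
  nat
    | 0 => N
    | 1 => R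
    | 2 => p
    | _ => 0
  arr
    | 0, [a, j] => if h : a < R ∧ j < N then u ⟨a, h.1⟩ ⟨j, h.2⟩ else 0
    | 1, [i, j, k] => if h : i < p ∧ j < N ∧ k < N then c ⟨i, h.1⟩ ⟨j, h.2.1⟩ ⟨k, h.2.2⟩ else 0
    | 2, [a] => if h : a < R then φ ⟨a, h⟩ else 0
    | 3, [a] => if h : a < R then γ ⟨a, h⟩ else 0
    | _, _ => 0
  steps := 0
  calls := 0

/-- The outcome encoded by a final configuration: counter `3` is `0` for "trivially intersects", `1`
for a list of vectors, and anything else for "Fail"; the number of vectors is in counter `4`, and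
their coordinates are in array `4`. -/
def outputOutcome {N : ℕ} (s : Config 𝕜) : Outcome (Fin N → 𝕜) :=
  if s.nat 3 = 0 then .trivial
  else if s.nat 3 = 1 then
    .found (List.ofFn fun a : Fin (s.nat 4) => fun j : Fin N => s.arr 4 [(a : ℕ), (j : ℕ)])
  else .fail

/-- Transport of an outcome along a map of vectors. -/
def Outcome.map {V W : Type*} (g : V → W) : Outcome V → Outcome W
  | .trivial => .trivial
  | .found l => .found (l.map g)
  | .fail => .fail

/-- The final configuration of the program `P` on tensors `u`, quadrics `f` (given by all their
coefficients) and random functionals `φ`, `γ`. The `N` positions of a tensor are numbered by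
Mathlib's standard bijection `finPiFinEquiv` with `Fin N`. -/
noncomputable def runOnTensors [RCLike 𝕜] (O : DiagOracle 𝕜) (P : Prog) {m : ℕ} {n : Fin m → ℕ}
    {R p : ℕ} (u : Fin R → Tensor 𝕜 n) (f : Fin p → MvPolynomial (∀ i, Fin (n i)) 𝕜)
    (φ γ : Fin R → 𝕜) : Config 𝕜 :=
  P.exec O (inputConfig (N := totalDim n) (fun a j => u a (finPiFinEquiv.symm j))
    (fun i j k => quadCoeff (f i) (finPiFinEquiv.symm j) (finPiFinEquiv.symm k)) φ γ)

/-- The outcome of the run, with the vectors read as tensors. -/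
noncomputable def tensorOutcome {m : ℕ} {n : Fin m → ℕ} (s : Config 𝕜) : Outcome (Tensor 𝕜 n) :=
  (outputOutcome (N := totalDim n) s).map fun x j => x (finPiFinEquiv j)

end Machine

end EntangledSubspace

open EntangledSubspace

set_option linter.unusedSectionVars false

/-! Elements of `V ⊗ V` are matrices. The square `x ⊗ x` lies in `S²(U)` exactly when `x ∈ U`, and
in `I₂^⊥` exactly when all the quadrics vanish at `x`. So `U ∩ X` consists of the `x` with `x ⊗ x`
in `certSpace`. If this space is zero, then `U` meets `X` trivially. If its basis decomposes as `z_a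
⊗ v_a ⊗ v_a` with `z` invertible, then every `v_a ⊗ v_a` lies in it, hence `v_a ∈ U ∩ X`. This is
correctness (`Alg1Run.correct`).

Dimension count. Restricting quadrics to product tensors maps `S²(V*)` onto the tensor product of
the spaces `S²` of the factors, so the quadrics vanishing on `X` form a space of dimension `p = N·B`
(`finrank_ker_restrictCoeffs`, `numQuadrics_cast`). The swap minors among them already cut out `X`.
The hypothesis `R ≤ B` therefore reads `R·N ≤ p`.

Generic subspace. For bilinear forms `B_k` of the quadrics it must be shown that `∑ c_ab B_k(v_a,
v_b) = 0` for all `k` forces the symmetric array `c` to vanish. Fix `i` and weights `h` with `h_i =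
1`. Asking a combination `G = ∑ μ_k B_k` to have every `v_a - h_a v_i` with `a ≠ i` in its radical
imposes `(R-1)N < p` linear conditions on `μ`, so there is a nonzero solution, polynomial in these
differences. Then `G(v_a, v_b) = h_a h_b G(v_i, v_i)`, and generically `G(v_i, v_i) ≠ 0` because
`v_i` is free once the differences are fixed. Hence `∑ c_ab h_a h_b = 0`. Indicators of one and of
two indices as weights give `c = 0` (`exists_poly_weights`, `exists_poly_symmetric_eq_zero`).

Planted tensor. It suffices to find one tuple with `v_0` a basis tensor `e_o` for which only the
multiples of the relation at `(0,0)` survive, since injectivity is an open condition and `X ×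
V^(R-1)` is the image of an affine space (`exists_poly_injective`, `holdsGenerically_of_poly`). The
argument above, with room for `N` more conditions, removes the entries of `c` not involving index
`0`. What remains is a `y = ∑ c_0b v_b` with `B_k(e_o, y) = 0` for all `k`. The swap minors force
the coordinates of `y` at indices differing from `o` in at least two places to vanish. There are at
least `R` of these (`add_le_totalDim`), so `c_0b = 0` for generic `v_b`. Now `certSpace` is the line
through `v_0 ⊗ v_0`, on which simultaneous diagonalization returns a multiple of `v_0` as soon as
the first coordinates of `φ` and `γ` are nonzero.

Running time. An explicit program computes `certSpace` as the kernel of a Gram matrix and `T(γ)⁺`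
from a diagonalization of `T(γ)ᴴ T(γ)`, then diagonalizes `M = T(φ) T(γ)⁺`. It tests only whether
the eigenvectors of `M` for nonzero eigenvalues are valid, simple, `s` in number and decompose `T`
by squares. This is enough: if so, the remaining steps of the algorithm succeed with `w = v`
(`simDiagRun_of_decomposition`); if not, the algorithm has a failing run
(`Alg1Run.fail_of_not_exists`). The number of steps is bounded syntactically (`exec_steps_le`,
`cost_le`). -/

namespace EntangledSubspace

/-! ## Frame properties and running time of programs -/

/-- The program contains no instruction that writes to the array `t`. -/
def Prog.keepsArr (t : ℕ) : Prog → Bool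
  | .skip => true
  | .seq c d => c.keepsArr t && d.keepsArr t
  | .setNat _ _ => true
  | .setZero a => a.array != t
  | .setOne a => a.array != t
  | .copy a _ => a.array != t
  | .conj a _ => a.array != t
  | .arith _ a _ _ => a.array != t
  | .ifLt _ _ c d => c.keepsArr t && d.keepsArr t
  | .ifZero _ c d => c.keepsArr t && d.keepsArr t
  | .loop _ _ c => c.keepsArr t
  | .diagonalize _ _ v l w => v != t && (l != t && w != t)

/-- The program contains no instruction that changes the counter `x`. -/
def Prog.keepsNat (x : ℕ) : Prog → Bool
  | .seq c d => c.keepsNat x && d.keepsNat x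
  | .setNat y _ => y != x
  | .ifLt _ _ c d => c.keepsNat x && d.keepsNat x
  | .ifZero _ c d => c.keepsNat x && d.keepsNat x
  | .loop y _ c => y != x && c.keepsNat x
  | _ => true

/-- A bound for the number of oracle calls, for programs without oracle calls in loops. -/
def Prog.numCalls : Prog → ℕ
  | .seq c d => c.numCalls + d.numCalls
  | .ifLt _ _ c d => c.numCalls + d.numCalls
  | .ifZero _ c d => c.numCalls + d.numCalls
  | .diagonalize _ _ _ _ _ => 1
  | _ => 0

/-- All loops and oracle calls have their size in a counter from the list `L`, no counter from `L`
is changed, and there are no oracle calls in loops. -/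
def Prog.sized (L : List ℕ) : Prog → Bool
  | .seq c d => c.sized L && d.sized L
  | .setNat x _ => !L.contains x
  | .ifLt _ _ c d => c.sized L && d.sized L
  | .ifZero _ c d => c.sized L && d.sized L
  | .loop x (.var y) c => !L.contains x && (L.contains y && (c.sized L && c.numCalls == 0))
  | .loop _ _ _ => false
  | .diagonalize (.var y) _ _ _ _ => L.contains y
  | .diagonalize _ _ _ _ _ => false
  | _ => true

/-- A bound for the number of steps, when all sizes are at most `K`. -/
def Prog.cost (K : ℕ) : Prog → ℕ
  | .seq c d => c.cost K + d.cost K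
  | .ifLt _ _ c d => 1 + (c.cost K + d.cost K)
  | .ifZero _ c d => 1 + (c.cost K + d.cost K)
  | .loop _ _ c => 1 + K * (1 + c.cost K)
  | .diagonalize _ _ _ _ _ => 1 + K + 3 * K ^ 2
  | _ => 1

section Exec

variable {𝕜 : Type*} [RCLike 𝕜] (O : DiagOracle 𝕜)

/-- The rule for loop invariants: `I i` is the state after `i` passes. The number of passes is fixed
before the loop, so the proof is induction on the prefixes of `List.range`. -/
theorem exec_loop_induction {x : ℕ} {e : NExp} {c : Prog} {s : Config 𝕜}
    (I : ℕ → Config 𝕜 → Prop) (h0 : I 0 (s.tick 1))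
    (hs : ∀ i < e.eval s.nat, ∀ t, I i t → I (i + 1) (c.exec O ((t.setNat x i).tick 1))) :
    I (e.eval s.nat) ((Prog.loop x e c).exec O s) := by
  have key : ∀ n ≤ e.eval s.nat, I n ((List.range n).foldl
      (fun s' i => c.exec O ((s'.setNat x i).tick 1)) (s.tick 1)) := by
    intro n
    induction n with
    | zero => intro _; simpa using h0
    | succ n ih =>
      intro hn
      rw [List.range_succ, List.foldl_append]
      exact hs n (by omega) _ (ih (by omega))
  simpa [Prog.exec] using key _ le_rfl

theorem exec_arr_eq {t : ℕ} {c : Prog} (h : c.keepsArr t = true) (s : Config 𝕜) :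
    (c.exec O s).arr t = s.arr t := by
  induction c generalizing s with
  | skip => rfl
  | seq c d hc hd =>
    simp only [Prog.keepsArr, Bool.and_eq_true] at h
    simp only [Prog.exec]
    rw [hd h.2, hc h.1]
  | setNat x e => rfl
  | setZero a | setOne a | copy a | conj a | arith o a =>
    simp only [Prog.keepsArr, bne_iff_ne] at h
    simp [Prog.exec, Config.write, Config.tick, Function.update_of_ne h.symm]
  | ifLt e e' c d hc hd | ifZero a c d hc hd =>
    simp only [Prog.keepsArr, Bool.and_eq_true] at h
    simp only [Prog.exec]
    split_ifs
    · rw [hc h.1]; rfl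
    · rw [hd h.2]; rfl
  | loop x e c hc =>
    refine exec_loop_induction O (fun _ u => u.arr t = s.arr t) rfl ?_
    intro i _ u hu
    rw [hc h]; exact hu
  | diagonalize e a v l w =>
    simp only [Prog.keepsArr, Bool.and_eq_true, bne_iff_ne] at h
    simp [Prog.exec, Config.writeMatrix, Config.writeVector, Config.tick,
      Function.update_of_ne h.1.symm, Function.update_of_ne h.2.1.symm,
      Function.update_of_ne h.2.2.symm]

theorem exec_nat_eq {x : ℕ} {c : Prog} (h : c.keepsNat x = true) (s : Config 𝕜) :
    (c.exec O s).nat x = s.nat x := by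
  induction c generalizing s with
  | skip => rfl
  | seq c d hc hd =>
    simp only [Prog.keepsNat, Bool.and_eq_true] at h
    simp only [Prog.exec]
    rw [hd h.2, hc h.1]
  | setNat y e =>
    simp only [Prog.keepsNat, bne_iff_ne] at h
    simp [Prog.exec, Config.setNat, Config.tick, Function.update_of_ne h.symm]
  | setZero a | setOne a | copy a | conj a | arith o a => rfl
  | ifLt e e' c d hc hd | ifZero a c d hc hd =>
    simp only [Prog.keepsNat, Bool.and_eq_true] at h
    simp only [Prog.exec]
    split_ifs
    · rw [hc h.1]; rfl
    · rw [hd h.2]; rfl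
  | loop y e c hc =>
    simp only [Prog.keepsNat, Bool.and_eq_true, bne_iff_ne] at h
    refine exec_loop_induction O (fun _ u => u.nat x = s.nat x) rfl ?_
    intro i _ u hu
    rw [hc h.2]
    simp [Config.setNat, Config.tick, Function.update_of_ne h.1.symm, hu]
  | diagonalize e a v l w => rfl

theorem keepsNat_of_sized {L : List ℕ} {x : ℕ} (hx : L.contains x = true) {c : Prog}
    (h : c.sized L = true) : c.keepsNat x = true := by
  have aux : ∀ y, (!L.contains y) = true → (y != x) = true := by
    intro y hy
    rw [bne_iff_ne]
    rintro rfl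
    rw [hx] at hy
    exact absurd hy (by decide)
  induction c with
  | seq c d hc hd | ifLt _ _ c d hc hd | ifZero _ c d hc hd =>
    simp only [Prog.sized, Bool.and_eq_true] at h
    simp [Prog.keepsNat, hc h.1, hd h.2]
  | setNat y e => exact aux y h
  | loop y e c hc =>
    cases e <;> simp only [Prog.sized, Bool.and_eq_true, Bool.false_eq_true] at h
    simp only [Prog.keepsNat, Bool.and_eq_true]
    exact ⟨aux y h.1, hc h.2.2.1⟩
  | _ => rfl

/-- The counters in `L` hold all sizes and are never changed, so the bound `K` on them remains valid
during the run and the cost can be read off the program text. Oracle calls are excluded from loops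
because their number must not grow with the input. -/
theorem exec_steps_le {L : List ℕ} {K : ℕ} {c : Prog} (h : c.sized L = true) (s : Config 𝕜)
    (hs : ∀ x, L.contains x = true → s.nat x ≤ K) :
    (c.exec O s).steps ≤ s.steps + c.cost K ∧ (c.exec O s).calls ≤ s.calls + c.numCalls := by
  induction c generalizing s with
  | skip | setNat | setZero a | setOne a | copy a | conj a | arith o a =>
    exact ⟨le_rfl, le_rfl⟩
  | seq c d hc hd =>
    simp only [Prog.sized, Bool.and_eq_true] at h
    simp only [Prog.exec, Prog.cost, Prog.numCalls]
    have h1 := hc h.1 s hs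
    have h2 := hd h.2 (c.exec O s) fun x hx => by
      rw [exec_nat_eq O (keepsNat_of_sized hx h.1)]; exact hs x hx
    omega
  | ifLt e e' c d hc hd | ifZero a c d hc hd =>
    simp only [Prog.sized, Bool.and_eq_true] at h
    simp only [Prog.exec, Prog.cost, Prog.numCalls]
    have h1 := hc h.1 (s.tick 1) hs
    have h2 := hd h.2 (s.tick 1) hs
    simp only [Config.tick] at h1 h2 ⊢
    split_ifs <;> omega
  | loop y e c hc =>
    cases e <;> simp only [Prog.sized, Bool.and_eq_true, Bool.false_eq_true] at h
    rename_i z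
    obtain ⟨hy, hz, hc', hn⟩ := h
    have hn' : c.numCalls = 0 := by simpa using hn
    have key := exec_loop_induction O (x := y) (e := .var z) (c := c) (s := s)
      (fun i u => u.steps ≤ s.steps + (1 + i * (1 + c.cost K)) ∧ u.calls ≤ s.calls ∧
        ∀ x, L.contains x = true → u.nat x ≤ K) ⟨by simp [Config.tick], le_rfl, hs⟩ (by
      rintro i - u ⟨h1, h2, h3⟩
      have hu : ∀ x, L.contains x = true → ((u.setNat y i).tick 1).nat x ≤ K := by
        intro x hx
        have hxy : x ≠ y := by rintro rfl; rw [hx] at hy; exact absurd hy (by decide)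
        simpa [Config.setNat, Config.tick, Function.update_of_ne hxy] using h3 x hx
      have h4 := hc hc' ((u.setNat y i).tick 1) hu
      refine ⟨?_, ?_, ?_⟩
      · have h5 : ((u.setNat y i).tick 1).steps = u.steps + 1 := rfl
        rw [h5] at h4
        have := h4.1
        nlinarith
      · have h5 : ((u.setNat y i).tick 1).calls = u.calls := rfl
        omega
      · intro x hx
        rw [exec_nat_eq O (keepsNat_of_sized hx hc')]; exact hu x hx)
    obtain ⟨h1, h2, -⟩ := key
    refine ⟨h1.trans ?_, h2.trans (by simp [Prog.numCalls])⟩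
    have : NExp.eval s.nat (.var z) ≤ K := hs z hz
    simp only [Prog.cost]
    gcongr
  | diagonalize e a v l w =>
    cases e <;> simp only [Prog.sized, Bool.false_eq_true] at h
    rename_i z
    have hz : s.nat z ≤ K := hs z h
    refine ⟨?_, le_rfl⟩
    simp only [Prog.exec, Prog.cost, Config.writeMatrix, Config.writeVector, Config.tick, NExp.eval]
    gcongr

end Exec

/-- Each level of loop nesting contributes one factor `K`. A single constant serves as coefficient
and exponent, which only weakens the bound when `K ≥ 1`. -/
theorem cost_le (c : Prog) : ∃ C : ℕ, ∀ K, 1 ≤ K → c.cost K ≤ C * K ^ C := by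
  have mono : ∀ {a C D K : ℕ}, 1 ≤ K → C ≤ D → a ≤ C * K ^ C → a ≤ D * K ^ D := by
    intro a C D K hK hCD h
    exact h.trans (Nat.mul_le_mul hCD (Nat.pow_le_pow_right hK hCD))
  have one : ∀ {C K : ℕ}, 1 ≤ K → 1 ≤ C → 1 ≤ C * K ^ C := by
    intro C K hK hC
    exact Nat.one_le_iff_ne_zero.2 (by positivity)
  have two : ∀ c d : Prog, (∃ C : ℕ, ∀ K, 1 ≤ K → c.cost K ≤ C * K ^ C) →
      (∃ C : ℕ, ∀ K, 1 ≤ K → d.cost K ≤ C * K ^ C) →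
      ∃ C : ℕ, ∀ K, 1 ≤ K → 1 + (c.cost K + d.cost K) ≤ C * K ^ C := by
    rintro c d ⟨C, hC⟩ ⟨D, hD⟩
    refine ⟨1 + (C + D), fun K hK => ?_⟩
    have h1 : K ^ C ≤ K ^ (1 + (C + D)) := Nat.pow_le_pow_right hK (by omega)
    have h2 : K ^ D ≤ K ^ (1 + (C + D)) := Nat.pow_le_pow_right hK (by omega)
    have h3 : 1 ≤ K ^ (1 + (C + D)) := Nat.one_le_pow _ _ hK
    have := hC K hK
    have := hD K hK
    have := Nat.mul_le_mul_left C h1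
    have := Nat.mul_le_mul_left D h2
    rw [add_mul, add_mul, one_mul]
    omega
  induction c with
  | seq c d hc hd =>
    obtain ⟨C, hC⟩ := two c d hc hd
    exact ⟨C, fun K hK => le_trans (by simp only [Prog.cost]; omega) (hC K hK)⟩
  | ifLt _ _ c d hc hd | ifZero _ c d hc hd => exact two c d hc hd
  | loop x e c hc =>
    obtain ⟨C, hC⟩ := hc
    refine ⟨C + 2, fun K hK => ?_⟩
    have h1 := hC K hK
    have h3 : 1 ≤ K ^ C := Nat.one_le_pow _ _ hK
    simp only [Prog.cost]
    calc 1 + K * (1 + c.cost K) ≤ K * K ^ C + K * (K ^ C + C * K ^ C) := by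
          have : 1 ≤ K * K ^ C := Nat.mul_pos hK h3
          gcongr
      _ = (C + 2) * K ^ (C + 1) := by ring
      _ ≤ (C + 2) * K ^ (C + 2) := Nat.mul_le_mul_left _ (Nat.pow_le_pow_right hK (by omega))
  | diagonalize e a v l w =>
    refine ⟨5, fun K hK => ?_⟩
    simp only [Prog.cost]
    have h1 : K ≤ K ^ 5 := by simpa using Nat.pow_le_pow_right hK (show 1 ≤ 5 by omega)
    have h2 : K ^ 2 ≤ K ^ 5 := Nat.pow_le_pow_right hK (by omega)
    omega
  | _ => exact ⟨1, fun K hK => one hK le_rfl⟩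

end EntangledSubspace

namespace EntangledSubspace

/-! ## Compilation of scalar expressions -/

/-- Scalar expressions. The summation index of `sum x e`, which runs through the numbers below the
content of the counter `x`, is the counter whose number is the current nesting level. -/
inductive SExp
  | one
  | cell (a : Cell)
  | arith (o : ArithOp) (e f : SExp)
  | conj (e : SExp)
  /-- The inverse, with value `0` at `0`. -/
  | inv (e : SExp)
  | sum (x : ℕ) (e : SExp)

/-- All counters of the index expression have numbers below `k`. -/
def NExp.usesBelow (k : ℕ) : NExp → Bool
  | .const _ => true
  | .var x => decide (x < k)
  | .add a b => a.usesBelow k && b.usesBelow k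
  | .sub a b => a.usesBelow k && b.usesBelow k

namespace SExp

/-- The value of an expression at nesting level `k`. -/
def eval {𝕜 : Type*} [RCLike 𝕜] (arr : ℕ → List ℕ → 𝕜) : SExp → ℕ → (ℕ → ℕ) → 𝕜
  | one, _, _ => 1
  | cell a, _, ν => arr a.array (a.index.map (NExp.eval ν))
  | arith o e f, k, ν => o.apply (e.eval arr k ν) (f.eval arr k ν)
  | conj e, k, ν => star (e.eval arr k ν)
  | inv e, k, ν => (e.eval arr k ν)⁻¹
  | sum x e, k, ν => ∑ i ∈ Finset.range (ν x), e.eval arr (k + 1) (Function.update ν k i)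

/-- All counters that are free at level `k` have numbers below `k`. -/
def closedAt : ℕ → SExp → Bool
  | _, one => true
  | k, cell a => a.index.all (NExp.usesBelow k)
  | k, arith _ e f => e.closedAt k && f.closedAt k
  | k, conj e => e.closedAt k
  | k, inv e => e.closedAt k
  | k, sum x e => decide (x < k) && e.closedAt (k + 1)

/-- The expression does not refer to the array `t`. -/
def avoids (t : ℕ) : SExp → Bool
  | one => true
  | cell a => a.array != t
  | arith _ e f => e.avoids t && f.avoids t
  | conj e => e.avoids t
  | inv e => e.avoids t
  | sum _ e => e.avoids t

/-- The registers for intermediate results. -/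
def reg (d : ℕ) : Cell := ⟨30, [.const d]⟩

/-- A program that computes the value of an expression into the register `d`. -/
def compile : SExp → ℕ → ℕ → Prog
  | one, _, d => .setOne (reg d)
  | cell a, _, d => .copy (reg d) a
  | arith o e f, k, d =>
      .seq (e.compile k d) (.seq (f.compile k (d + 1)) (.arith o (reg d) (reg d) (reg (d + 1))))
  | conj e, k, d => .seq (e.compile k d) (.conj (reg d) (reg d))
  | inv e, k, d => .seq (e.compile k d) (.ifZero (reg d) .skip
      (.seq (.setOne (reg (d + 1))) (.arith .div (reg d) (reg (d + 1)) (reg d))))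
  | sum x e, k, d =>
      .seq (.setZero (reg d)) (.loop k (.var x)
        (.seq (e.compile (k + 1) (d + 1)) (.arith .add (reg d) (reg d) (reg (d + 1)))))

end SExp

theorem NExp.eval_congr {k : ℕ} {e : NExp} (h : e.usesBelow k = true) {ν ν' : ℕ → ℕ}
    (hν : ∀ x < k, ν x = ν' x) : e.eval ν = e.eval ν' := by
  induction e with
  | const c => rfl
  | var x => exact hν x (by simpa [usesBelow] using h)
  | add a b ha hb | sub a b ha hb =>
    simp only [usesBelow, Bool.and_eq_true] at h
    simp only [eval, ha h.1, hb h.2]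

theorem NExp.map_eval_congr {k : ℕ} {l : List NExp} (h : l.all (NExp.usesBelow k) = true)
    {ν ν' : ℕ → ℕ} (hν : ∀ x < k, ν x = ν' x) : l.map (NExp.eval ν) = l.map (NExp.eval ν') := by
  rw [List.all_eq_true] at h
  exact List.map_congr_left fun e he => NExp.eval_congr (h e he) hν

section Exec

variable {𝕜 : Type*} [RCLike 𝕜] (O : DiagOracle 𝕜)

theorem SExp.eval_congr {e : SExp} {k : ℕ} (h : e.closedAt k = true) {ν ν' : ℕ → ℕ}
    (hν : ∀ x < k, ν x = ν' x) {arr arr' : ℕ → List ℕ → 𝕜}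
    (ha : ∀ t, e.avoids t = false → arr t = arr' t) : e.eval arr k ν = e.eval arr' k ν' := by
  induction e generalizing k ν ν' with
  | one => rfl
  | cell a =>
    simp only [eval]
    rw [ha a.array (by simp [avoids]), NExp.map_eval_congr h hν]
  | arith o e f he hf =>
    simp only [closedAt, Bool.and_eq_true] at h
    simp only [avoids, Bool.and_eq_false_iff] at ha
    simp only [eval, he h.1 hν fun t ht => ha t (.inl ht), hf h.2 hν fun t ht => ha t (.inr ht)]
  | conj e he => simp only [eval, he h hν ha]
  | inv e he => simp only [eval, he h hν ha]
  | sum x e he =>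
    simp only [closedAt, Bool.and_eq_true, decide_eq_true_eq] at h
    simp only [eval]
    rw [hν x h.1]
    refine Finset.sum_congr rfl fun i _ => he h.2 (fun y hy => ?_) ha
    by_cases hyk : y = k
    · simp [hyk]
    · simp [Function.update_of_ne hyk, hν y (by omega)]

theorem SExp.keepsArr_compile (e : SExp) (k d : ℕ) {t : ℕ} (ht : t ≠ 30) :
    (e.compile k d).keepsArr t = true := by
  have : (30 != t) = true := by simpa using ht.symm
  induction e generalizing k d with
  | _ => simp_all [compile, Prog.keepsArr, reg]

theorem SExp.keepsNat_compile (e : SExp) {k : ℕ} (d : ℕ) {x : ℕ} (hx : x < k) :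
    (e.compile k d).keepsNat x = true := by
  induction e generalizing k d with
  | sum y e he =>
    have : (k != x) = true := by simpa using hx.ne'
    simp [compile, Prog.keepsNat, this, he (d + 1) (Nat.lt_succ_of_lt hx)]
  | _ => simp_all [compile, Prog.keepsNat]

/-- Registers are used as a stack. That registers below `d` survive is what makes the induction
work: the second operand and the summands are computed at level `d + 1` while register `d` holds the
first operand or the partial sum. -/
theorem exec_compile {e : SExp} {k : ℕ} (d : ℕ) (h : e.closedAt k = true)
    (h30 : e.avoids 30 = true) (s : Config 𝕜) :
    ((e.compile k d).exec O s).arr 30 [d] = e.eval s.arr k s.nat ∧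
      ∀ d' < d, ((e.compile k d).exec O s).arr 30 [d'] = s.arr 30 [d'] := by
  have ne : ∀ {t : ℕ} {e : SExp}, e.avoids 30 = true → e.avoids t = false → t ≠ 30 := by
    rintro t e h h' rfl
    rw [h] at h'
    exact absurd h' (by decide)
  induction e generalizing k d s with
  | one =>
    refine ⟨by simp [SExp.compile, Prog.exec, Config.write, Config.tick, SExp.reg, SExp.eval,
      NExp.eval], fun d' hd' => ?_⟩
    simp [SExp.compile, Prog.exec, Config.write, Config.tick, SExp.reg, NExp.eval,
      hd'.ne]
  | cell a =>
    refine ⟨by simp [SExp.compile, Prog.exec, Config.write, Config.read, Config.tick, SExp.reg,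
      SExp.eval, NExp.eval], fun d' hd' => ?_⟩
    simp [SExp.compile, Prog.exec, Config.write, Config.tick, SExp.reg, NExp.eval,
      hd'.ne]
  | arith o e f he hf =>
    simp only [SExp.closedAt, Bool.and_eq_true] at h
    simp only [SExp.avoids, Bool.and_eq_true] at h30
    obtain ⟨e1, e2⟩ := he d h.1 h30.1 s
    obtain ⟨f1, f2⟩ := hf (d + 1) h.2 h30.2 ((e.compile k d).exec O s)
    have hfe : f.eval ((e.compile k d).exec O s).arr k ((e.compile k d).exec O s).nat =
        f.eval s.arr k s.nat :=
      SExp.eval_congr h.2 (fun x hx => exec_nat_eq O (e.keepsNat_compile d hx) s)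
        fun t ht => exec_arr_eq O (e.keepsArr_compile k d (ne h30.2 ht)) s
    constructor
    · simp [SExp.compile, Prog.exec, Config.write, Config.tick, SExp.reg, Config.read, NExp.eval,
        SExp.eval, f1, f2 d (by omega), e1, hfe]
    · intro d' hd'
      simp [SExp.compile, Prog.exec, Config.write, Config.tick, SExp.reg, NExp.eval,
        hd'.ne, f2 d' (by omega), e2 d' hd']
  | conj e he =>
    obtain ⟨e1, e2⟩ := he d h h30 s
    constructor
    · simp [SExp.compile, Prog.exec, Config.write, Config.tick, SExp.reg, Config.read, NExp.eval,
        SExp.eval, e1]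
    · intro d' hd'
      simp [SExp.compile, Prog.exec, Config.write, Config.tick, SExp.reg, NExp.eval,
        hd'.ne, e2 d' hd']
  | inv e he =>
    obtain ⟨e1, e2⟩ := he d h h30 s
    constructor
    · by_cases h0 : e.eval s.arr k s.nat = 0
      · simp [SExp.compile, Prog.exec, h0, SExp.eval, Config.tick, Config.read, SExp.reg,
          NExp.eval, e1]
      · simp [SExp.compile, Prog.exec, h0, SExp.eval, Config.tick, Config.write, Config.read,
          SExp.reg, NExp.eval, e1, ArithOp.apply]
    · intro d' hd'
      by_cases h0 : e.eval s.arr k s.nat = 0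
      · simp [SExp.compile, Prog.exec, h0, Config.tick, Config.read, SExp.reg, NExp.eval, e1,
          e2 d' hd']
      · simp [SExp.compile, Prog.exec, h0, Config.tick, Config.write, Config.read, e1, SExp.reg,
          NExp.eval, e2 d' hd', hd'.ne, (Nat.lt_succ_of_lt hd').ne]
  | sum x e he =>
    simp only [SExp.closedAt, Bool.and_eq_true, decide_eq_true_eq] at h
    set s₀ : Config 𝕜 := (Prog.setZero (SExp.reg d)).exec O s with hs₀
    have h0 : s₀.arr 30 [d] = 0 := by
      simp [hs₀, Prog.exec, Config.write, Config.tick, SExp.reg, NExp.eval]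
    have h0' : ∀ d' < d, s₀.arr 30 [d'] = s.arr 30 [d'] := by
      intro d' hd'
      simp [hs₀, Prog.exec, Config.write, Config.tick, SExp.reg, NExp.eval,
        hd'.ne]
    have h0a : ∀ t ≠ 30, s₀.arr t = s.arr t := fun t ht =>
      exec_arr_eq O (by simpa [Prog.keepsArr, SExp.reg] using ht.symm) s
    have hn : s₀.nat = s.nat := rfl
    have key := exec_loop_induction O (x := k) (e := .var x) (s := s₀)
      (c := .seq (e.compile (k + 1) (d + 1)) (.arith .add (SExp.reg d) (SExp.reg d)
        (SExp.reg (d + 1))))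
      (fun i u => u.arr 30 [d] = ∑ j ∈ Finset.range i,
          e.eval s.arr (k + 1) (Function.update s.nat k j) ∧
        (∀ d' < d, u.arr 30 [d'] = s.arr 30 [d']) ∧ (∀ t ≠ 30, u.arr t = s.arr t) ∧
        ∀ y < k, u.nat y = s.nat y)
      ⟨by simpa [Config.tick] using h0, h0', h0a, fun y _ => by rw [← hn]; rfl⟩ (by
      rintro i - u ⟨u1, u2, u3, u4⟩
      set v : Config 𝕜 := (u.setNat k i).tick 1 with hv
      have hva : v.arr = u.arr := rfl
      have hvn : ∀ y < k + 1, v.nat y = Function.update s.nat k i y := by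
        intro y hy
        by_cases hyk : y = k
        · simp [hv, hyk, Config.tick, Config.setNat]
        · simp [hv, Config.tick, Config.setNat, Function.update_of_ne hyk, u4 y (by omega)]
      obtain ⟨e1, e2⟩ := he (d + 1) h.2 h30 v
      have e3 : e.eval v.arr (k + 1) v.nat =
          e.eval s.arr (k + 1) (Function.update s.nat k i) :=
        SExp.eval_congr h.2 hvn fun t ht => u3 t (ne (e := e) h30 ht)
      rw [e3] at e1
      refine ⟨?_, ?_, ?_, ?_⟩
      · simp [Prog.exec, Config.write, Config.tick, SExp.reg, Config.read, NExp.eval, e1,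
          e2 d (by omega), ArithOp.apply, Finset.sum_range_succ, hva, u1]
      · intro d' hd'
        simp [Prog.exec, Config.write, Config.tick, SExp.reg, NExp.eval,
          hd'.ne, e2 d' (by omega), hva, u2 d' hd']
      · intro t ht
        rw [exec_arr_eq O (t := t) _ v, hva, u3 t ht]
        simpa [Prog.keepsArr, SExp.reg, e.keepsArr_compile (k + 1) (d + 1) ht] using ht.symm
      · intro y hy
        rw [exec_nat_eq O (x := y) _ v, hvn y (by omega), Function.update_of_ne hy.ne]
        simp [Prog.keepsNat, e.keepsNat_compile (d + 1) (Nat.lt_succ_of_lt hy)])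
    have hx : NExp.eval s₀.nat (.var x) = s.nat x := rfl
    rw [hx] at key
    exact ⟨key.1, key.2.1⟩

/-! ## Filling arrays, testing equations, and collecting indices -/

/-- Write the values of the expression `e` to the cells of array `t` with indices
`pre ++ [i₁, …, iᵣ]`, for all `iⱼ` below the content of the `j`-th counter in the list. -/
def fill (t : ℕ) (e : SExp) : ℕ → List ℕ → List NExp → Prog
  | k, [], pre => .seq (e.compile k 0) (.copy ⟨t, pre⟩ (SExp.reg 0))
  | k, x :: xs, pre => .loop k (.var x) (fill t e (k + 1) xs (pre ++ [.var k]))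

/-- Write `1` to the cell `[]` of array `t`, unless the expression `e` vanishes for all values
of its indices. -/
def check (t : ℕ) (e : SExp) : ℕ → List ℕ → Prog
  | k, [] => .seq (e.compile k 0) (.ifZero (SExp.reg 0) .skip (.setOne ⟨t, []⟩))
  | k, x :: xs => .loop k (.var x) (check t e (k + 1) xs)

/-- Run `body` for all indices below the content of the counter `x` at which `test` vanishes,
counting them with the counter `r`. -/
def collect (r x k : ℕ) (test : SExp) (body : Prog) : Prog :=
  .seq (.setNat r (.const 0)) (.loop k (.var x) (.seq (test.compile (k + 1) 0)
    (.ifZero (SExp.reg 0) (.seq body (.setNat r (.add (.var r) (.const 1)))) .skip)))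

/-- The value of an expression, with the counters from `k` on set to given numbers. -/
def SExp.evalAt (arr : ℕ → List ℕ → 𝕜) (e : SExp) : ℕ → (ℕ → ℕ) → List ℕ → 𝕜
  | k, ν, [] => e.eval arr k ν
  | k, ν, w :: ws => e.evalAt arr (k + 1) (Function.update ν k w) ws

theorem SExp.evalAt_congr {e : SExp} {k : ℕ} {ws : List ℕ} (h : e.closedAt (k + ws.length) = true)
    {ν ν' : ℕ → ℕ} (hν : ∀ x < k, ν x = ν' x) {arr arr' : ℕ → List ℕ → 𝕜}
    (ha : ∀ t, e.avoids t = false → arr t = arr' t) :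
    e.evalAt arr k ν ws = e.evalAt arr' k ν' ws := by
  induction ws generalizing k ν ν' with
  | nil => exact SExp.eval_congr h hν ha
  | cons w ws ih =>
    refine ih (by
      rwa [List.length_cons, show k + (ws.length + 1) = k + 1 + ws.length by omega] at h) fun x hx => ?_
    by_cases hxk : x = k
    · simp [hxk]
    · simp [Function.update_of_ne hxk, hν x (by omega)]

theorem keepsArr_fill {t u : ℕ} (hu : u ≠ 30) (hut : u ≠ t) (e : SExp) (k : ℕ) (xs : List ℕ)
    (pre : List NExp) : (fill t e k xs pre).keepsArr u = true := by
  induction xs generalizing k pre with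
  | nil => simpa [fill, Prog.keepsArr, e.keepsArr_compile k 0 hu] using hut.symm
  | cons x xs ih => simp [fill, Prog.keepsArr, ih]

theorem keepsNat_fill {t x k : ℕ} (hx : x < k) (e : SExp) (xs : List ℕ)
    (pre : List NExp) : (fill t e k xs pre).keepsNat x = true := by
  induction xs generalizing k pre with
  | nil => simp [fill, Prog.keepsNat, e.keepsNat_compile 0 hx]
  | cons y xs ih => simp [fill, Prog.keepsNat, ih (Nat.lt_succ_of_lt hx), hx.ne']

/-- The second conclusion, that cells outside the addressed block are untouched, is needed when an
array is filled block by block, with the block number in `pre`. -/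
theorem exec_fill {t : ℕ} {e : SExp} {k : ℕ} {xs : List ℕ} {pre : List NExp}
    (ht : t ≠ 30) (h : e.closedAt (k + xs.length) = true) (h30 : e.avoids 30 = true)
    (het : e.avoids t = true) (hxs : ∀ x ∈ xs, x < k) (hpre : pre.all (NExp.usesBelow k) = true)
    (s : Config 𝕜) :
    (∀ ws, List.Forall₂ (fun w x => w < s.nat x) ws xs →
      ((fill t e k xs pre).exec O s).arr t (pre.map (NExp.eval s.nat) ++ ws) =
        e.evalAt s.arr k s.nat ws) ∧
    ∀ l, (∀ ws, List.Forall₂ (fun w x => w < s.nat x) ws xs →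
        l ≠ pre.map (NExp.eval s.nat) ++ ws) →
      ((fill t e k xs pre).exec O s).arr t l = s.arr t l := by
  have ne : ∀ {u : ℕ}, e.avoids u = false → u ≠ 30 ∧ u ≠ t := by
    intro u h'
    constructor <;> rintro rfl <;> simp_all
  induction xs generalizing k pre s with
  | nil =>
    obtain ⟨e1, -⟩ := exec_compile O 0 h h30 s
    have h2 : ((e.compile k 0).exec O s).arr t = s.arr t :=
      exec_arr_eq O (e.keepsArr_compile k 0 ht) s
    have h3 : pre.map (NExp.eval ((e.compile k 0).exec O s).nat) = pre.map (NExp.eval s.nat) :=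
      NExp.map_eval_congr hpre fun x hx => exec_nat_eq O (e.keepsNat_compile 0 hx) s
    constructor
    · rintro ws hws
      rw [List.forall₂_nil_right_iff] at hws
      subst hws
      have e1' : ((e.compile k 0).exec O s).arr (SExp.reg 0).array
          ((SExp.reg 0).index.map (NExp.eval ((e.compile k 0).exec O s).nat)) =
          e.eval s.arr k s.nat := e1
      simp [fill, Prog.exec, Config.write, Config.tick, Config.read, h3, e1', SExp.evalAt]
    · intro l hl
      have := hl [] List.Forall₂.nil
      rw [List.append_nil] at this
      simp [fill, Prog.exec, Config.write, Config.tick, h3, Function.update_of_ne this, h2]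
  | cons x xs ih =>
    have hlen : e.closedAt (k + 1 + xs.length) = true := by
      rwa [List.length_cons, show k + (xs.length + 1) = k + 1 + xs.length by omega] at h
    have hpre' : (pre ++ [NExp.var k]).all (NExp.usesBelow (k + 1)) = true := by
      rw [List.all_append, Bool.and_eq_true]
      refine ⟨?_, by simp [NExp.usesBelow]⟩
      rw [List.all_eq_true] at hpre ⊢
      intro a ha
      have := hpre a ha
      clear * - this
      induction a with
      | const c => rfl
      | var x => simp only [NExp.usesBelow, decide_eq_true_eq] at this ⊢; omega
      | add a b ha hb | sub a b ha hb =>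
        simp only [NExp.usesBelow, Bool.and_eq_true] at this ⊢
        exact ⟨ha this.1, hb this.2⟩
    have hkx : ∀ y ∈ xs, y < k := fun y hy => hxs y (List.mem_cons_of_mem _ hy)
    set q := pre.map (NExp.eval s.nat) with hq
    have key := exec_loop_induction O (x := k) (e := .var x) (s := s)
      (c := fill t e (k + 1) xs (pre ++ [.var k]))
      (fun i u => (∀ w < i, ∀ ws, List.Forall₂ (fun w x => w < s.nat x) ws xs →
          u.arr t (q ++ w :: ws) = e.evalAt s.arr (k + 1) (Function.update s.nat k w) ws) ∧
        (∀ l, (∀ w < i, ∀ ws, List.Forall₂ (fun w x => w < s.nat x) ws xs →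
          l ≠ q ++ w :: ws) → u.arr t l = s.arr t l) ∧
        (∀ v, v ≠ 30 → v ≠ t → u.arr v = s.arr v) ∧ ∀ y < k, u.nat y = s.nat y)
      ⟨by simp, fun l _ => rfl, fun v _ _ => rfl, fun y _ => rfl⟩ (by
      rintro i - u ⟨u1, u2, u3, u4⟩
      set v : Config 𝕜 := (u.setNat k i).tick 1 with hv
      have hva : v.arr = u.arr := rfl
      have hvn : ∀ y < k + 1, v.nat y = Function.update s.nat k i y := by
        intro y hy
        by_cases hyk : y = k
        · simp [hv, hyk, Config.tick, Config.setNat]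
        · simp [hv, Config.tick, Config.setNat, Function.update_of_ne hyk, u4 y (by omega)]
      have hvn' : ∀ y < k, v.nat y = s.nat y := fun y hy => by
        rw [hvn y (by omega), Function.update_of_ne hy.ne]
      have hpv : (pre ++ [NExp.var k]).map (NExp.eval v.nat) = q ++ [i] := by
        rw [List.map_append, NExp.map_eval_congr hpre hvn', ← hq]
        simp [NExp.eval, hvn k (by omega)]
      have hall : ∀ ws, List.Forall₂ (fun w x => w < v.nat x) ws xs ↔
          List.Forall₂ (fun w x => w < s.nat x) ws xs := by
        intro ws
        clear * - hkx hvn'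
        induction xs generalizing ws with
        | nil => simp
        | cons y ys ihy =>
          cases ws with
          | nil => simp
          | cons w ws =>
            rw [List.forall₂_cons, List.forall₂_cons, hvn' y (hkx y (by simp)),
              ihy (fun z hz => hkx z (List.mem_cons_of_mem _ hz))]
      obtain ⟨i1, i2⟩ := ih hlen (fun y hy => Nat.lt_succ_of_lt (hkx y hy)) hpre' v
      rw [hpv] at i1 i2
      have hcong : ∀ ws, List.Forall₂ (fun w x => w < s.nat x) ws xs →
          e.evalAt v.arr (k + 1) v.nat ws =
          e.evalAt s.arr (k + 1) (Function.update s.nat k i) ws := by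
        intro ws hws
        refine SExp.evalAt_congr (by rw [hws.length_eq]; exact hlen) hvn fun w hw => ?_
        rw [hva, u3 w (ne hw).1 (ne hw).2]
      refine ⟨?_, ?_, ?_, ?_⟩
      · intro w hw ws hws
        by_cases hwi : w = i
        · subst hwi
          have := i1 ws ((hall ws).2 hws)
          rw [hcong ws hws] at this
          simpa using this
        · rw [i2, hva, u1 w (by omega) ws hws]
          intro ws' _ heq
          rw [List.append_assoc] at heq
          have := List.append_cancel_left heq
          simp only [List.cons_append, List.nil_append, List.cons.injEq] at this
          exact hwi this.1
      · intro l hl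
        rw [i2, hva, u2]
        · intro w hw ws hws
          exact hl w (by omega) ws hws
        · intro ws hws heq
          exact hl i (by omega) ws ((hall ws).1 hws) (by simpa using heq)
      · intro w hw hwt
        rw [exec_arr_eq O (keepsArr_fill hw hwt _ _ _ _), hva, u3 w hw hwt]
      · intro y hy
        rw [exec_nat_eq O (keepsNat_fill (Nat.lt_succ_of_lt hy) _ _ _), hvn' y hy])
    have hx : NExp.eval s.nat (.var x) = s.nat x := rfl
    rw [hx] at key
    obtain ⟨k1, k2, -, -⟩ := key
    constructor
    · intro ws hws
      cases hws with
      | cons h1 h2 => exact k1 _ h1 _ h2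
    · intro l hl
      exact k2 l fun w hw ws hws => hl (w :: ws) (List.Forall₂.cons hw hws)

end Exec
end EntangledSubspace

namespace EntangledSubspace

/-! ### Testing loops and collecting loops. -/

section Exec

variable {𝕜 : Type*} [RCLike 𝕜] (O : DiagOracle 𝕜)

theorem keepsArr_check {t u : ℕ} (hu : u ≠ 30) (hut : u ≠ t) (e : SExp) (k : ℕ) (xs : List ℕ) :
    (check t e k xs).keepsArr u = true := by
  induction xs generalizing k with
  | nil => simpa [check, Prog.keepsArr, e.keepsArr_compile k 0 hu] using hut.symm
  | cons x xs ih => simp [check, Prog.keepsArr, ih]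

theorem keepsNat_check {t x k : ℕ} (hx : x < k) (e : SExp) (xs : List ℕ) :
    (check t e k xs).keepsNat x = true := by
  induction xs generalizing k with
  | nil => simp [check, Prog.keepsNat, e.keepsNat_compile 0 hx]
  | cons y xs ih => simp [check, Prog.keepsNat, ih (Nat.lt_succ_of_lt hx), hx.ne']

/-- The flag is only ever set, never cleared. Hence several checks can be run in sequence on the
same flag. -/
theorem exec_check {t : ℕ} {e : SExp} {k : ℕ} {xs : List ℕ}
    (ht : t ≠ 30) (h : e.closedAt (k + xs.length) = true) (h30 : e.avoids 30 = true)
    (het : e.avoids t = true) (hxs : ∀ x ∈ xs, x < k) (s : Config 𝕜) :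
    ((check t e k xs).exec O s).arr t [] = 0 ↔ s.arr t [] = 0 ∧
      ∀ ws, List.Forall₂ (fun w x => w < s.nat x) ws xs → e.evalAt s.arr k s.nat ws = 0 := by
  have ne : ∀ {u : ℕ}, e.avoids u = false → u ≠ 30 ∧ u ≠ t := by
    intro u h'
    constructor <;> rintro rfl <;> simp_all
  induction xs generalizing k s with
  | nil =>
    obtain ⟨e1, -⟩ := exec_compile O 0 h h30 s
    have h2 : ((e.compile k 0).exec O s).arr t = s.arr t :=
      exec_arr_eq O (e.keepsArr_compile k 0 ht) s
    have e1' : ((e.compile k 0).exec O s).read (SExp.reg 0) = e.eval s.arr k s.nat := e1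
    simp only [check, Prog.exec, e1', List.forall₂_nil_right_iff, forall_eq, SExp.evalAt]
    split_ifs with h0
    · simp [Config.tick, h0, h2]
    · simp [Config.tick, Config.write, h0]
  | cons x xs ih =>
    have hlen : e.closedAt (k + 1 + xs.length) = true := by
      rwa [List.length_cons, show k + (xs.length + 1) = k + 1 + xs.length by omega] at h
    have hkx : ∀ y ∈ xs, y < k := fun y hy => hxs y (List.mem_cons_of_mem _ hy)
    have key := exec_loop_induction O (x := k) (e := .var x) (s := s)
      (c := check t e (k + 1) xs)
      (fun i u => (u.arr t [] = 0 ↔ s.arr t [] = 0 ∧ ∀ w < i, ∀ ws,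
          List.Forall₂ (fun w x => w < s.nat x) ws xs →
          e.evalAt s.arr (k + 1) (Function.update s.nat k w) ws = 0) ∧
        (∀ v, v ≠ 30 → v ≠ t → u.arr v = s.arr v) ∧ ∀ y < k, u.nat y = s.nat y)
      ⟨by simp [Config.tick], fun v _ _ => rfl, fun y _ => rfl⟩ (by
      rintro i - u ⟨u1, u3, u4⟩
      set v : Config 𝕜 := (u.setNat k i).tick 1 with hv
      have hva : v.arr = u.arr := rfl
      have hvn : ∀ y < k + 1, v.nat y = Function.update s.nat k i y := by
        intro y hy
        by_cases hyk : y = k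
        · simp [hv, hyk, Config.tick, Config.setNat]
        · simp [hv, Config.tick, Config.setNat, Function.update_of_ne hyk, u4 y (by omega)]
      have hvn' : ∀ y < k, v.nat y = s.nat y := fun y hy => by
        rw [hvn y (by omega), Function.update_of_ne hy.ne]
      have hall : ∀ ws, List.Forall₂ (fun w x => w < v.nat x) ws xs ↔
          List.Forall₂ (fun w x => w < s.nat x) ws xs := by
        intro ws
        clear * - hkx hvn'
        induction xs generalizing ws with
        | nil => simp
        | cons y ys ihy =>
          cases ws with
          | nil => simp
          | cons w ws =>
            rw [List.forall₂_cons, List.forall₂_cons, hvn' y (hkx y (by simp)),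
              ihy (fun z hz => hkx z (List.mem_cons_of_mem _ hz))]
      have hcong : ∀ ws, List.Forall₂ (fun w x => w < s.nat x) ws xs →
          e.evalAt v.arr (k + 1) v.nat ws =
          e.evalAt s.arr (k + 1) (Function.update s.nat k i) ws := by
        intro ws hws
        refine SExp.evalAt_congr (by rw [hws.length_eq]; exact hlen) hvn fun w hw => ?_
        rw [hva, u3 w (ne hw).1 (ne hw).2]
      refine ⟨?_, ?_, ?_⟩
      · have ihv := ih hlen (fun y hy => Nat.lt_succ_of_lt (hkx y hy)) v
        refine ihv.trans ?_
        rw [hva, u1, and_assoc]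
        refine and_congr_right fun _ => ⟨?_, ?_⟩
        · rintro ⟨h1, h2⟩ w hw ws hws
          rcases Nat.lt_succ_iff_lt_or_eq.1 hw with hw | rfl
          · exact h1 w hw ws hws
          · rw [← hcong ws hws, hva]; exact h2 ws ((hall ws).2 hws)
        · intro h1
          refine ⟨fun w hw => h1 w (by omega), fun ws hws => ?_⟩
          rw [← hva, hcong ws ((hall ws).1 hws)]
          exact h1 i (by omega) ws ((hall ws).1 hws)
      · intro w hw hwt
        rw [exec_arr_eq O (keepsArr_check hw hwt _ _ _), hva, u3 w hw hwt]
      · intro y hy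
        rw [exec_nat_eq O (keepsNat_check (Nat.lt_succ_of_lt hy) _ _), hvn' y hy])
    have hx : NExp.eval s.nat (.var x) = s.nat x := rfl
    rw [hx] at key
    rw [show check t e k (x :: xs) = .loop k (.var x) (check t e (k + 1) xs) from rfl, key.1]
    refine and_congr_right fun _ => ⟨?_, ?_⟩
    · intro h1 ws hws
      cases hws with
      | cons h2 h3 => exact h1 _ h2 _ h3
    · intro h1 w hw ws hws
      exact h1 (w :: ws) (List.Forall₂.cons hw hws)

-- `Row arr a i` expresses that the `a`-th output row was produced from index `i`; the body has to
-- establish the new row and to preserve the earlier ones. Array `30` is scratch space and may not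
-- matter for `Row`. The test must not depend on the counter `r`, which changes during the loop;
-- this is `htn`.
open Classical in
theorem exec_collect {r x k : ℕ} {test : SExp} {body : Prog} (hr : r < k) (hxr : x ≠ r)
    (ht : test.closedAt (k + 1) = true) (h30 : test.avoids 30 = true)
    (hbr : body.keepsNat r = true) (hbn : ∀ y < k, body.keepsNat y = true)
    (hta : ∀ t, test.avoids t = false → body.keepsArr t = true)
    (s : Config 𝕜)
    (htn : ∀ (arr : ℕ → List ℕ → 𝕜) (ν ν' : ℕ → ℕ), (∀ y < k + 1, y ≠ r → ν y = ν' y) →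
      test.eval arr (k + 1) ν = test.eval arr (k + 1) ν')
    (Row : (ℕ → List ℕ → 𝕜) → ℕ → ℕ → Prop)
    (hRow : ∀ arr arr' a i, (∀ t, t ≠ 30 → arr t = arr' t) → Row arr a i → Row arr' a i)
    (hbody : ∀ u : Config 𝕜, (∀ t, t ≠ 30 → body.keepsArr t = true → u.arr t = s.arr t) →
      (∀ y < k, y ≠ r → u.nat y = s.nat y) →
      Row (body.exec O u).arr (u.nat r) (u.nat k) ∧
      ∀ a i, a < u.nat r → Row u.arr a i → Row (body.exec O u).arr a i) :
    let L := (List.range (s.nat x)).filter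
      fun i => test.eval s.arr (k + 1) (Function.update s.nat k i) = 0
    ((collect r x k test body).exec O s).nat r = L.length ∧
      ∀ a (h : a < L.length), Row ((collect r x k test body).exec O s).arr a L[a] := by
  intro L
  set p : ℕ → Bool := fun i => test.eval s.arr (k + 1) (Function.update s.nat k i) = 0 with hp
  set s₀ : Config 𝕜 := (Prog.setNat r (.const 0)).exec O s with hs₀
  have key := exec_loop_induction O (x := k) (e := .var x) (s := s₀)
    (c := .seq (test.compile (k + 1) 0)
      (.ifZero (SExp.reg 0) (.seq body (.setNat r (.add (.var r) (.const 1)))) .skip))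
    (fun n u => u.nat r = ((List.range n).filter p).length ∧
      (∀ a (h : a < ((List.range n).filter p).length), Row u.arr a ((List.range n).filter p)[a]) ∧
      (∀ t, t ≠ 30 → body.keepsArr t = true → u.arr t = s.arr t) ∧
      ∀ y < k, y ≠ r → u.nat y = s.nat y)
    ⟨by simp [hs₀, Prog.exec, Config.setNat, Config.tick, NExp.eval], by simp, fun t _ _ => rfl,
      fun y _ hyr => by
        simp [hs₀, Prog.exec, Config.setNat, Config.tick, Function.update_of_ne hyr]⟩ (by
    rintro i - u ⟨u1, u2, u3, u4⟩
    set v : Config 𝕜 := (u.setNat k i).tick 1 with hv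
    have hva : v.arr = u.arr := rfl
    have hvk : v.nat k = i := by simp [hv, Config.tick, Config.setNat]
    have hvn : ∀ y ≠ k, v.nat y = u.nat y := by
      intro y hyk
      simp [hv, Config.tick, Config.setNat, Function.update_of_ne hyk]
    set w : Config 𝕜 := (test.compile (k + 1) 0).exec O v with hw
    have hwa : ∀ t ≠ 30, w.arr t = u.arr t := fun t ht =>
      exec_arr_eq O (test.keepsArr_compile (k + 1) 0 ht) v
    have hwn : ∀ y < k + 1, w.nat y = v.nat y := fun y hy =>
      exec_nat_eq O (test.keepsNat_compile 0 hy) v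
    have htest : w.read (SExp.reg 0) = test.eval s.arr (k + 1) (Function.update s.nat k i) := by
      refine ((exec_compile O 0 ht h30 v).1).trans ?_
      rw [← htn s.arr v.nat]
      · refine SExp.eval_congr ht (fun _ _ => rfl) fun t ht' => ?_
        refine u3 t ?_ (hta t ht')
        rintro rfl
        rw [h30] at ht'
        exact absurd ht' (by decide)
      · intro y hy hyr
        by_cases hyk : y = k
        · simp [hyk, hvk]
        · rw [hvn y hyk, u4 y (by omega) hyr, Function.update_of_ne hyk]
    simp only [Prog.exec, ← hw, htest]
    rw [List.range_succ, List.filter_append]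
    split_ifs with h0
    · have hpi : p i = true := by simpa [hp] using h0
      have hfi : List.filter p [i] = [i] := by simp [hpi]
      rw [hfi]
      obtain ⟨b1, b2⟩ := hbody (w.tick 1) (fun t ht hb => (hwa t ht).trans (u3 t ht hb))
        (fun y hy hyr => ((hwn y (by omega)).trans (hvn y (by omega))).trans (u4 y hy hyr))
      have hwr : (w.tick 1).nat r = ((List.range i).filter p).length :=
        ((hwn r (by omega)).trans (hvn r (by omega))).trans u1
      have hwk : (w.tick 1).nat k = i := (hwn k (by omega)).trans hvk
      rw [hwr, hwk] at b1
      refine ⟨?_, ?_, ?_, ?_⟩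
      · simp [Config.tick, Config.setNat, NExp.eval]
        rw [exec_nat_eq O hbr]
        exact hwr
      · intro a ha
        refine hRow (body.exec O (w.tick 1)).arr _ _ _ (fun t _ => rfl) ?_
        rw [List.length_append, List.length_singleton] at ha
        by_cases hal : a < ((List.range i).filter p).length
        · rw [List.getElem_append_left hal]
          refine b2 _ _ (by rw [hwr]; exact hal) ?_
          exact hRow _ _ _ _ (fun t ht => (hwa t ht).symm) (u2 a hal)
        · have : a = ((List.range i).filter p).length := by omega
          subst this
          simpa using b1
      · intro t ht hb
        show (body.exec O (w.tick 1)).arr t = _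
        rw [exec_arr_eq O hb]
        exact (hwa t ht).trans (u3 t ht hb)
      · intro y hy hyr
        simp only [Config.tick, Config.setNat, Function.update_of_ne hyr]
        rw [exec_nat_eq O (hbn y hy)]
        exact ((hwn y (by omega)).trans (hvn y (by omega))).trans (u4 y hy hyr)
    · have hpi : p i = false := by simpa [hp] using h0
      have hfi : List.filter p [i] = [] := by simp [hpi]
      rw [hfi, List.append_nil]
      refine ⟨((hwn r (by omega)).trans (hvn r (by omega))).trans u1, fun a ha => ?_,
        fun t ht hb => (hwa t ht).trans (u3 t ht hb),
        fun y hy hyr => ((hwn y (by omega)).trans (hvn y (by omega))).trans (u4 y hy hyr)⟩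
      exact hRow _ _ _ _ (fun t ht => (hwa t ht).symm) (u2 a ha))
  have hx' : NExp.eval s₀.nat (.var x) = s.nat x := by
    simp [hs₀, Prog.exec, Config.setNat, Config.tick, NExp.eval, Function.update_of_ne hxr]
  rw [hx'] at key
  exact ⟨key.1, key.2.1⟩

end Exec
end EntangledSubspace

namespace EntangledSubspace

/-! ## Pseudoinverses and simple spectra -/

section LinearAlgebra

variable {𝕜 : Type*} [RCLike 𝕜] {ι : Type*} [Fintype ι] [DecidableEq ι]

-- This is `B⁺ = (Bᴴ B)⁺ Bᴴ`, with the zero eigenvalues handled by the convention `0⁻¹ = 0`. The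
-- matrix `P` need not be unitary, since the oracle may return any diagonalization, so that the
-- inner factor `G'` is Hermitian has to be proved.
open scoped ComplexOrder in
theorem isPseudoinverse_of_diagonalization {B P Q : Matrix ι ι 𝕜} {l : ι → 𝕜} (hPQ : P * Q = 1)
    (h : Bᴴ * B = P * diagonal l * Q) :
    IsPseudoinverse B (P * diagonal (fun i => (l i)⁻¹) * Q * Bᴴ) := by
  have hQP : Q * P = 1 := mul_eq_one_comm.1 hPQ
  have hmul : ∀ d d' : ι → 𝕜, P * diagonal d * Q * (P * diagonal d' * Q) =
      P * diagonal (fun i => d i * d' i) * Q := by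
    intro d d'
    calc P * diagonal d * Q * (P * diagonal d' * Q)
        = P * diagonal d * (Q * P) * diagonal d' * Q := by simp only [Matrix.mul_assoc]
      _ = _ := by rw [hQP, Matrix.mul_one, Matrix.mul_assoc P, diagonal_mul_diagonal]
  set G := Bᴴ * B with hG
  set G' := P * diagonal (fun i => (l i)⁻¹) * Q with hG'
  have hGh : Gᴴ = G := by rw [hG]; simp
  have hcomm : G * G' = G' * G := by
    rw [h, hG', hmul, hmul]
    simp only [mul_comm]
  have h1 : G * G' * G = G := by
    rw [h, hG', hmul, hmul]
    congr 3
    ext i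
    by_cases hi : l i = 0 <;> simp [hi]
  have h2 : G' * G * G' = G' := by
    rw [h, hG', hmul, hmul]
    congr 3
    ext i
    by_cases hi : l i = 0 <;> simp [hi]
  -- For `E = G G'` the identity `Eᴴ E = Eᴴ` holds. Its left side is Hermitian, hence so is `E`.
  have hE : (G * G')ᴴ = G * G' := by
    have h3 : (G * G')ᴴ * (G * G') = (G * G')ᴴ := by
      rw [conjTranspose_mul, hGh, Matrix.mul_assoc, hcomm, ← Matrix.mul_assoc G, h1]
    have h4 := congrArg conjTranspose h3
    rw [conjTranspose_mul, conjTranspose_conjTranspose] at h4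
    rw [← h3]
    exact h4
  have hG'h : G'ᴴ = G' := by
    have h5 : G'ᴴ = G' * (G * G'ᴴ) := by
      have h6 := congrArg conjTranspose h2
      rw [Matrix.mul_assoc, conjTranspose_mul, hE, hcomm, Matrix.mul_assoc] at h6
      exact h6.symm
    rw [h5]
    have h7 : G * G'ᴴ = G * G' := by
      have : (G' * G)ᴴ = G * G'ᴴ := by rw [conjTranspose_mul, hGh]
      rw [← this, ← hcomm, hE]
    rw [h7, ← Matrix.mul_assoc, h2]
  have hB : B * (G' * G) = B := by
    have : Bᴴ * B * (G' * G - 1) = 0 := by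
      rw [← hG, Matrix.mul_sub, ← Matrix.mul_assoc, h1, Matrix.mul_one, sub_self]
    rw [Matrix.conjTranspose_mul_self_mul_eq_zero, Matrix.mul_sub, Matrix.mul_one,
      sub_eq_zero] at this
    exact this
  constructor
  · rw [Matrix.mul_assoc, Matrix.mul_assoc G', ← hG, hB]
  · rw [Matrix.mul_assoc G', ← hG, ← Matrix.mul_assoc, h2]
  · show (B * (G' * Bᴴ))ᴴ = B * (G' * Bᴴ)
    rw [conjTranspose_mul, conjTranspose_mul, hG'h, conjTranspose_conjTranspose, Matrix.mul_assoc]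
  · rw [Matrix.mul_assoc, ← hG, IsHermitian, ← hcomm, hE]

theorem exists_diagonalization_of_isHermitian {A : Matrix ι ι 𝕜} (hA : A.IsHermitian) :
    ∃ (P : Matrix ι ι 𝕜) (l : ι → 𝕜) (Q : Matrix ι ι 𝕜), P * Q = 1 ∧ A = P * diagonal l * Q := by
  refine ⟨hA.eigenvectorUnitary, fun i => (hA.eigenvalues i : 𝕜),
    star (hA.eigenvectorUnitary : Matrix ι ι 𝕜), by simp, ?_⟩
  have := hA.spectral_theorem
  rw [Unitary.conjStarAlgAut_apply] at this
  exact this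

theorem exists_isPseudoinverse (B : Matrix ι ι 𝕜) : ∃ Y, IsPseudoinverse B Y := by
  obtain ⟨P, l, Q, hPQ, h⟩ :=
    exists_diagonalization_of_isHermitian (isHermitian_conjTranspose_mul_self B)
  exact ⟨_, isPseudoinverse_of_diagonalization hPQ h⟩

theorem exists_dual {s : ℕ} {v : Fin s → ι → 𝕜} (hv : LinearIndependent 𝕜 v) :
    ∃ K : Fin s → ι → 𝕜, ∀ a b, ∑ j, K a j * v b j = if a = b then 1 else 0 := by
  obtain ⟨g, hg⟩ := LinearMap.exists_leftInverse_of_injective (Fintype.linearCombination 𝕜 v)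
    (LinearMap.ker_eq_bot.2 (linearIndependent_iff_injective_fintypeLinearCombination.1 hv))
  refine ⟨fun a j => g (Pi.single j 1) a, fun a b => ?_⟩
  have h1 : g (v b) = Pi.single b 1 := by
    have := LinearMap.congr_fun hg (Pi.single b 1)
    simpa [Fintype.linearCombination_apply_single] using this
  have h2 : v b = ∑ j, v b j • (Pi.single j 1 : ι → 𝕜) := (pi_eq_sum_univ' (v b))
  have h3 := congrFun h1 a
  rw [h2, map_sum, Finset.sum_apply] at h3
  simp only [map_smul, Pi.smul_apply, smul_eq_mul, Pi.single_apply] at h3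
  rw [← h3]
  exact Finset.sum_congr rfl fun j _ => mul_comm _ _

theorem hasSimpleNonzeroSpectrum_of_range_le {A : Matrix ι ι 𝕜} {s : ℕ} {l : Fin s → 𝕜}
    {v : Fin s → ι → 𝕜} (hv : LinearIndependent 𝕜 v) (hl : Function.Injective l)
    (hl0 : ∀ a, l a ≠ 0) (hA : ∀ a, A *ᵥ v a = l a • v a)
    (hr : ∀ x, A *ᵥ x ∈ Submodule.span 𝕜 (Set.range v)) : HasSimpleNonzeroSpectrum A l v where
  rank_eq := by
    have : LinearMap.range A.mulVecLin = Submodule.span 𝕜 (Set.range v) := by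
      apply le_antisymm
      · rintro _ ⟨x, rfl⟩
        exact hr x
      · rw [Submodule.span_le]
        rintro _ ⟨a, rfl⟩
        exact ⟨(l a)⁻¹ • v a, by simp [hA, smul_smul, hl0 a]⟩
    rw [Matrix.rank, this, finrank_span_eq_card hv, Fintype.card_fin]
  injective := hl
  ne_zero := hl0
  vec_ne_zero := hv.ne_zero
  eigen := hA

namespace HasSimpleNonzeroSpectrum

variable {A : Matrix ι ι 𝕜} {r : ℕ} {l : Fin r → 𝕜} {v : Fin r → ι → 𝕜}

theorem linearIndependent (h : HasSimpleNonzeroSpectrum A l v) : LinearIndependent 𝕜 v :=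
  Module.End.eigenvectors_linearIndependent' A.mulVecLin l h.injective v fun a =>
    Module.End.hasEigenvector_iff.2 ⟨Module.End.mem_eigenspace_iff.2 (h.eigen a), h.vec_ne_zero a⟩

theorem range_eq (h : HasSimpleNonzeroSpectrum A l v) :
    LinearMap.range A.mulVecLin = Submodule.span 𝕜 (Set.range v) := by
  symm
  apply Submodule.eq_of_le_of_finrank_eq
  · rw [Submodule.span_le]
    rintro _ ⟨a, rfl⟩
    exact ⟨(l a)⁻¹ • v a, by simp [h.eigen, smul_smul, h.ne_zero a]⟩
  · rw [finrank_span_eq_card h.linearIndependent, Fintype.card_fin, ← h.rank_eq, Matrix.rank]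

/-- An eigenvector for a nonzero eigenvalue is a multiple of one of the `v a`. -/
theorem exists_smul_eq (h : HasSimpleNonzeroSpectrum A l v) {x : ι → 𝕜} {μ : 𝕜} (hμ : μ ≠ 0)
    (hx : x ≠ 0) (hAx : A *ᵥ x = μ • x) : ∃ (a : Fin r) (c : 𝕜), x = c • v a ∧ μ = l a := by
  have hmem : x ∈ Submodule.span 𝕜 (Set.range v) := by
    rw [← h.range_eq]
    exact ⟨μ⁻¹ • x, by simp [hAx, smul_smul, hμ]⟩
  obtain ⟨c, rfl⟩ := (Submodule.mem_span_range_iff_exists_fun 𝕜).1 hmem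
  have h1 : ∑ a, (c a * (l a - μ)) • v a = 0 := by
    have h2 : A *ᵥ (∑ a, c a • v a) = ∑ a, (c a * l a) • v a := by
      rw [Matrix.mulVec_sum]
      exact Finset.sum_congr rfl fun a _ => by rw [mulVec_smul, h.eigen, smul_smul]
    rw [h2, Finset.smul_sum] at hAx
    simp only [mul_sub, sub_smul, Finset.sum_sub_distrib, hAx, smul_smul, mul_comm μ, sub_self]
  have h2 := Fintype.linearIndependent_iff.1 h.linearIndependent _ h1
  obtain ⟨a, ha⟩ : ∃ a, c a ≠ 0 := by
    by_contra! hc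
    exact hx (by simp [hc])
  have hla : l a = μ := by
    simpa [ha, sub_eq_zero] using h2 a
  refine ⟨a, c a, ?_, hla.symm⟩
  refine Finset.sum_eq_single a (fun b _ hb => ?_) (by simp)
  have : c b = 0 := by
    rcases mul_eq_zero.1 (h2 b) with h3 | h3
    · exact h3
    · exact absurd (h.injective ((sub_eq_zero.1 h3).trans hla.symm)) hb
  rw [this, zero_smul]

/-- The oracle promises something only for diagonalizable matrices. The `v a` span the range and
have nonzero eigenvalues, so the range meets the kernel trivially; by dimension the two are
complementary, and the `v a` together with a basis of the kernel form an eigenbasis. -/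
theorem exists_diagonalization (h : HasSimpleNonzeroSpectrum A l v) :
    ∃ (P : Matrix ι ι 𝕜) (d : ι → 𝕜) (Q : Matrix ι ι 𝕜), P * Q = 1 ∧ A = P * diagonal d * Q := by
  have hdisj : Disjoint (LinearMap.range A.mulVecLin) (LinearMap.ker A.mulVecLin) := by
    rw [Submodule.disjoint_def]
    intro x hx hx0
    rw [h.range_eq] at hx
    obtain ⟨c, rfl⟩ := (Submodule.mem_span_range_iff_exists_fun 𝕜).1 hx
    rw [LinearMap.mem_ker, Matrix.mulVecLin_apply, Matrix.mulVec_sum] at hx0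
    have h1 : ∑ a, (c a * l a) • v a = 0 := by
      rw [← hx0]
      exact Finset.sum_congr rfl fun a _ => by rw [mulVec_smul, h.eigen, smul_smul]
    have h2 := Fintype.linearIndependent_iff.1 h.linearIndependent _ h1
    refine Finset.sum_eq_zero fun a _ => ?_
    have : c a = 0 := by simpa [h.ne_zero a] using h2 a
    rw [this, zero_smul]
  have hcompl : IsCompl (LinearMap.range A.mulVecLin) (LinearMap.ker A.mulVecLin) :=
    ⟨hdisj, codisjoint_iff.2 (Submodule.eq_top_of_disjoint _ _
      (LinearMap.finrank_range_add_finrank_ker A.mulVecLin).ge hdisj)⟩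
  let b₁ : Module.Basis (Fin r) 𝕜 (LinearMap.range A.mulVecLin) :=
    (Module.Basis.span h.linearIndependent).map (LinearEquiv.ofEq _ _ h.range_eq.symm)
  let b₂ := Module.finBasis 𝕜 (LinearMap.ker A.mulVecLin)
  let b₃ := (b₁.prod b₂).map (Submodule.prodEquivOfIsCompl _ _ hcompl)
  have e : Fin r ⊕ Fin (Module.finrank 𝕜 (LinearMap.ker A.mulVecLin)) ≃ ι :=
    b₃.indexEquiv (Pi.basisFun 𝕜 ι)
  let b := b₃.reindex e
  have hb₁ : ∀ a, (b₁ a : ι → 𝕜) = v a := fun a => by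
    simp [b₁, Module.Basis.span_apply]
  have hb : ∀ i, A *ᵥ (b i) = Sum.elim l (fun _ => 0) (e.symm i) • b i := by
    intro i
    have hbi : b i = b₃ (e.symm i) := by simp [b]
    rw [hbi]
    rcases e.symm i with a | a
    · have : b₃ (Sum.inl a) = v a := by simp [b₃, hb₁]
      rw [this, h.eigen]
      rfl
    · have : b₃ (Sum.inr a) = b₂ a := by simp [b₃]
      rw [this]
      have h0 := LinearMap.mem_ker.1 (b₂ a).2
      rw [Matrix.mulVecLin_apply] at h0
      simpa using h0
  refine ⟨(Pi.basisFun 𝕜 ι).toMatrix b, fun i => Sum.elim l (fun _ => 0) (e.symm i),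
    b.toMatrix (Pi.basisFun 𝕜 ι), Module.Basis.toMatrix_mul_toMatrix_flip _ _, ?_⟩
  have h3 : A * (Pi.basisFun 𝕜 ι).toMatrix b = (Pi.basisFun 𝕜 ι).toMatrix b *
      diagonal (fun i => Sum.elim l (fun _ => 0) (e.symm i)) := by
    ext j i
    have := congrFun (hb i) j
    rw [mul_diagonal]
    simpa [Matrix.mul_apply, mulVec, dotProduct, Module.Basis.toMatrix_apply, mul_comm] using this
  rw [← h3, Matrix.mul_assoc, Module.Basis.toMatrix_mul_toMatrix_flip, Matrix.mul_one]

end HasSimpleNonzeroSpectrum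

end LinearAlgebra
end EntangledSubspace

namespace EntangledSubspace

/-! ## Simultaneous diagonalization of symmetric decompositions -/

section SimDiag

variable {𝕜 : Type*} [RCLike 𝕜] {ι : Type*} [Fintype ι] [DecidableEq ι]

/-- The symmetric matrix `∑ a, c a • v a (v a)ᵀ`. -/
def weightedSquares {s : ℕ} (v : Fin s → ι → 𝕜) (c : Fin s → 𝕜) : Matrix ι ι 𝕜 :=
  ∑ a, c a • vecMulVec (v a) (v a)

theorem weightedSquares_mulVec {s : ℕ} (v : Fin s → ι → 𝕜) (c : Fin s → 𝕜) (x : ι → 𝕜) :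
    weightedSquares v c *ᵥ x = ∑ a, (c a * (v a ⬝ᵥ x)) • v a := by
  rw [weightedSquares, Matrix.sum_mulVec]
  refine Finset.sum_congr rfl fun a _ => ?_
  ext j
  simp [smul_mulVec, vecMulVec_mulVec]
  ring

theorem weightedSquares_transpose {s : ℕ} (v : Fin s → ι → 𝕜) (c : Fin s → 𝕜) :
    (weightedSquares v c)ᵀ = weightedSquares v c := by
  simp [weightedSquares, transpose_sum, transpose_vecMulVec]

theorem contract_eq_weightedSquares {s : ℕ} {T : Fin s → Matrix ι ι 𝕜} {z : Fin s → Fin s → 𝕜}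
    {v : Fin s → ι → 𝕜} (hT : ∀ i, T i = ∑ a, z a i • vecMulVec (v a) (v a)) (φ : Fin s → 𝕜) :
    contract T φ = weightedSquares v fun a => ∑ i, φ i * z a i := by
  simp only [contract, hT, weightedSquares, Finset.smul_sum, Finset.sum_smul, smul_smul]
  rw [Finset.sum_comm]

theorem IsPseudoinverse.transpose {A Y : Matrix ι ι 𝕜} (h : IsPseudoinverse A Y) :
    IsPseudoinverse Aᵀ Yᵀ where
  mul_mul_left := by
    rw [← transpose_mul, ← transpose_mul, ← Matrix.mul_assoc, h.mul_mul_left]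
  mul_mul_right := by
    rw [← transpose_mul, ← transpose_mul, ← Matrix.mul_assoc, h.mul_mul_right]
  isHermitian_left := by rw [← transpose_mul]; exact h.isHermitian_right.transpose
  isHermitian_right := by rw [← transpose_mul]; exact h.isHermitian_left.transpose

/-- Both matrices have the form `V diag Vᵀ` with `V` of full column rank and nonzero weights. So the
kernel of the `β`-matrix lies in that of the `α`-matrix, and `A Y A = A` alone gives `S_α Y S_β =
S_α`. Evaluating at the dual vectors `K a` shows that `v a` is an eigenvector for `α a / β a`. -/
theorem hasSimpleNonzeroSpectrum_weightedSquares {s : ℕ} {v : Fin s → ι → 𝕜}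
    (hv : LinearIndependent 𝕜 v) {α β : Fin s → 𝕜} (hα : ∀ a, α a ≠ 0) (hβ : ∀ a, β a ≠ 0)
    (hinj : Function.Injective fun a => α a / β a) {Y : Matrix ι ι 𝕜}
    (hY : IsPseudoinverse (weightedSquares v β) Y) :
    HasSimpleNonzeroSpectrum (weightedSquares v α * Y) (fun a => α a / β a) v := by
  refine hasSimpleNonzeroSpectrum_of_range_le hv hinj (fun a => div_ne_zero (hα a) (hβ a)) ?_ ?_
  · intro a
    obtain ⟨K, hK⟩ := exists_dual hv
    have hdot : ∀ b, v b ⬝ᵥ K a = if a = b then 1 else 0 := fun b => by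
      rw [dotProduct_comm]; exact hK a b
    have hcK : ∀ c : Fin s → 𝕜, weightedSquares v c *ᵥ K a = c a • v a := fun c => by
      simp [weightedSquares_mulVec, hdot]
    have h1 : v a = (β a)⁻¹ • (weightedSquares v β *ᵥ K a) := by
      rw [hcK, smul_smul, inv_mul_cancel₀ (hβ a), one_smul]
    have h2 : ∀ y, weightedSquares v β *ᵥ y = 0 → weightedSquares v α *ᵥ y = 0 := by
      intro y hy
      rw [weightedSquares_mulVec] at hy
      have h3 := Fintype.linearIndependent_iff.1 hv _ hy
      rw [weightedSquares_mulVec]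
      refine Finset.sum_eq_zero fun b _ => ?_
      have h4 : v b ⬝ᵥ y = 0 := (mul_eq_zero.1 (h3 b)).resolve_left (hβ b)
      rw [h4, mul_zero, zero_smul]
    have h5 : weightedSquares v α *ᵥ (Y *ᵥ (weightedSquares v β *ᵥ K a)) =
        weightedSquares v α *ᵥ K a := by
      rw [← sub_eq_zero, ← mulVec_sub]
      apply h2
      rw [mulVec_sub, mulVec_mulVec, mulVec_mulVec, hY.mul_mul_left, sub_self]
    have h6 : weightedSquares v α *ᵥ (Y *ᵥ v a) = (β a)⁻¹ • (α a • v a) := by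
      conv_lhs => rw [h1]
      rw [mulVec_smul, mulVec_smul, h5, hcK]
    rw [← mulVec_mulVec, h6, smul_smul, div_eq_inv_mul]
  · intro x
    rw [← mulVec_mulVec, weightedSquares_mulVec]
    exact Submodule.sum_mem _ fun a _ => Submodule.smul_mem _ _ (Submodule.subset_span ⟨a, rfl⟩)

/-- Transposing the product gives `S_β Xᵀ`, where `Xᵀ` is a pseudoinverse of the symmetric matrix
`S_α`. This is the previous situation with `α` and `β` exchanged. -/
theorem hasSimpleNonzeroSpectrum_transpose_weightedSquares {s : ℕ} {v : Fin s → ι → 𝕜}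
    (hv : LinearIndependent 𝕜 v) {α β : Fin s → 𝕜} (hα : ∀ a, α a ≠ 0) (hβ : ∀ a, β a ≠ 0)
    (hinj : Function.Injective fun a => α a / β a) {X : Matrix ι ι 𝕜}
    (hX : IsPseudoinverse (weightedSquares v α) X) :
    HasSimpleNonzeroSpectrum (X * weightedSquares v β)ᵀ (fun a => (α a / β a)⁻¹) v := by
  rw [transpose_mul, weightedSquares_transpose]
  have h1 := hX.transpose
  rw [weightedSquares_transpose] at h1
  simp only [inv_div]
  refine hasSimpleNonzeroSpectrum_weightedSquares hv hβ hα (fun a b hab => hinj ?_) h1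
  simpa using congrArg (·⁻¹) hab

/-- A converse: nonzero eigenvalues alone force nonzero weights. For `y = Y v_a`, comparing
coefficients gives `α_b (v_b · y) = 0` for `b ≠ a` and `α_a (v_a · y) = l_a`. Then `S_β y` is a
multiple of `v_a`, and `Y S_β Y = Y` gives `β_a (v_a · y) = 1`. -/
theorem weights_of_eigenvectors {s : ℕ} {v : Fin s → ι → 𝕜}
    (hv : LinearIndependent 𝕜 v) {α β l : Fin s → 𝕜} {Y : Matrix ι ι 𝕜}
    (hY : IsPseudoinverse (weightedSquares v β) Y) (hl : ∀ a, l a ≠ 0)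
    (hA : ∀ a, (weightedSquares v α * Y) *ᵥ v a = l a • v a) (a : Fin s) :
    α a ≠ 0 ∧ β a ≠ 0 ∧ l a = α a / β a := by
  have h1 := hA a
  rw [← mulVec_mulVec, weightedSquares_mulVec] at h1
  set y := Y *ᵥ v a with hy
  have h2 : ∑ b, (α b * (v b ⬝ᵥ y) - if b = a then l a else 0) • v b = 0 := by
    simp [sub_smul, h1, ite_smul]
  have h3 := Fintype.linearIndependent_iff.1 hv _ h2
  have h4 : α a * (v a ⬝ᵥ y) = l a := by simpa [sub_eq_zero] using h3 a
  have hα : ∀ b, α b ≠ 0 := by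
    intro b
    have hb := hA b
    rw [← mulVec_mulVec, weightedSquares_mulVec] at hb
    have h2 : ∑ c, (α c * (v c ⬝ᵥ (Y *ᵥ v b)) - if c = b then l b else 0) • v c = 0 := by
      simp [sub_smul, hb, ite_smul]
    have h3 := Fintype.linearIndependent_iff.1 hv _ h2 b
    intro h0
    simp [h0, hl b] at h3
  have h5 : ∀ b, b ≠ a → v b ⬝ᵥ y = 0 := by
    intro b hb
    simpa [hb, hα b] using h3 b
  have h6 : weightedSquares v β *ᵥ y = (β a * (v a ⬝ᵥ y)) • v a := by
    rw [weightedSquares_mulVec]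
    refine Finset.sum_eq_single a (fun b _ hb => ?_) (by simp)
    rw [h5 b hb, mul_zero, zero_smul]
  have h7 : y = (β a * (v a ⬝ᵥ y)) • y := by
    conv_lhs => rw [hy, ← hY.mul_mul_right, ← mulVec_mulVec, ← mulVec_mulVec, ← hy, h6,
      mulVec_smul, ← hy]
  have h8 : v a ⬝ᵥ y ≠ 0 := by
    intro h0
    rw [h0, mul_zero] at h4
    exact hl a h4.symm
  have h9 : β a * (v a ⬝ᵥ y) = 1 := by
    have := congrArg (v a ⬝ᵥ ·) h7
    simp only [dotProduct_smul, smul_eq_mul] at this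
    exact mul_right_cancel₀ h8 (by rw [one_mul]; exact this.symm)
  have hβ : β a ≠ 0 := by
    intro h0
    simp [h0] at h9
  refine ⟨hα a, hβ, ?_⟩
  rw [eq_div_iff hβ, ← h4, mul_assoc, mul_comm _ (β a), h9, mul_one]

/-- The matrices `T i` are `s` independent elements of the span of `s` squares. So the square
coefficient matrix `z` is invertible and the squares are independent. The program therefore need not
test these conditions. -/
theorem linearIndependent_of_squares_decomposition {s : ℕ} {T : Fin s → Matrix ι ι 𝕜}
    (hTli : LinearIndependent 𝕜 T) {z : Fin s → Fin s → 𝕜} {v : Fin s → ι → 𝕜}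
    (hT : ∀ i, T i = ∑ a, z a i • vecMulVec (v a) (v a)) :
    LinearIndependent 𝕜 z ∧ ∀ a, v a ≠ 0 := by
  constructor
  · have hcol : LinearIndependent 𝕜 (Matrix.of z).col := by
      rw [Fintype.linearIndependent_iff]
      intro g hg
      refine Fintype.linearIndependent_iff.1 hTli g ?_
      simp only [hT, Finset.smul_sum, smul_smul]
      rw [Finset.sum_comm]
      refine Finset.sum_eq_zero fun a _ => ?_
      rw [← Finset.sum_smul]
      have := congrFun hg a
      simp only [Finset.sum_apply, Pi.smul_apply, smul_eq_mul, Pi.zero_apply] at this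
      rw [show ∑ i, g i * z a i = 0 from this, zero_smul]
    rw [Matrix.linearIndependent_cols_iff_isUnit, ← Matrix.linearIndependent_rows_iff_isUnit] at hcol
    exact hcol
  · have hW : LinearIndependent 𝕜 fun a => vecMulVec (v a) (v a) := by
      rw [linearIndependent_iff_card_le_finrank_span, ← finrank_span_eq_card hTli]
      apply Submodule.finrank_mono
      rw [Submodule.span_le]
      rintro _ ⟨i, rfl⟩
      rw [hT]
      exact Submodule.sum_mem _ fun a _ => Submodule.smul_mem _ _ (Submodule.subset_span ⟨a, rfl⟩)
    intro a h0
    exact hW.ne_zero a (by simp [h0])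

/-- Why the program may stop after the first eigenvalue problem: once the eigenvectors of `T(φ)
T(γ)⁺` decompose `T` by squares, they also serve as second family, `K a ⊗ K a` for dual vectors `K
a` are dual functionals, and the resulting `T(h a)` are the `z a`. -/
theorem simDiagRun_of_decomposition {s : ℕ} {T : Fin s → Matrix ι ι 𝕜}
    (hTli : LinearIndependent 𝕜 T) {z : Fin s → Fin s → 𝕜} {v : Fin s → ι → 𝕜}
    (hT : ∀ i, T i = ∑ a, z a i • vecMulVec (v a) (v a)) {φ γ : Fin s → 𝕜} {Y : Matrix ι ι 𝕜}
    (hY : IsPseudoinverse (contract T γ) Y) {l : Fin s → 𝕜} (hl : Function.Injective l)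
    (hl0 : ∀ a, l a ≠ 0) (hA : ∀ a, (contract T φ * Y) *ᵥ v a = l a • v a) :
    SimDiagRun T φ γ (some (List.ofFn fun a => (z a, v a, v a))) ∧
      IsSquareDecomposition T (List.ofFn fun a => (z a, v a, v a)) z v := by
  obtain ⟨hz, hv0⟩ := linearIndependent_of_squares_decomposition hTli hT
  have hv : LinearIndependent 𝕜 v :=
    Module.End.eigenvectors_linearIndependent' (contract T φ * Y).mulVecLin l hl v fun a =>
      Module.End.hasEigenvector_iff.2 ⟨Module.End.mem_eigenspace_iff.2 (hA a), hv0 a⟩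
  refine ⟨?_, ⟨by rw [List.map_ofFn]; rfl, hT, hz, hv⟩⟩
  obtain ⟨X, hX⟩ := exists_isPseudoinverse (contract T φ)
  obtain ⟨K, hK⟩ := exists_dual hv
  have hdual : ∀ a b, ∑ j, ∑ k, (vecMulVec (K a) (K a)) j k * (v b j * v b k) =
      if a = b then 1 else 0 := by
    intro a b
    have : ∑ j, ∑ k, (vecMulVec (K a) (K a)) j k * (v b j * v b k) =
        (∑ j, K a j * v b j) * ∑ k, K a k * v b k := by
      rw [Finset.sum_mul_sum]
      refine Finset.sum_congr rfl fun j _ => Finset.sum_congr rfl fun k _ => ?_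
      rw [vecMulVec_apply]; ring
    rw [this, hK]
    split_ifs <;> simp
  have hy : ∀ a, contract₂₃ T (vecMulVec (K a) (K a)) = z a := by
    intro a
    ext i
    have : contract₂₃ T (vecMulVec (K a) (K a)) i =
        ∑ b, z b i * ∑ j, ∑ k, (vecMulVec (K a) (K a)) j k * (v b j * v b k) := by
      simp only [contract₂₃, hT, Matrix.sum_apply, Matrix.smul_apply, smul_eq_mul, Finset.mul_sum]
      rw [Finset.sum_comm_cycle]
      refine Finset.sum_congr rfl fun b _ => Finset.sum_congr rfl fun j _ =>
        Finset.sum_congr rfl fun k _ => ?_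
      rw [vecMulVec_apply, vecMulVec_apply]
      ring
    rw [this]
    simp [hdual]
  have h1 : contract T φ = _ := contract_eq_weightedSquares hT φ
  have h2 : contract T γ = _ := contract_eq_weightedSquares hT γ
  have hw := weights_of_eigenvectors hv (by rw [← h2]; exact hY) hl0 (by rw [← h1]; exact hA)
  have hA' : HasSimpleNonzeroSpectrum (contract T φ * Y) l v := by
    have hl' : l = fun a => _ := funext fun a => (hw a).2.2
    have := hasSimpleNonzeroSpectrum_weightedSquares hv (fun a => (hw a).1) (fun a => (hw a).2.1)
      (by rw [← hl']; exact hl) (h2 ▸ hY)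
    rw [← hl', ← h1] at this
    exact this
  have hB' : HasSimpleNonzeroSpectrum (X * contract T γ)ᵀ (fun a => (l a)⁻¹) v := by
    have hl' : l = fun a => _ := funext fun a => (hw a).2.2
    have := hasSimpleNonzeroSpectrum_transpose_weightedSquares hv (fun a => (hw a).1)
      (fun a => (hw a).2.1) (by rw [← hl']; exact hl) (h1 ▸ hX)
    rw [← h2] at this
    convert this using 3 with a
    exact (hw a).2.2
  have key := SimDiagRun.success X Y hX hY s l v v hA' hB' (fun a => vecMulVec (K a) (K a)) hdual
    (by
      rintro ⟨a, b, hab, hmem⟩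
      rw [hy, hy] at hmem
      obtain ⟨c, hc⟩ := Submodule.mem_span_singleton.1 hmem
      -- The forbidden relation is `z a - c • z b = 0`.
      have := Fintype.linearIndependent_iff.1 hz (fun i => if i = a then 1 else if i = b then -c else 0)
        (by
          rw [Finset.sum_eq_add_of_mem a b (Finset.mem_univ _) (Finset.mem_univ _) hab
            (by rintro d - ⟨h1, h2⟩; simp [h1, h2])]
          simp [hab.symm, ← hc]) a
      simp at this)
  simpa only [hy] using key

/-- The coefficients of symmetric matrices with respect to the squares of the columns of `P`. -/
theorem eq_sum_squares_of_diagonalization {s : ℕ} {M P Q : Matrix ι ι 𝕜} {d : ι → 𝕜}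
    (hPQ : P * Q = 1) (hM : M = P * diagonal d * Q) {l : Fin s → 𝕜} {v : Fin s → ι → 𝕜}
    (h : HasSimpleNonzeroSpectrum M l v) :
    Fintype.card {i // d i ≠ 0} = s ∧ (∀ i j, d i ≠ 0 → d i = d j → i = j) ∧
    ∀ c : Fin s → 𝕜, ∀ j k, weightedSquares v c j k = ∑ i : {i // d i ≠ 0},
      (∑ x, ∑ y, Q i x * weightedSquares v c x y * Q i y) * (P j i * P k i) := by
  have hQP : Q * P = 1 := mul_eq_one_comm.1 hPQ
  have hPu : IsUnit P.det := (Matrix.isUnit_iff_isUnit_det _).1 (IsUnit.of_mul_eq_one _ hPQ)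
  have hQu : IsUnit Q.det := (Matrix.isUnit_iff_isUnit_det _).1 (IsUnit.of_mul_eq_one _ hQP)
  have hcol : ∀ i, M *ᵥ P.col i = d i • P.col i := by
    intro i
    have h1 : M * P = P * diagonal d := by rw [hM, Matrix.mul_assoc, hQP, Matrix.mul_one]
    ext j
    have := congrFun (congrFun h1 j) i
    rw [mul_diagonal] at this
    simpa [Matrix.mul_apply, mulVec, dotProduct, mul_comm] using this
  have hQcol : ∀ i, Q *ᵥ P.col i = Pi.single i 1 := by
    intro i
    ext j
    have := congrFun (congrFun hQP j) i
    rw [Matrix.one_apply] at this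
    simpa [Matrix.mul_apply, mulVec, dotProduct, Pi.single_apply] using this
  have hcol0 : ∀ i, P.col i ≠ 0 := by
    intro i h0
    have := congrFun (hQcol i) i
    rw [h0] at this
    simp at this
  have hcard : Fintype.card {i // d i ≠ 0} = s := by
    rw [← h.rank_eq, hM, rank_mul_eq_left_of_isUnit_det _ _ hQu,
      rank_mul_eq_right_of_isUnit_det _ _ hPu, rank_diagonal]
  have hinj : ∀ i j, d i ≠ 0 → d i = d j → i = j := by
    intro i j hi hij
    obtain ⟨a, c, h1, h2⟩ := h.exists_smul_eq hi (hcol0 i) (hcol i)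
    obtain ⟨b, c', h3, h4⟩ := h.exists_smul_eq (hij ▸ hi) (hcol0 j) (hcol j)
    have hab : a = b := h.injective (by rw [← h2, ← h4, hij])
    subst hab
    by_contra hne
    have h5 : c' • P.col i = c • P.col j := by rw [h1, h3, smul_comm]
    have h6 := congrArg (Q *ᵥ ·) h5
    simp only [mulVec_smul, hQcol] at h6
    have h7 := congrFun h6 i
    simp [hne] at h7
    rw [h7, zero_smul] at h3
    exact hcol0 j h3
  refine ⟨hcard, hinj, ?_⟩
  -- The coordinates of `v a` in the basis of columns of `P` can be nonzero only where `d` takes the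
  -- value `l a`. The nonzero values of `d` are distinct, so just one coordinate survives.
  have hva : ∀ a, ∃ (i : {i // d i ≠ 0}) (c : 𝕜), v a = c • P.col i := by
    intro a
    set y := Q *ᵥ v a with hy
    have hPy : v a = P *ᵥ y := by rw [hy, mulVec_mulVec, hPQ, one_mulVec]
    have h1 : ∀ i, d i * y i = l a * y i := by
      intro i
      have h2 := congrArg (Q *ᵥ ·) (h.eigen a)
      simp only [mulVec_smul, ← hy] at h2
      rw [hM, mulVec_mulVec, ← Matrix.mul_assoc, ← Matrix.mul_assoc, hQP, Matrix.one_mul,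
        ← mulVec_mulVec, ← hy] at h2
      have h3 := congrFun h2 i
      simpa [mulVec_diagonal] using h3
    obtain ⟨i, hi⟩ : ∃ i, y i ≠ 0 := by
      by_contra! h0
      exact h.vec_ne_zero a (by rw [hPy, show y = 0 from funext h0, mulVec_zero])
    have hdi : ∀ i, y i ≠ 0 → d i = l a := fun i hi => mul_right_cancel₀ hi (h1 i)
    refine ⟨⟨i, by rw [hdi i hi]; exact h.ne_zero a⟩, y i, ?_⟩
    have hyi : y = y i • Pi.single i 1 := by
      ext j
      by_cases hj : j = i
      · simp [hj]
      · have : y j = 0 := by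
          by_contra h0
          exact hj (hinj j i (by rw [hdi j h0]; exact h.ne_zero a) ((hdi j h0).trans (hdi i hi).symm))
        simp [hj, this]
    rw [hPy]
    conv_lhs => rw [hyi]
    rw [mulVec_smul, mulVec_single_one]
  have hQP' : ∀ i j, ∑ x, Q i x * P x j = if i = j then 1 else 0 := by
    intro i j
    rw [← Matrix.mul_apply, hQP, Matrix.one_apply]
  have hsq : ∀ (i i' : ι) (c : 𝕜), ∑ x, ∑ y, Q i x * (c * (P x i' * P y i')) * Q i y =
      c * (if i = i' then 1 else 0) := by
    intro i i' c
    have : ∑ x, ∑ y, Q i x * (c * (P x i' * P y i')) * Q i y =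
        c * ((∑ x, Q i x * P x i') * ∑ y, Q i y * P y i') := by
      rw [Finset.sum_mul_sum, Finset.mul_sum]
      refine Finset.sum_congr rfl fun x _ => ?_
      rw [Finset.mul_sum]
      exact Finset.sum_congr rfl fun y _ => by ring
    rw [this, hQP']
    split_ifs <;> simp
  choose i₀ c₀ hv using hva
  intro c j k
  -- Rescaling a column by `c₀ a` multiplies its square by `c₀ a ^ 2`. Pairing with row `i` of `Q`
  -- on both sides recovers the coefficient of the `i`-th square, since `Q * P = 1`.
  have hW : ∀ x y, weightedSquares v c x y =
      ∑ a, (c a * c₀ a ^ 2) * (P x (i₀ a) * P y (i₀ a)) := by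
    intro x y
    simp only [weightedSquares, Matrix.sum_apply, Matrix.smul_apply, vecMulVec_apply, hv,
      Pi.smul_apply, smul_eq_mul, Matrix.col_apply]
    exact Finset.sum_congr rfl fun a _ => by ring
  have h1 : ∀ i, ∑ x, ∑ y, Q i x * weightedSquares v c x y * Q i y =
      ∑ a, (c a * c₀ a ^ 2) * (if i = (i₀ a : ι) then 1 else 0) := by
    intro i
    simp only [hW, Finset.mul_sum, Finset.sum_mul]
    rw [Finset.sum_comm_cycle]
    exact Finset.sum_congr rfl fun a _ => hsq i (i₀ a) _
  simp only [h1, Finset.sum_mul]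
  rw [Finset.sum_comm, hW]
  refine Finset.sum_congr rfl fun a _ => ?_
  rw [Finset.sum_eq_single (i₀ a) (fun i _ hi => ?_) (by simp)]
  · simp
  · rw [if_neg (fun h => hi (Subtype.ext h))]
    simp

end SimDiag
end EntangledSubspace

namespace EntangledSubspace

/-! ## Quadrics -/

section Quadrics

variable {𝕜 : Type*} [RCLike 𝕜] {ι : Type*} [Fintype ι] [DecidableEq ι]

/-- The exponent of the monomial `x_a x_b`. -/
noncomputable def pairExponent {ι : Type*} [DecidableEq ι] (z : Sym2 ι) : ι →₀ ℕ :=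
  Multiset.toFinsupp z.toMultiset

theorem pairExponent_mk (a b : ι) :
    pairExponent s(a, b) = Finsupp.single a 1 + Finsupp.single b 1 := by
  have : (s(a, b) : Sym2 ι).toMultiset = {a} + {b} := rfl
  rw [pairExponent, this, map_add, Multiset.toFinsupp_singleton, Multiset.toFinsupp_singleton]

theorem pairExponent_injective : Function.Injective (pairExponent (ι := ι)) := by
  intro z w h
  have h' : z.toMultiset = w.toMultiset := Multiset.toFinsupp.injective h
  induction z using Sym2.inductionOn with | _ a b
  induction w using Sym2.inductionOn with | _ c d
  have h2 : (a ::ₘ {b} : Multiset ι) = c ::ₘ {d} := h'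
  rw [Multiset.cons_eq_cons] at h2
  rw [Sym2.eq_iff]
  rcases h2 with ⟨h3, h4⟩ | ⟨_, cs, h4, h5⟩
  · exact .inl ⟨h3, by simpa using h4⟩
  · rw [Multiset.singleton_eq_cons_iff] at h4 h5
    exact .inr ⟨h5.1.symm, h4.1⟩

theorem exists_pairExponent_eq {d : ι →₀ ℕ} (hd : d.degree = 2) : ∃ z, pairExponent z = d := by
  have h : (Finsupp.toMultiset d).card = 2 := by
    rw [Finsupp.card_toMultiset, ← hd]; rfl
  obtain ⟨a, b, hab⟩ := Multiset.card_eq_two.1 h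
  refine ⟨s(a, b), ?_⟩
  rw [pairExponent, show (s(a, b) : Sym2 ι).toMultiset = {a, b} from rfl, ← hab,
    Finsupp.toMultiset_toFinsupp]

theorem degree_pairExponent (z : Sym2 ι) : (pairExponent z).degree = 2 := by
  induction z using Sym2.inductionOn with | _ a b
  rw [pairExponent_mk, map_add, Finsupp.degree_single, Finsupp.degree_single]

/-- The value of the monomial `x_a x_b`. -/
def pairValue (x : ι → 𝕜) : Sym2 ι → 𝕜 :=
  Sym2.lift ⟨fun a b => x a * x b, fun _ _ => mul_comm _ _⟩

@[simp]
theorem pairValue_mk (x : ι → 𝕜) (a b : ι) : pairValue x s(a, b) = x a * x b := rfl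

theorem prod_pow_pairExponent (x : ι → 𝕜) (z : Sym2 ι) :
    ∏ c, x c ^ pairExponent z c = pairValue x z := by
  induction z using Sym2.inductionOn with | _ a b
  simp only [pairExponent_mk, Finsupp.add_apply, pow_add, Finset.prod_mul_distrib,
    Finsupp.single_apply, pow_ite, pow_one, pow_zero, Finset.prod_ite_eq, Finset.mem_univ, if_true,
    pairValue_mk]

/-- The quadric with given coefficients. -/
noncomputable def quadOfCoeffs : (Sym2 ι → 𝕜) →ₗ[𝕜] MvPolynomial ι 𝕜 :=
  ∑ z, (MvPolynomial.monomial (pairExponent z)).comp (LinearMap.proj z)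

theorem quadOfCoeffs_apply (g : Sym2 ι → 𝕜) :
    quadOfCoeffs g = ∑ z, MvPolynomial.monomial (pairExponent z) (g z) := by
  simp [quadOfCoeffs]

theorem coeff_quadOfCoeffs (g : Sym2 ι → 𝕜) (z : Sym2 ι) :
    MvPolynomial.coeff (pairExponent z) (quadOfCoeffs g) = g z := by
  simp [quadOfCoeffs_apply, MvPolynomial.coeff_sum, MvPolynomial.coeff_monomial,
    pairExponent_injective.eq_iff]

theorem quadOfCoeffs_injective : Function.Injective (quadOfCoeffs (𝕜 := 𝕜) (ι := ι)) := by
  intro g g' h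
  ext z
  rw [← coeff_quadOfCoeffs g, h, coeff_quadOfCoeffs]

theorem isHomogeneous_quadOfCoeffs (g : Sym2 ι → 𝕜) : (quadOfCoeffs g).IsHomogeneous 2 := by
  rw [quadOfCoeffs_apply]
  exact MvPolynomial.IsHomogeneous.sum _ _ _ fun z _ =>
    MvPolynomial.isHomogeneous_monomial _ (degree_pairExponent z)

theorem quadOfCoeffs_coeff {q : MvPolynomial ι 𝕜} (hq : q.IsHomogeneous 2) :
    quadOfCoeffs (fun z => MvPolynomial.coeff (pairExponent z) q) = q := by
  ext d
  by_cases hd : d.degree = 2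
  · obtain ⟨z, rfl⟩ := exists_pairExponent_eq hd
    rw [coeff_quadOfCoeffs]
  · rw [hq.coeff_eq_zero hd, (isHomogeneous_quadOfCoeffs _).coeff_eq_zero hd]

theorem eval_quadOfCoeffs (g : Sym2 ι → 𝕜) (x : ι → 𝕜) :
    MvPolynomial.eval x (quadOfCoeffs g) = ∑ z, g z * pairValue x z := by
  simp only [quadOfCoeffs_apply, map_sum, MvPolynomial.eval_monomial, Finsupp.prod_pow,
    prod_pow_pairExponent]

theorem quadCoeff_eq (q : MvPolynomial ι 𝕜) (j k : ι) :
    quadCoeff q j k = MvPolynomial.coeff (pairExponent s(j, k)) q := by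
  rw [quadCoeff, pairExponent_mk]

/-- An unordered pair of distinct indices comes from two ordered pairs, which explains the halves
off the diagonal. -/
theorem sum_pairs_eq_sum_sym2 (F : Sym2 ι → 𝕜) :
    ∑ j, ∑ k, (if j = k then F s(j, k) else F s(j, k) / 2) = ∑ z, F z := by
  rw [← Fintype.sum_prod_type' (f := fun j k => if j = k then F s(j, k) else F s(j, k) / 2),
    ← Finset.sum_fiberwise_of_maps_to (s := Finset.univ) (t := Finset.univ)
      (g := fun p : ι × ι => s(p.1, p.2)) (by simp)]
  refine Finset.sum_congr rfl fun z _ => ?_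
  induction z using Sym2.inductionOn with | _ a b
  by_cases hab : a = b
  · subst hab
    rw [Finset.sum_eq_single (a, a)]
    · simp
    · rintro ⟨c, d⟩ hc hne
      simp at hc
      exact absurd (Prod.ext hc.1 hc.2) hne
    · simp
  · have : Finset.univ.filter (fun p : ι × ι => s(p.1, p.2) = s(a, b)) = {(a, b), (b, a)} := by
      ext ⟨c, d⟩
      simp
    rw [this, Finset.sum_pair (by simp [hab])]
    simp only [hab, Ne.symm hab, if_false, Sym2.eq_swap (a := b) (b := a)]
    exact add_halves _

theorem quadMatrix_comm (q : MvPolynomial ι 𝕜) (j k : ι) : quadMatrix q j k = quadMatrix q k j := by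
  simp only [quadMatrix, quadCoeff_eq, Sym2.eq_swap (a := j) (b := k), eq_comm (a := j)]

theorem eval_eq_sum_quadMatrix {q : MvPolynomial ι 𝕜} (hq : q.IsHomogeneous 2) (x : ι → 𝕜) :
    MvPolynomial.eval x q = ∑ j, ∑ k, quadMatrix q j k * (x j * x k) := by
  conv_lhs => rw [← quadOfCoeffs_coeff hq]
  rw [eval_quadOfCoeffs, ← sum_pairs_eq_sum_sym2]
  refine Finset.sum_congr rfl fun j _ => Finset.sum_congr rfl fun k _ => ?_
  simp only [quadMatrix, quadCoeff_eq, pairValue_mk]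
  split_ifs <;> ring

/-- The matrix of a quadric, as a linear map. -/
noncomputable def quadMatrixLin : MvPolynomial ι 𝕜 →ₗ[𝕜] Matrix ι ι 𝕜 where
  toFun := quadMatrix
  map_add' p q := by
    ext j k
    simp only [quadMatrix, quadCoeff, MvPolynomial.coeff_add, Matrix.add_apply]
    split_ifs <;> ring
  map_smul' c q := by
    ext j k
    simp only [quadMatrix, quadCoeff, MvPolynomial.coeff_smul, Matrix.smul_apply, smul_eq_mul,
      RingHom.id_apply]
    split_ifs <;> ring

theorem eq_zero_of_quadMatrix_eq_zero {q : MvPolynomial ι 𝕜} (hq : q.IsHomogeneous 2)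
    (h : quadMatrix q = 0) : q = 0 := by
  rw [← quadOfCoeffs_coeff hq]
  have h0 : (fun z => MvPolynomial.coeff (pairExponent z) q) = 0 := by
    funext z
    induction z using Sym2.inductionOn with | _ j k
    have := congrFun (congrFun h j) k
    rw [quadMatrix, quadCoeff_eq] at this
    split_ifs at this with hjk
    · exact this
    · simpa using this
  rw [h0, map_zero]

theorem linearIndependent_quadMatrix {p : ℕ} {f : Fin p → MvPolynomial ι 𝕜}
    (hf : ∀ i, (f i).IsHomogeneous 2) (hli : LinearIndependent 𝕜 f) :
    LinearIndependent 𝕜 fun i => quadMatrix (f i) := by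
  rw [Fintype.linearIndependent_iff] at hli ⊢
  intro c hc
  refine hli c (eq_zero_of_quadMatrix_eq_zero ?_ ?_)
  · refine MvPolynomial.IsHomogeneous.sum _ _ _ fun i _ => ?_
    rw [MvPolynomial.smul_eq_C_mul]
    simpa using (MvPolynomial.isHomogeneous_C ι (c i)).mul (hf i)
  · have := map_sum (quadMatrixLin (𝕜 := 𝕜) (ι := ι)) (fun i => c i • f i) Finset.univ
    simp only [map_smul] at this
    exact this.trans hc

end Quadrics

/-! ## The quadrics that vanish on product tensors -/

section Segre

variable {𝕜 : Type*} [RCLike 𝕜] {m : ℕ} {n : Fin m → ℕ}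

/-- The factors of a pair of multi-indices. -/
def splitPair (z : Sym2 (∀ i, Fin (n i))) : ∀ i, Sym2 (Fin (n i)) := fun i => z.map (· i)

theorem splitPair_surjective : Function.Surjective (splitPair (n := n)) := by
  intro t
  have : ∀ i, ∃ p : Fin (n i) × Fin (n i), s(p.1, p.2) = t i := fun i => by
    induction t i using Sym2.inductionOn with | _ a b
    exact ⟨(a, b), rfl⟩
  choose p hp using this
  exact ⟨s(fun i => (p i).1, fun i => (p i).2), funext fun i => hp i⟩

/-- The coefficients of the restriction of a quadric to product tensors, as a multihomogeneous
polynomial in the factors. -/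
noncomputable def restrictCoeffs :
    (Sym2 (∀ i, Fin (n i)) → 𝕜) →ₗ[𝕜] ((∀ i, Sym2 (Fin (n i))) → 𝕜) where
  toFun g t := ∑ z with splitPair z = t, g z
  map_add' g g' := by ext t; simp [Finset.sum_add_distrib]
  map_smul' c g := by ext t; simp [Finset.mul_sum]

theorem restrictCoeffs_apply (g : Sym2 (∀ i, Fin (n i)) → 𝕜) (t : ∀ i, Sym2 (Fin (n i))) :
    restrictCoeffs g t = ∑ z with splitPair z = t, g z := rfl

/-- The given coefficients are placed on a section of the surjection `splitPair`, one monomial for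
each fibre. -/
theorem restrictCoeffs_surjective :
    Function.Surjective (restrictCoeffs (𝕜 := 𝕜) (n := n)) := by
  intro h
  refine ⟨fun z => if Function.surjInv splitPair_surjective (splitPair z) = z
    then h (splitPair z) else 0, ?_⟩
  ext t
  rw [restrictCoeffs_apply, Finset.sum_eq_single (Function.surjInv splitPair_surjective t)]
  · simp [Function.surjInv_eq]
  · intro z hz hne
    rw [Finset.mem_filter] at hz
    rw [hz.2, if_neg hne.symm]
  · simp [Function.surjInv_eq]

/-- Rank-nullity: `Sym2` of a set with `k` elements has `(k + 1).choose 2` elements. -/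
theorem finrank_ker_restrictCoeffs :
    Module.finrank 𝕜 (LinearMap.ker (restrictCoeffs (𝕜 := 𝕜) (n := n))) = numQuadrics n := by
  have h := LinearMap.finrank_range_add_finrank_ker (restrictCoeffs (𝕜 := 𝕜) (n := n))
  rw [LinearMap.range_eq_top.2 restrictCoeffs_surjective, finrank_top, Module.finrank_pi,
    Module.finrank_pi, Sym2.card, Fintype.card_pi, Fintype.card_pi] at h
  simp only [Sym2.card, Fintype.card_fin] at h
  rw [numQuadrics, totalDim]
  omega

theorem pairValue_productTensor (y : ∀ i, Fin (n i) → 𝕜) (z : Sym2 (∀ i, Fin (n i))) :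
    pairValue (productTensor y) z = ∏ i, pairValue (y i) (splitPair z i) := by
  induction z using Sym2.inductionOn with | _ a b
  simp [splitPair, productTensor, Finset.prod_mul_distrib]

theorem eval_productTensor (g : Sym2 (∀ i, Fin (n i)) → 𝕜) (y : ∀ i, Fin (n i) → 𝕜) :
    MvPolynomial.eval (productTensor y) (quadOfCoeffs g) =
      ∑ t, restrictCoeffs g t * ∏ i, pairValue (y i) (t i) := by
  rw [eval_quadOfCoeffs, ← Finset.sum_fiberwise_of_maps_to (s := Finset.univ) (t := Finset.univ)
      (g := splitPair) (by simp)]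
  refine Finset.sum_congr rfl fun t _ => ?_
  rw [restrictCoeffs_apply, Finset.sum_mul]
  refine Finset.sum_congr rfl fun z hz => ?_
  rw [pairValue_productTensor, (Finset.mem_filter.1 hz).2]

/-- A quadric vanishes on the product tensors if and only if its restriction has no nonzero
coefficients. -/
theorem forall_eval_eq_zero_iff (g : Sym2 (∀ i, Fin (n i)) → 𝕜) :
    (∀ x ∈ productTensors 𝕜 n, MvPolynomial.eval x (quadOfCoeffs g) = 0) ↔
      restrictCoeffs g = 0 := by
  constructor
  · intro h
    -- Distinct `t` give distinct monomials in the coordinates of the factors. A polynomial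
    -- vanishing everywhere over an infinite field is zero, so all its coefficients vanish.
    let E : (∀ i, Sym2 (Fin (n i))) → ((Σ i, Fin (n i)) →₀ ℕ) := fun t =>
      Finsupp.equivFunOnFinite.symm fun p => pairExponent (t p.1) p.2
    have hE : Function.Injective E := by
      intro t t' htt
      funext i
      apply pairExponent_injective
      ext c
      exact DFunLike.congr_fun htt ⟨i, c⟩
    have h0 : ∑ t, MvPolynomial.monomial (E t) (restrictCoeffs g t) = 0 := by
      apply MvPolynomial.funext
      intro y
      rw [map_zero, map_sum, ← h _ ⟨fun i c => y ⟨i, c⟩, rfl⟩, eval_productTensor]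
      refine Finset.sum_congr rfl fun t _ => ?_
      rw [MvPolynomial.eval_monomial, Finsupp.prod_pow, Fintype.prod_sigma]
      congr 1
      refine Finset.prod_congr rfl fun i _ => ?_
      rw [← prod_pow_pairExponent]
      rfl
    ext t
    have := congrArg (MvPolynomial.coeff (E t)) h0
    simpa [MvPolynomial.coeff_sum, MvPolynomial.coeff_monomial, hE.eq_iff] using this
  · rintro h _ ⟨y, rfl⟩
    rw [eval_productTensor, h]
    simp

/-- The coefficients of `x_j x_k - x_{j'} x_{k'}`, where `j'`, `k'` arise from `j`, `k` by exchanging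
the entries at position `i`. -/
noncomputable def swapMinor (j k : ∀ i, Fin (n i)) (i : Fin m) : Sym2 (∀ i, Fin (n i)) → 𝕜 :=
  Pi.single s(j, k) 1 - Pi.single s(Function.update j i (k i), Function.update k i (j i)) 1

/-- Exchanging the entries at one position changes none of the unordered pairs `{j l, k l}`, so both
monomials have the same restriction. -/
theorem swapMinor_mem_ker (j k : ∀ i, Fin (n i)) (i : Fin m) :
    swapMinor (𝕜 := 𝕜) j k i ∈ LinearMap.ker (restrictCoeffs (𝕜 := 𝕜) (n := n)) := by
  have h1 : ∀ z, restrictCoeffs (Pi.single z (1 : 𝕜)) = Pi.single (splitPair (n := n) z) 1 := by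
    intro z
    ext t
    rw [restrictCoeffs_apply]
    simp only [Pi.single_apply, Finset.sum_filter]
    rw [Finset.sum_eq_single z (by intro b _ hb; simp [hb]) (by simp)]
    simp [eq_comm]
  rw [LinearMap.mem_ker, swapMinor, map_sub, h1, h1, sub_eq_zero]
  congr 1
  funext l
  by_cases hl : l = i
  · subst hl
    simp [splitPair, Sym2.eq_swap]
  · simp [splitPair, Function.update_of_ne hl]

/-- Relative to a nonzero coordinate `x o`, the swap equations allow the entries of `o` to be
replaced one at a time, each at the cost of a factor `x (update o i (j i)) / x o`. Positivity of `m`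
gives the zero tensor a factor to vanish in and provides a factor to absorb the scalar `x o`. -/
theorem mem_productTensors_of_swap (hm : 0 < m) {x : Tensor 𝕜 n}
    (h : ∀ j k i, x j * x k = x (Function.update j i (k i)) * x (Function.update k i (j i))) :
    x ∈ productTensors 𝕜 n := by
  by_cases hx : x = 0
  · refine ⟨0, ?_⟩
    ext j
    rw [hx]
    exact Finset.prod_eq_zero (Finset.mem_univ ⟨0, hm⟩) rfl
  obtain ⟨o, ho⟩ := Function.ne_iff.1 hx
  rw [Pi.zero_apply] at ho
  have key : ∀ (s : Finset (Fin m)) (j : ∀ i, Fin (n i)),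
      x (s.piecewise j o) = x o * ∏ i ∈ s, (x (Function.update o i (j i)) / x o) := by
    intro s j
    induction s using Finset.induction_on with
    | empty => simp
    | insert i s hi ih =>
      rw [Finset.prod_insert hi, Finset.piecewise_insert]
      have h1 := h (Function.update (s.piecewise j o) i (j i)) o i
      have h2 : Function.update (Function.update (s.piecewise j o) i (j i)) i (o i) =
          s.piecewise j o := by
        rw [Function.update_idem, ← Finset.piecewise_eq_of_notMem s j o hi, Function.update_eq_self]
      rw [h2, Function.update_self, ih] at h1
      refine mul_right_cancel₀ ho (h1.trans ?_)
      field_simp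
  -- The factor at position `0` is not divided by `x o`; this accounts for the leading `x o` in
  -- `key`.
  refine ⟨fun i c => if i = ⟨0, hm⟩ then x (Function.update o i c)
    else x (Function.update o i c) / x o, ?_⟩
  ext j
  have := key Finset.univ j
  rw [Finset.piecewise_univ] at this
  rw [this, productTensor, ← Finset.mul_prod_erase _ _ (Finset.mem_univ (⟨0, hm⟩ : Fin m)),
    ← Finset.mul_prod_erase Finset.univ _ (Finset.mem_univ (⟨0, hm⟩ : Fin m)), if_pos rfl,
    ← mul_assoc, mul_div_cancel₀ _ ho]
  congr 1
  refine Finset.prod_congr rfl fun i hi => ?_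
  rw [if_neg (Finset.ne_of_mem_erase hi)]

theorem forall_swap_of_eval {x : Tensor 𝕜 n}
    (h : ∀ g ∈ LinearMap.ker (restrictCoeffs (𝕜 := 𝕜) (n := n)),
      MvPolynomial.eval x (quadOfCoeffs g) = 0) (j k : ∀ i, Fin (n i)) (i : Fin m) :
    x j * x k = x (Function.update j i (k i)) * x (Function.update k i (j i)) := by
  have := h _ (swapMinor_mem_ker j k i)
  rw [eval_quadOfCoeffs] at this
  simpa [swapMinor, sub_mul, Finset.sum_sub_distrib, Pi.single_apply, sub_eq_zero] using this

theorem exists_cutsOutByQuadrics (hm : 0 < m) :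
    ∃ f : Fin (numQuadrics n) → MvPolynomial (∀ i, Fin (n i)) 𝕜,
      CutsOutByQuadrics f (productTensors 𝕜 n) := by
  let b := Module.finBasisOfFinrankEq 𝕜 _ (finrank_ker_restrictCoeffs (𝕜 := 𝕜) (n := n))
  refine ⟨fun i => quadOfCoeffs (b i), fun i => isHomogeneous_quadOfCoeffs _, ?_, ?_⟩
  · exact (b.linearIndependent.map' _ (Submodule.ker_subtype _)).map' quadOfCoeffs
      (LinearMap.ker_eq_bot.2 quadOfCoeffs_injective)
  · ext x
    constructor
    · intro hx
      refine mem_productTensors_of_swap hm (forall_swap_of_eval fun g hg => ?_)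
      have h1 := b.sum_repr ⟨g, hg⟩
      have h2 : g = ∑ i, b.repr ⟨g, hg⟩ i • (b i : Sym2 (∀ i, Fin (n i)) → 𝕜) := by
        have h3 := congrArg (Submodule.subtype _) h1
        rw [map_sum] at h3
        simpa only [map_smul, Submodule.subtype_apply] using h3.symm
      rw [h2]
      simp only [map_sum, map_smul, MvPolynomial.smul_eval]
      exact Finset.sum_eq_zero fun i _ => by rw [hx i, mul_zero]
    · intro hx i
      exact (forall_eval_eq_zero_iff _).2 (b i).2 x hx

/-- The given quadrics are independent, vanish on `X`, and equal in number the dimension of the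
space of all quadrics vanishing on `X`. Hence they span that space, and in particular the swap
minors are available from any admissible `f`. -/
theorem quadOfCoeffs_mem_span {f : Fin (numQuadrics n) → MvPolynomial (∀ i, Fin (n i)) 𝕜}
    (hf : CutsOutByQuadrics f (productTensors 𝕜 n)) {g : Sym2 (∀ i, Fin (n i)) → 𝕜}
    (hg : g ∈ LinearMap.ker (restrictCoeffs (𝕜 := 𝕜) (n := n))) :
    quadOfCoeffs g ∈ Submodule.span 𝕜 (Set.range f) := by
  have h1 : Submodule.span 𝕜 (Set.range f) =
      (LinearMap.ker (restrictCoeffs (𝕜 := 𝕜) (n := n))).map quadOfCoeffs := by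
    apply Submodule.eq_of_le_of_finrank_eq
    · rw [Submodule.span_le]
      rintro _ ⟨i, rfl⟩
      refine ⟨fun z => MvPolynomial.coeff (pairExponent z) (f i), ?_,
        quadOfCoeffs_coeff (hf.homogeneous i)⟩
      rw [SetLike.mem_coe, LinearMap.mem_ker, ← forall_eval_eq_zero_iff,
        quadOfCoeffs_coeff (hf.homogeneous i)]
      intro x hx
      rw [← hf.zeroSet] at hx
      exact hx i
    · rw [finrank_span_eq_card hf.linearIndependent, Fintype.card_fin,
        ← (Submodule.equivMapOfInjective _ quadOfCoeffs_injective _).finrank_eq,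
        finrank_ker_restrictCoeffs]
  rw [h1]
  exact ⟨g, hg, rfl⟩

end Segre
end EntangledSubspace

namespace EntangledSubspace

/-! ## Runs of the algorithm -/

section Runs

variable {𝕜 : Type*} [RCLike 𝕜] {ι : Type*} [Fintype ι] [DecidableEq ι]

theorem vecMulVec_mem_symSquare {U : Submodule 𝕜 (ι → 𝕜)} {x y : ι → 𝕜} (hx : x ∈ U) (hy : y ∈ U) :
    vecMulVec x y + vecMulVec y x ∈ symSquare U := by
  have h : vecMulVec x y + vecMulVec y x =
      vecMulVec (x + y) (x + y) - vecMulVec x x - vecMulVec y y := by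
    rw [add_vecMulVec, vecMulVec_add, vecMulVec_add]
    abel
  rw [h]
  exact Submodule.sub_mem _ (Submodule.sub_mem _
    (Submodule.subset_span ⟨_, U.add_mem hx hy, rfl⟩) (Submodule.subset_span ⟨_, hx, rfl⟩))
    (Submodule.subset_span ⟨_, hy, rfl⟩)

theorem mem_symSquare_span_iff {R : ℕ} {v : Fin R → ι → 𝕜} {M : Matrix ι ι 𝕜} :
    M ∈ symSquare (Submodule.span 𝕜 (Set.range v)) ↔ ∃ c : Fin R → Fin R → 𝕜,
      (∀ a b, c a b = c b a) ∧ M = ∑ a, ∑ b, c a b • vecMulVec (v a) (v b) := by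
  constructor
  · intro hM
    induction hM using Submodule.span_induction with
    | mem M hM =>
      obtain ⟨x, hx, rfl⟩ := hM
      obtain ⟨d, rfl⟩ := (Submodule.mem_span_range_iff_exists_fun 𝕜).1 hx
      refine ⟨fun a b => d a * d b, fun a b => mul_comm _ _, ?_⟩
      ext j k
      simp only [vecMulVec_apply, Matrix.sum_apply, Matrix.smul_apply, smul_eq_mul,
        Finset.sum_apply, Pi.smul_apply]
      rw [Finset.sum_mul_sum]
      exact Finset.sum_congr rfl fun a _ => Finset.sum_congr rfl fun b _ => by ring
    | zero => exact ⟨0, fun _ _ => rfl, by simp⟩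
    | add M M' _ _ h h' =>
      obtain ⟨c, hc, rfl⟩ := h
      obtain ⟨c', hc', rfl⟩ := h'
      exact ⟨c + c', fun a b => by simp [hc a b, hc' a b], by
        simp [add_smul, Finset.sum_add_distrib]⟩
    | smul t M _ h =>
      obtain ⟨c, hc, rfl⟩ := h
      exact ⟨t • c, fun a b => by simp [hc a b], by simp [Finset.smul_sum, smul_smul]⟩
  · rintro ⟨c, hc, rfl⟩
    have hmem : ∀ a, v a ∈ Submodule.span 𝕜 (Set.range v) := fun a =>
      Submodule.subset_span ⟨a, rfl⟩
    have h : ∑ a, ∑ b, c a b • vecMulVec (v a) (v b) = (2⁻¹ : 𝕜) • ∑ a, ∑ b,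
        c a b • (vecMulVec (v a) (v b) + vecMulVec (v b) (v a)) := by
      have hsw : ∑ a, ∑ b, c a b • vecMulVec (v b) (v a) =
          ∑ a, ∑ b, c a b • vecMulVec (v a) (v b) := by
        rw [Finset.sum_comm]
        exact Finset.sum_congr rfl fun a _ => Finset.sum_congr rfl fun b _ => by rw [hc]
      simp only [smul_add, Finset.sum_add_distrib]
      rw [hsw, ← smul_add, ← two_smul 𝕜 (∑ a, ∑ b, _), smul_smul, inv_mul_cancel₀ two_ne_zero,
        one_smul]
    rw [h]
    exact Submodule.smul_mem _ _ (Submodule.sum_mem _ fun a _ => Submodule.sum_mem _ fun b _ =>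
      Submodule.smul_mem _ _ (vecMulVec_mem_symSquare (hmem a) (hmem b)))

/-- All matrices in `S²(U)` have their image in `U`, and the image of `x ⊗ x` is spanned by `x`. -/
theorem mem_of_vecMulVec_mem_symSquare {U : Submodule 𝕜 (ι → 𝕜)} {x : ι → 𝕜}
    (h : vecMulVec x x ∈ symSquare U) : x ∈ U := by
  have key : ∀ M ∈ symSquare U, ∀ y, M *ᵥ y ∈ U := by
    intro M hM y
    induction hM using Submodule.span_induction with
    | mem M hM =>
      obtain ⟨z, hz, rfl⟩ := hM
      rw [vecMulVec_mulVec]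
      exact U.smul_of_tower_mem _ hz
    | zero => simp
    | add M M' _ _ h h' => rw [add_mulVec]; exact U.add_mem h h'
    | smul t M _ h => rw [smul_mulVec]; exact U.smul_mem _ h
  by_cases hx : x = 0
  · rw [hx]; exact U.zero_mem
  obtain ⟨j, hj⟩ := Function.ne_iff.1 hx
  have h1 := key _ h (Pi.single j 1)
  have h2 : vecMulVec x x *ᵥ (Pi.single j 1) = x j • x := by
    ext k
    simp [vecMulVec_apply, mul_comm]
  rw [h2] at h1
  exact (U.smul_mem_iff hj).1 h1

theorem vecMulVec_mem_quadricsPerp_iff {p : ℕ} {f : Fin p → MvPolynomial ι 𝕜}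
    (hf : ∀ i, (f i).IsHomogeneous 2) {x : ι → 𝕜} :
    vecMulVec x x ∈ quadricsPerp f ↔ ∀ i, MvPolynomial.eval x (f i) = 0 := by
  refine forall_congr' fun i => ?_
  rw [eval_eq_sum_quadMatrix (hf i)]
  rfl

variable {R p : ℕ} {u : Fin R → ι → 𝕜} {f : Fin p → MvPolynomial ι 𝕜} {φ γ : Fin R → 𝕜}

/-- With one component the combination step could alter only an empty list of found vectors. Such a
list would come from an empty basis of `certSpace`, which is excluded because that space is nonzero.
-/
theorem alg2RunIrreducible_iff {out : Outcome (ι → 𝕜)} :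
    Alg2RunIrreducible u f φ γ out ↔ Alg1Run u f φ γ out := by
  have hcomb : ∀ o, Alg1Run u f φ γ o → combineOutcomes [o] = o := by
    intro o ho
    cases ho with
    | trivial h => rfl
    | tooLarge h => rfl
    | fail => rfl
    | found h s hs P L hL z v hdec =>
      cases s with
      | zero =>
        refine absurd ?_ h
        rw [Submodule.eq_bot_iff]
        intro x hx
        have := P.sum_repr ⟨x, hx⟩
        rw [Finset.univ_eq_empty, Finset.sum_empty] at this
        exact (congrArg Subtype.val this).symm
      | succ s => simp [combineOutcomes, Outcome.vectors, List.ofFn_succ]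
  constructor
  · rintro ⟨o, ho, rfl⟩
    rw [List.ofFn_succ, List.ofFn_zero, hcomb _ (ho 0)]
    exact ho 0
  · intro h
    refine ⟨fun _ => out, fun _ => h, ?_⟩
    rw [List.ofFn_succ, List.ofFn_zero, hcomb _ h]

/-- For a list of found vectors, functionals dual to the independent `z a` express each `v a ⊗ v a`
through the basis `P` of `certSpace`; this yields both `v a ∈ U` and `v a ∈ X`. -/
theorem Alg1Run.correct {X : Set (ι → 𝕜)} (hf : CutsOutByQuadrics f X)
    {out : Outcome (ι → 𝕜)} (h : Alg1Run u f φ γ out) :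
    (out = .trivial → ∀ x ∈ Submodule.span 𝕜 (Set.range u), x ∈ X → x = 0) ∧
    ∀ l, out = .found l → l ≠ [] ∧ ∀ x ∈ l, x ≠ 0 ∧
      x ∈ Submodule.span 𝕜 (Set.range u) ∧ x ∈ X := by
  have h2 := alg2RunIrreducible_iff.2 h
  cases h with
  | tooLarge h => exact ⟨by simp, by simp⟩
  | fail => exact ⟨by simp, by simp⟩
  | trivial h =>
    refine ⟨fun _ x hx hxX => ?_, by simp⟩
    have hmem : vecMulVec x x ∈ certSpace u f :=
      ⟨Submodule.subset_span ⟨x, hx, rfl⟩, (vecMulVec_mem_quadricsPerp_iff hf.homogeneous).2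
        (by rw [← hf.zeroSet] at hxX; exact hxX)⟩
    rw [h, Submodule.mem_bot, vecMulVec_eq_zero] at hmem
    exact hmem.elim id id
  | found h s hs P L hL z v hdec =>
    refine ⟨by simp, ?_⟩
    intro l hl
    cases hl
    refine ⟨?_, ?_⟩
    · intro h0
      rw [h0] at h2
      obtain ⟨o, -, ho⟩ := h2
      simp only [combineOutcomes] at ho
      split at ho
      · split_ifs at ho
      · simp at ho
    intro x hx
    obtain ⟨a, rfl⟩ := (List.mem_ofFn' _ _).1 hx
    obtain ⟨K, hK⟩ := exists_dual hdec.left_independent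
    have hmem : vecMulVec (v a) (v a) ∈ certSpace u f := by
      have h3 : vecMulVec (v a) (v a) = ∑ i, K a i • (P i : Matrix ι ι 𝕜) := by
        simp only [hdec.sum_eq, Finset.smul_sum, smul_smul]
        rw [Finset.sum_comm]
        simp only [← Finset.sum_smul, hK]
        simp
      rw [h3]
      exact Submodule.sum_mem _ fun i _ => Submodule.smul_mem _ _ (P i).2
    refine ⟨hdec.right_independent.ne_zero a, mem_of_vecMulVec_mem_symSquare hmem.1, ?_⟩
    rw [← hf.zeroSet]
    exact (vecMulVec_mem_quadricsPerp_iff hf.homogeneous).1 hmem.2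

theorem Alg1Run.eq_trivial (hbot : certSpace u f = ⊥)
    {out : Outcome (ι → 𝕜)} (h : Alg1Run u f φ γ out) : out = .trivial := by
  cases h with
  | trivial h => rfl
  | tooLarge h => rw [hbot, finrank_bot] at h; omega
  | found h => exact absurd hbot h
  | fail h => exact absurd hbot h

theorem linearIndependent_coe_basis {s : ℕ} (P : Module.Basis (Fin s) 𝕜 (certSpace u f)) :
    LinearIndependent 𝕜 fun i => (P i : Matrix ι ι 𝕜) :=
  P.linearIndependent.map' (Submodule.subtype _) (Submodule.ker_subtype _)

theorem Alg1Run.of_decomposition (hne : certSpace u f ≠ ⊥) {s : ℕ} (hs : s ≤ R)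
    (P : Module.Basis (Fin s) 𝕜 (certSpace u f)) {z : Fin s → Fin s → 𝕜} {v : Fin s → ι → 𝕜}
    (hT : ∀ i, (P i : Matrix ι ι 𝕜) = ∑ a, z a i • vecMulVec (v a) (v a)) {Y : Matrix ι ι 𝕜}
    (hY : IsPseudoinverse (contract (fun i => (P i : Matrix ι ι 𝕜))
      fun i => γ (Fin.castLE hs i)) Y)
    {l : Fin s → 𝕜} (hl : Function.Injective l) (hl0 : ∀ a, l a ≠ 0)
    (hA : ∀ a, (contract (fun i => (P i : Matrix ι ι 𝕜)) (fun i => φ (Fin.castLE hs i)) * Y) *ᵥ v a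
      = l a • v a) :
    Alg1Run u f φ γ (.found (List.ofFn v)) := by
  obtain ⟨h1, h2⟩ := simDiagRun_of_decomposition (linearIndependent_coe_basis P) hT hY hl hl0 hA
  exact .found hne s hs P _ h1 z v h2

theorem exists_smul_of_rankOne_eq {α κ : Type*} {y z : α → 𝕜} {v w x : κ → 𝕜} (hz : z ≠ 0)
    (hx : x ≠ 0) (h : rankOne (y, v, w) = rankOne (z, x, x)) : ∃ c : 𝕜, c ≠ 0 ∧ x = c • v := by
  obtain ⟨i, hi⟩ := Function.ne_iff.1 hz
  obtain ⟨k, hk⟩ := Function.ne_iff.1 hx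
  rw [Pi.zero_apply] at hi hk
  have h1 : ∀ j, y i * v j * w k = z i * x j * x k := fun j =>
    congrFun (congrFun (congrFun h i) j) k
  have h2 : x = (y i * w k / (z i * x k)) • v := by
    ext j
    rw [Pi.smul_apply, smul_eq_mul, div_mul_eq_mul_div, eq_div_iff (mul_ne_zero hi hk)]
    linear_combination -(h1 j)
  refine ⟨_, ?_, h2⟩
  intro h0
  rw [h0, zero_smul] at h2
  exact hx h2

theorem exists_dual_products {r : ℕ} {v w : Fin r → ι → 𝕜} (hv : LinearIndependent 𝕜 v)
    (hw : LinearIndependent 𝕜 w) : ∃ h : Fin r → Matrix ι ι 𝕜,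
      ∀ a b, ∑ j, ∑ k, h a j k * (v b j * w b k) = if a = b then 1 else 0 := by
  obtain ⟨K, hK⟩ := exists_dual hv
  obtain ⟨K', hK'⟩ := exists_dual hw
  refine ⟨fun a => vecMulVec (K a) (K' a), fun a b => ?_⟩
  have : ∑ j, ∑ k, (vecMulVec (K a) (K' a)) j k * (v b j * w b k) =
      (∑ j, K a j * v b j) * ∑ k, K' a k * w b k := by
    rw [Finset.sum_mul_sum]
    refine Finset.sum_congr rfl fun j _ => Finset.sum_congr rfl fun k _ => ?_
    rw [vecMulVec_apply]; ring
  rw [this, hK, hK']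
  split_ifs <;> simp

/-- This justifies the answer "Fail" of the program. The stages of simultaneous diagonalization are
followed until one of them fails. If none does, a valid square decomposition would contradict `hno`.
-/
theorem Alg1Run.fail_of_not_exists (hne : certSpace u f ≠ ⊥) {s : ℕ} (hs : s ≤ R)
    (P : Module.Basis (Fin s) 𝕜 (certSpace u f)) {Y : Matrix ι ι 𝕜}
    (hY : IsPseudoinverse (contract (fun i => (P i : Matrix ι ι 𝕜))
      fun i => γ (Fin.castLE hs i)) Y)
    (hno : ¬ ∃ (l : Fin s → 𝕜) (v : Fin s → ι → 𝕜) (z : Fin s → Fin s → 𝕜),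
      HasSimpleNonzeroSpectrum
        (contract (fun i => (P i : Matrix ι ι 𝕜)) (fun i => φ (Fin.castLE hs i)) * Y) l v ∧
      ∀ i, (P i : Matrix ι ι 𝕜) = ∑ a, z a i • vecMulVec (v a) (v a)) :
    Alg1Run u f φ γ .fail := by
  obtain ⟨X, hX⟩ := exists_isPseudoinverse
    (contract (fun i => (P i : Matrix ι ι 𝕜)) fun i => φ (Fin.castLE hs i))
  by_cases hA : ∃ (r : ℕ) (l : Fin r → 𝕜) (v : Fin r → ι → 𝕜), HasSimpleNonzeroSpectrum
      (contract (fun i => (P i : Matrix ι ι 𝕜)) (fun i => φ (Fin.castLE hs i)) * Y) l v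
  swap
  · exact .fail hne s hs P none (.failLeft Y hY hA) (by simp)
  obtain ⟨r, l, v, hA⟩ := hA
  by_cases hB : ∃ w : Fin r → ι → 𝕜, HasSimpleNonzeroSpectrum
      (X * contract (fun i => (P i : Matrix ι ι 𝕜)) (fun i => γ (Fin.castLE hs i)))ᵀ
      (fun a => (l a)⁻¹) w
  swap
  · exact .fail hne s hs P none (.failRight X Y hX hY r l v hA hB) (by simp)
  obtain ⟨w, hB⟩ := hB
  obtain ⟨h, hdual⟩ := exists_dual_products hA.linearIndependent hB.linearIndependent
  by_cases hpar : ∃ a b, a ≠ b ∧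
      contract₂₃ (fun i => (P i : Matrix ι ι 𝕜)) (h a) ∈
        Submodule.span 𝕜 {contract₂₃ (fun i => (P i : Matrix ι ι 𝕜)) (h b)}
  · exact .fail hne s hs P none (.failParallel X Y hX hY r l v w hA hB h hdual hpar) (by simp)
  refine .fail hne s hs P _ (.success X Y hX hY r l v w hA hB h hdual hpar) ?_
  rintro ⟨L, z, v', hL, hdec⟩
  rw [Option.some.injEq] at hL
  subst hL
  have hterms := hdec.terms
  rw [List.map_ofFn] at hterms
  have hrs : r = s := by simpa using congrArg List.length hterms
  subst hrs
  have hterms' := List.ofFn_injective hterms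
  -- Equal nonzero rank-one tensors have proportional factors, so each `v' a` is a multiple of `v a`
  -- and thus an eigenvector for the same eigenvalue.
  refine hno ⟨l, v', z, ?_, hdec.sum_eq⟩
  refine ⟨hA.rank_eq, hA.injective, hA.ne_zero, hdec.right_independent.ne_zero, fun a => ?_⟩
  obtain ⟨c, -, hc⟩ := exists_smul_of_rankOne_eq (hdec.left_independent.ne_zero a)
    (hdec.right_independent.ne_zero a) (congrFun hterms' a)
  rw [hc, mulVec_smul, hA.eigen, smul_comm]

/-- Every basis of `certSpace` is a single matrix `c • x ⊗ x`, so only the first coordinates of `φ`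
and `γ` enter. If they are nonzero, the spectra are simple for any choice of pseudoinverse, and
every branch leading to failure is contradictory. -/
theorem Alg1Run.eq_found_of_planted (hR : 0 < R) {x : ι → 𝕜} (hx : x ≠ 0)
    (hcert : certSpace u f = Submodule.span 𝕜 {vecMulVec x x}) (hφ : φ ⟨0, hR⟩ ≠ 0)
    (hγ : γ ⟨0, hR⟩ ≠ 0) {out : Outcome (ι → 𝕜)} (h : Alg1Run u f φ γ out) :
    ∃ c : 𝕜, c ≠ 0 ∧ out = .found [c • x] := by
  have hW : vecMulVec x x ≠ 0 := by
    rw [Ne, vecMulVec_eq_zero]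
    exact fun h => hx (h.elim id id)
  have hfin : Module.finrank 𝕜 (certSpace u f) = 1 := by
    rw [hcert, finrank_span_singleton hW]
  have hbasis : ∀ {s : ℕ}, Module.Basis (Fin s) 𝕜 (certSpace u f) → s = 1 := by
    intro s P
    rw [← hfin, Module.finrank_eq_card_basis P, Fintype.card_fin]
  have hP : ∀ P : Module.Basis (Fin 1) 𝕜 (certSpace u f), ∃ c : 𝕜, c ≠ 0 ∧
      ∀ i, (P i : Matrix ι ι 𝕜) = c • vecMulVec x x := by
    intro P
    have h1 : (P 0 : Matrix ι ι 𝕜) ∈ Submodule.span 𝕜 {vecMulVec x x} := hcert ▸ (P 0).2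
    obtain ⟨c, hc⟩ := Submodule.mem_span_singleton.1 h1
    refine ⟨c, ?_, fun i => by rw [Subsingleton.elim i 0, hc]⟩
    rintro rfl
    rw [zero_smul] at hc
    exact P.ne_zero 0 (Subtype.ext hc.symm)
  cases h with
  | trivial h => rw [h, finrank_bot] at hfin; omega
  | tooLarge h => rw [hfin] at h; omega
  | found h s hs P L hL z v hdec =>
    obtain rfl := hbasis P
    obtain ⟨c, hc, hcP⟩ := hP P
    have h1 := hdec.sum_eq 0
    simp only [hcP, Fin.sum_univ_one] at h1
    obtain ⟨k, hk⟩ := Function.ne_iff.1 hx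
    rw [Pi.zero_apply] at hk
    have h2 : ∀ j, c * (x j * x k) = z 0 0 * (v 0 j * v 0 k) := fun j => by
      have := congrFun (congrFun h1 j) k
      simpa [vecMulVec_apply] using this
    have h3 : z 0 0 * (v 0 k * v 0 k) ≠ 0 := by
      rw [← h2 k]
      exact mul_ne_zero hc (mul_ne_zero hk hk)
    have hz : z 0 0 ≠ 0 := left_ne_zero_of_mul h3
    have hv : v 0 k ≠ 0 := left_ne_zero_of_mul (right_ne_zero_of_mul h3)
    refine ⟨c * x k / (z 0 0 * v 0 k), div_ne_zero (mul_ne_zero hc hk) (mul_ne_zero hz hv), ?_⟩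
    rw [List.ofFn_succ, List.ofFn_zero]
    congr 2
    ext j
    rw [Pi.smul_apply, smul_eq_mul, div_mul_eq_mul_div, eq_div_iff (mul_ne_zero hz hv)]
    linear_combination -(h2 j)
  | fail h s hs P o ho hdec =>
    exfalso
    obtain rfl := hbasis P
    obtain ⟨c, hc, hcP⟩ := hP P
    have hT : ∀ i, (P i : Matrix ι ι 𝕜) = ∑ a : Fin 1, (fun _ _ => c : Fin 1 → Fin 1 → 𝕜) a i •
        vecMulVec ((fun _ => x : Fin 1 → ι → 𝕜) a) ((fun _ => x : Fin 1 → ι → 𝕜) a) := by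
      intro i
      simp [hcP]
    have hxli : LinearIndependent 𝕜 (fun _ => x : Fin 1 → ι → 𝕜) :=
      LinearIndependent.of_subsingleton 0 hx
    have hα : ∀ a : Fin 1, ∑ i : Fin 1, φ (Fin.castLE hs i) * c ≠ 0 := fun a => by
      simpa using ⟨hφ, hc⟩
    have hβ : ∀ a : Fin 1, ∑ i : Fin 1, γ (Fin.castLE hs i) * c ≠ 0 := fun a => by
      simpa using ⟨hγ, hc⟩
    have HA := fun {Y} hY => hasSimpleNonzeroSpectrum_weightedSquares hxli hα hβ
      (Function.injective_of_subsingleton _) (Y := Y) hY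
    have HB := fun {X} hX => hasSimpleNonzeroSpectrum_transpose_weightedSquares hxli hα hβ
      (Function.injective_of_subsingleton _) (X := X) hX
    rw [← contract_eq_weightedSquares hT, ← contract_eq_weightedSquares hT] at HA HB
    have hr : ∀ {Y : Matrix ι ι 𝕜} {r : ℕ} {l : Fin r → 𝕜} {v : Fin r → ι → 𝕜},
        IsPseudoinverse (contract (fun i => (P i : Matrix ι ι 𝕜)) fun i => γ (Fin.castLE hs i)) Y →
        HasSimpleNonzeroSpectrum (contract (fun i => (P i : Matrix ι ι 𝕜))
          (fun i => φ (Fin.castLE hs i)) * Y) l v → r = 1 := by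
      intro Y r l v hY h
      rw [← h.rank_eq, (HA hY).rank_eq]
    cases ho with
    | failLeft Y hY hA => exact hA ⟨1, _, _, HA hY⟩
    | failRight X Y hX hY r l v hA hB =>
      obtain rfl := hr hY hA
      refine hB ⟨fun _ => x, ?_⟩
      convert HB hX using 2 with a
      obtain ⟨b, c, -, hb⟩ := (HA hY).exists_smul_eq (hA.ne_zero a) (hA.vec_ne_zero a) (hA.eigen a)
      exact congrArg _ hb
    | failParallel X Y hX hY r l v w hA hB h hdual hpar =>
      obtain rfl := hr hY hA
      obtain ⟨a, b, hab, -⟩ := hpar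
      exact hab (Subsingleton.elim a b)
    | success X Y hX hY r l v w hA hB h hdual hpar =>
      obtain rfl := hr hY hA
      obtain ⟨-, k, hk, -⟩ :=
        (HA hY).exists_smul_eq (hA.ne_zero 0) (hA.vec_ne_zero 0) (hA.eigen 0)
      obtain ⟨-, k', hk', -⟩ :=
        (HB hX).exists_smul_eq (hB.ne_zero 0) (hB.vec_ne_zero 0) (hB.eigen 0)
      refine hdec ⟨_, fun _ _ => c, fun _ => x, rfl, ?_, hT, ?_, hxli⟩
      · rw [List.map_ofFn]
        congr 1
        funext a
        have ha : a = 0 := Subsingleton.elim a 0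
        subst ha
        funext i j l
        have h1 := hdual 0 0
        rw [if_pos rfl, hk, hk'] at h1
        -- The eigenvectors found are `k • x` and `k' • x`. Duality of `h 0` to their product
        -- rescales `T(h 0)` by `(k * k')⁻¹`, so the rank-one term is `c ⊗ x ⊗ x` whatever the
        -- scaling.
        have h2 : contract₂₃ (fun i => (P i : Matrix ι ι 𝕜)) (h 0) i * (k * k') = c := by
          simp only [contract₂₃, hcP]
          refine Eq.trans ?_ ((congrArg (c * ·) h1).trans (mul_one c))
          rw [Finset.sum_mul, Finset.mul_sum]
          refine Finset.sum_congr rfl fun j _ => ?_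
          rw [Finset.sum_mul, Finset.mul_sum]
          refine Finset.sum_congr rfl fun l _ => ?_
          simp only [Matrix.smul_apply, vecMulVec_apply, smul_eq_mul, Pi.smul_apply]
          ring
        simp only [Function.comp, rankOne, hk, hk', Pi.smul_apply, smul_eq_mul]
        rw [← h2]
        ring
      · exact LinearIndependent.of_subsingleton 0 (fun h0 => hc (congrFun h0 0))

end Runs
end EntangledSubspace

namespace EntangledSubspace

/-! ## Generic tuples of vectors and spaces of quadrics -/

section Generic

variable {𝕜 : Type*} [RCLike 𝕜] {ι : Type*} [Fintype ι] [DecidableEq ι]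

/-- The bilinear form of a matrix. -/
def bilin (M : Matrix ι ι 𝕜) (x y : ι → 𝕜) : 𝕜 := ∑ j, ∑ l, M j l * (x j * y l)

theorem bilin_eq (M : Matrix ι ι 𝕜) (x y : ι → 𝕜) : bilin M x y = x ⬝ᵥ (M *ᵥ y) := by
  simp only [bilin, dotProduct, mulVec, Finset.mul_sum]
  exact Finset.sum_congr rfl fun j _ => Finset.sum_congr rfl fun l _ => by ring

theorem bilin_comm {M : Matrix ι ι 𝕜} (hM : ∀ j l, M j l = M l j) (x y : ι → 𝕜) :
    bilin M x y = bilin M y x := by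
  rw [bilin, bilin, Finset.sum_comm]
  exact Finset.sum_congr rfl fun j _ => Finset.sum_congr rfl fun l _ => by rw [hM]; ring

theorem bilin_sum_matrix {κ : Type*} (s : Finset κ) (c : κ → 𝕜) (M : κ → Matrix ι ι 𝕜)
    (x y : ι → 𝕜) : bilin (∑ k ∈ s, c k • M k) x y = ∑ k ∈ s, c k * bilin (M k) x y := by
  simp only [bilin_eq, Matrix.sum_mulVec, dotProduct_sum, smul_mulVec, dotProduct_smul, smul_eq_mul]

/-- Polarization: a symmetric form is determined by its values on the diagonal, since `2` is
invertible. -/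
theorem exists_bilin_self_ne_zero {M : Matrix ι ι 𝕜} (hM : ∀ j l, M j l = M l j) (h0 : M ≠ 0) :
    ∃ x, bilin M x x ≠ 0 := by
  by_contra! h
  apply h0
  have hs : ∀ j l, bilin M (Pi.single j 1) (Pi.single l 1) = M j l := fun j l => by
    simp [bilin_eq]
  ext j l
  have h1 := h (Pi.single j 1 + Pi.single l 1)
  have h2 := h (Pi.single j 1)
  have h3 := h (Pi.single l 1)
  have h4 : bilin M (Pi.single j 1 + Pi.single l 1) (Pi.single j 1 + Pi.single l 1) =
      bilin M (Pi.single j 1) (Pi.single j 1) + M j l + M l j +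
        bilin M (Pi.single l 1) (Pi.single l 1) := by
    rw [← hs j l, ← hs l j]
    simp only [bilin_eq, mulVec_add, dotProduct_add, add_dotProduct]
    ring
  rw [h1, h2, h3, hM l j, zero_add, add_zero, ← two_mul] at h4
  simpa using h4.symm

/-- More unknowns than equations, over a commutative ring, where the strong rank condition replaces
dimension. It is applied over a polynomial ring, so that the solution depends polynomially on the
vectors. -/
theorem exists_ne_zero_forall_sum_eq_zero {A ρ : Type*} [CommRing A] [Nontrivial A] [Fintype ρ]
    {p : ℕ} (hρ : Fintype.card ρ < p) (r : ρ → Fin p → A) :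
    ∃ μ : Fin p → A, μ ≠ 0 ∧ ∀ t, ∑ k, r t k * μ k = 0 := by
  by_contra! h
  have hinj : Function.Injective (Matrix.of r).mulVecLin := by
    rw [← LinearMap.ker_eq_bot, Submodule.eq_bot_iff]
    intro μ hμ
    by_contra hne
    obtain ⟨t, ht⟩ := h μ hne
    exact ht (congrFun (LinearMap.mem_ker.1 hμ) t)
  have := card_le_of_injective A _ hinj
  simp at this
  omega

theorem eval_aeval_eq {σ τ : Type*} (y : τ → 𝕜) (π : σ → MvPolynomial τ 𝕜)
    (q : MvPolynomial σ 𝕜) :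
    MvPolynomial.eval y (MvPolynomial.aeval π q) =
      MvPolynomial.eval (fun z => MvPolynomial.eval y (π z)) q := by
  induction q using MvPolynomial.induction_on with
  | C a => simp [MvPolynomial.algebraMap_eq]
  | add p q hp hq => rw [map_add, map_add, hp, hq, map_add]
  | mul_X p i hp =>
    rw [map_mul, map_mul, hp, MvPolynomial.aeval_X, map_mul, MvPolynomial.eval_X]

/-- The evaluation of a polynomial at a tuple of vectors. -/
noncomputable abbrev evalTuple {r : ℕ} (v : Fin r → ι → 𝕜) (q : MvPolynomial (Fin r × ι) 𝕜) : 𝕜 :=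
  MvPolynomial.eval (fun x => v x.1 x.2) q

variable {p r : ℕ} {B : Fin p → Matrix ι ι 𝕜} {τ : Type*} [Fintype τ]

/-- A combination `G = ∑ μ k • B k` is chosen to annihilate the rows of `W` and to have all
differences `v a - h a • v i` with `a ≠ i` in its radical. Then `G (v a, v b) = h a * h b * G (v i,
v i)`, and combining the given relations with the weights `μ k` leaves the claimed identity times `G
(v i, v i)`. This last value, as a polynomial in `v`, is `q`. -/
theorem exists_poly_weights (hB : ∀ k j l, B k j l = B k l j) (hli : LinearIndependent 𝕜 B)
    (W : τ → Fin p → 𝕜) (i : Fin r)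
    (hcard : (r - 1) * Fintype.card ι + Fintype.card τ < p) (h : Fin r → 𝕜) (hi : h i = 1) :
    ∃ q : MvPolynomial (Fin r × ι) 𝕜, q ≠ 0 ∧ ∀ v, evalTuple v q ≠ 0 →
      ∀ (c : Fin r → Fin r → 𝕜) (y : τ → 𝕜),
        (∀ k, ∑ a, ∑ b, c a b * bilin (B k) (v a) (v b) = ∑ t, y t * W t k) →
        ∑ a, ∑ b, c a b * (h a * h b) = 0 := by
  classical
  let A := MvPolynomial (Fin r × ι) 𝕜
  -- The variables `(a, l)` with `a ≠ i` stand for the coordinates of the differences. There is one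
  -- condition for each such `a` and each coordinate, and one for each row of `W`.
  let row : ({a : Fin r // a ≠ i} × ι) ⊕ τ → Fin p → A := Sum.elim
    (fun s k => ∑ l, MvPolynomial.C (B k l s.2) * MvPolynomial.X (s.1.1, l))
    (fun t k => MvPolynomial.C (W t k))
  have hc : Fintype.card (({a : Fin r // a ≠ i} × ι) ⊕ τ) < p := by
    rw [Fintype.card_sum, Fintype.card_prod]
    simpa [Fintype.card_subtype_compl] using hcard
  obtain ⟨μ, hμ0, hμ⟩ := exists_ne_zero_forall_sum_eq_zero hc row
  obtain ⟨k₀, hk₀⟩ := Function.ne_iff.1 hμ0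
  obtain ⟨d₀, hd₀⟩ : ∃ d : Fin r × ι → 𝕜, MvPolynomial.eval d (μ k₀) ≠ 0 := by
    by_contra! h0
    exact hk₀ (MvPolynomial.funext (by simpa using h0))
  -- the linear relations, at every point
  have hrel : ∀ d : Fin r × ι → 𝕜, (∀ a, a ≠ i → ∀ x,
      bilin (∑ k, MvPolynomial.eval d (μ k) • B k) (fun l => d (a, l)) x = 0) ∧
      ∀ t, ∑ k, W t k * MvPolynomial.eval d (μ k) = 0 := by
    intro d
    constructor
    · intro a ha x
      have h1 : ∀ j, ∑ k, (∑ l, B k l j * d (a, l)) * MvPolynomial.eval d (μ k) = 0 := by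
        intro j
        have := congrArg (MvPolynomial.eval d) (hμ (Sum.inl (⟨a, ha⟩, j)))
        simpa [row] using this
      rw [bilin_sum_matrix]
      have h2 : ∀ k, MvPolynomial.eval d (μ k) * bilin (B k) (fun l => d (a, l)) x =
          ∑ j, x j * ((∑ l, B k l j * d (a, l)) * MvPolynomial.eval d (μ k)) := by
        intro k
        rw [bilin, Finset.sum_comm, Finset.mul_sum]
        refine Finset.sum_congr rfl fun j _ => ?_
        rw [Finset.sum_mul, Finset.mul_sum, Finset.mul_sum]
        exact Finset.sum_congr rfl fun l _ => by ring
      simp only [h2]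
      rw [Finset.sum_comm]
      simp only [← Finset.mul_sum, h1]
      simp
    · intro t
      have := congrArg (MvPolynomial.eval d) (hμ (Sum.inr t))
      simpa [row] using this
  -- Substitution of the actual differences. A solution `μ` might involve the variables `(i, l)`;
  -- freezing them at `d₀` makes `G` depend on the differences only.
  let σ : Fin r × ι → A := fun z => if z.1 = i then MvPolynomial.C (d₀ z)
    else MvPolynomial.X z - MvPolynomial.C (h z.1) * MvPolynomial.X (i, z.2)
  let dd : (Fin r → ι → 𝕜) → Fin r × ι → 𝕜 := fun v z => if z.1 = i then d₀ z
    else v z.1 z.2 - h z.1 * v i z.2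
  have hσ : ∀ v : Fin r → ι → 𝕜, (fun z => evalTuple v (σ z)) = dd v := by
    intro v
    funext z
    simp only [σ, dd]
    split_ifs <;> simp
  let q : A := ∑ k, MvPolynomial.aeval σ (μ k) * ∑ j, ∑ l, MvPolynomial.C (B k j l) *
    (MvPolynomial.X (i, j) * MvPolynomial.X (i, l))
  have hq : ∀ v, evalTuple v q =
      bilin (∑ k, MvPolynomial.eval (dd v) (μ k) • B k) (v i) (v i) := by
    intro v
    rw [bilin_sum_matrix]
    simp only [q, evalTuple, map_sum, bilin]
    refine Finset.sum_congr rfl fun k _ => ?_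
    rw [map_mul, eval_aeval_eq, ← hσ]
    simp only [map_sum, map_mul, MvPolynomial.eval_C, MvPolynomial.eval_X, evalTuple]
  refine ⟨q, ?_, ?_⟩
  · have hG0 : ∑ k, MvPolynomial.eval d₀ (μ k) • B k ≠ 0 := fun h0 =>
      hd₀ (Fintype.linearIndependent_iff.1 hli _ h0 k₀)
    obtain ⟨x, hx⟩ := exists_bilin_self_ne_zero (fun j l => by
      simp only [Matrix.sum_apply, Matrix.smul_apply, hB _ j l]) hG0
    intro h0
    -- The tuple with prescribed differences `d₀` and arbitrary `v i = x`. At `d₀` the form `G` is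
    -- nonzero and symmetric, so some `x` has `G (x, x) ≠ 0`, which shows `q ≠ 0`.
    let v : Fin r → ι → 𝕜 := fun a j => if a = i then x j else d₀ (a, j) + h a * x j
    have hvi : v i = x := by funext j; simp [v]
    have hdv : dd v = d₀ := by
      funext z
      simp only [dd, hvi]
      split_ifs with hz
      · rfl
      · simp [v, hz]
    have := hq v
    rw [h0, hvi, hdv, evalTuple, map_zero] at this
    exact hx this.symm
  · intro v hv c y hcy
    rw [hq] at hv
    obtain ⟨h1, h2⟩ := hrel (dd v)
    set G := ∑ k, MvPolynomial.eval (dd v) (μ k) • B k with hG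
    have hGs : ∀ j l, G j l = G l j := fun j l => by
      simp only [hG, Matrix.sum_apply, Matrix.smul_apply, hB _ j l]
    have hGa : ∀ a x, bilin G (v a) x = h a * bilin G (v i) x := by
      intro a x
      by_cases ha : a = i
      · rw [ha, hi, one_mul]
      · have h3 := h1 a ha x
        have h4 : (fun l => dd v (a, l)) = v a - h a • v i := by
          funext l
          simp [dd, ha]
        rw [h4, bilin_eq, sub_dotProduct, smul_dotProduct, smul_eq_mul, sub_eq_zero] at h3
        rw [bilin_eq, h3, bilin_eq]
    have hGab : ∀ a b, bilin G (v a) (v b) = h a * h b * bilin G (v i) (v i) := by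
      intro a b
      rw [hGa, bilin_comm hGs, hGa, mul_assoc]
    have h5 : ∑ a, ∑ b, c a b * bilin G (v a) (v b) = 0 := by
      have h6 : ∑ a, ∑ b, c a b * bilin G (v a) (v b) =
          ∑ k, MvPolynomial.eval (dd v) (μ k) * ∑ a, ∑ b, c a b * bilin (B k) (v a) (v b) := by
        simp only [hG, bilin_sum_matrix, Finset.mul_sum]
        rw [Finset.sum_comm_cycle]
        exact Finset.sum_congr rfl fun k _ => Finset.sum_congr rfl fun a _ =>
          Finset.sum_congr rfl fun b _ => by ring
      rw [h6]
      simp only [hcy, Finset.mul_sum]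
      rw [Finset.sum_comm]
      refine Finset.sum_eq_zero fun t _ => ?_
      rw [← mul_zero (y t), ← h2 t, Finset.mul_sum]
      exact Finset.sum_congr rfl fun k _ => by ring
    have h7 : ∀ a b, c a b * bilin G (v a) (v b) =
        c a b * (h a * h b) * bilin G (v i) (v i) := fun a b => by rw [hGab]; ring
    have h8 : (∑ a, ∑ b, c a b * (h a * h b)) * bilin G (v i) (v i) = 0 := by
      rw [← h5]
      simp only [Finset.sum_mul]
      exact Finset.sum_congr rfl fun a _ => Finset.sum_congr rfl fun b _ => (h7 a b).symm
    exact (mul_eq_zero.1 h8).resolve_right hv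

/-- For generic vectors `v 0, …, v (r-1)`, no nontrivial symmetric combination of the vectors
`(B k (v a, v b))ₖ` lies in the span of the rows of `W`. -/
theorem exists_poly_symmetric_eq_zero (hB : ∀ k j l, B k j l = B k l j)
    (hli : LinearIndependent 𝕜 B) (W : τ → Fin p → 𝕜)
    (hcard : 0 < r → (r - 1) * Fintype.card ι + Fintype.card τ < p) :
    ∃ q : MvPolynomial (Fin r × ι) 𝕜, q ≠ 0 ∧ ∀ v, evalTuple v q ≠ 0 →
      ∀ (c : Fin r → Fin r → 𝕜) (y : τ → 𝕜), (∀ a b, c a b = c b a) →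
        (∀ k, ∑ a, ∑ b, c a b * bilin (B k) (v a) (v b) = ∑ t, y t * W t k) → c = 0 := by
  -- The weights are the indicator of `{z.1, z.2}`. The diagonal pairs give `c a a = 0`, and the
  -- pairs of distinct indices then give `2 * c a b = 0`.
  have key := fun z : Fin r × Fin r => exists_poly_weights hB hli W z.1 (hcard z.1.pos)
    (fun a => if a = z.1 ∨ a = z.2 then 1 else 0) (by simp)
  choose q hq0 hq using key
  refine ⟨∏ z, q z, Finset.prod_ne_zero_iff.2 fun z _ => hq0 z, fun v hv c y hc hcy => ?_⟩
  rw [evalTuple, map_prod, Finset.prod_ne_zero_iff] at hv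
  have h1 := fun z => hq z v (hv z (Finset.mem_univ z)) c y hcy
  have hdiag : ∀ a, c a a = 0 := by
    intro a
    have := h1 (a, a)
    simpa using this
  funext a b
  by_cases hab : a = b
  · rw [hab, hdiag]; rfl
  have h2 := h1 (a, b)
  have h3 : ∀ g : Fin r → 𝕜, ∑ d, g d * (if d = a ∨ d = b then 1 else 0) = g a + g b := by
    intro g
    rw [Finset.sum_eq_add_of_mem a b (Finset.mem_univ _) (Finset.mem_univ _) hab
      (by rintro d - ⟨hd, hd'⟩; simp [hd, hd'])]
    simp
  have h4 : ∀ d, ∑ e, c d e * ((if d = a ∨ d = b then 1 else 0) *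
      (if e = a ∨ e = b then 1 else 0)) = (c d a + c d b) * (if d = a ∨ d = b then 1 else 0) := by
    intro d
    rw [← h3, Finset.sum_mul]
    exact Finset.sum_congr rfl fun e _ => by ring
  simp only [h4, h3, hdiag, hc b a, zero_add, add_zero] at h2
  rw [← two_mul] at h2
  simpa using h2

/-- Injectivity of a matrix on a subspace is a Zariski open condition on the matrix. -/
theorem exists_poly_injective {σ κ τ : Type*} [Fintype κ] [Fintype τ] (S : Submodule 𝕜 (τ → 𝕜))
    (F : κ → τ → MvPolynomial σ 𝕜) (v₀ : σ → 𝕜)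
    (h₀ : ∀ c ∈ S, (∀ k, ∑ t, c t * MvPolynomial.eval v₀ (F k t) = 0) → c = 0) :
    ∃ q : MvPolynomial σ 𝕜, MvPolynomial.eval v₀ q ≠ 0 ∧ ∀ v, MvPolynomial.eval v q ≠ 0 →
      ∀ c ∈ S, (∀ k, ∑ t, c t * MvPolynomial.eval v (F k t) = 0) → c = 0 := by
  classical
  let b := Module.finBasis 𝕜 S
  let M : Matrix κ (Fin (Module.finrank 𝕜 S)) (MvPolynomial σ 𝕜) := fun k a =>
    ∑ t, MvPolynomial.C ((b a : τ → 𝕜) t) * F k t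
  have hM : ∀ v k (g : Fin (Module.finrank 𝕜 S) → 𝕜),
      ∑ a, g a * MvPolynomial.eval v (M k a) =
        ∑ t, ((∑ a, g a • b a : S) : τ → 𝕜) t * MvPolynomial.eval v (F k t) := by
    intro v k g
    simp only [M, map_sum, map_mul, MvPolynomial.eval_C, Finset.mul_sum, Submodule.coe_sum,
      Submodule.coe_smul, Finset.sum_apply, Pi.smul_apply, smul_eq_mul, Finset.sum_mul]
    rw [Finset.sum_comm]
    exact Finset.sum_congr rfl fun t _ => Finset.sum_congr rfl fun a _ => by ring
  have hli : LinearIndependent 𝕜 fun a k => MvPolynomial.eval v₀ (M k a) := by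
    rw [Fintype.linearIndependent_iff]
    intro g hg
    have h1 : (∑ a, g a • b a : S) = 0 := by
      apply Subtype.ext
      refine h₀ _ (Subtype.mem _) fun k => ?_
      rw [← hM]
      simpa using congrFun hg k
    exact Fintype.linearIndependent_iff.1 b.linearIndependent g h1
  obtain ⟨K, hK⟩ := exists_dual hli
  let D : Matrix (Fin (Module.finrank 𝕜 S)) (Fin (Module.finrank 𝕜 S)) (MvPolynomial σ 𝕜) :=
    fun a a' => ∑ k, MvPolynomial.C (K a k) * M k a'
  have hD : ∀ v, MvPolynomial.eval v D.det =
      (Matrix.of fun a a' => ∑ k, K a k * MvPolynomial.eval v (M k a')).det := by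
    intro v
    rw [RingHom.map_det]
    congr 1
    ext a a'
    change MvPolynomial.eval v (∑ k, MvPolynomial.C (K a k) * M k a') = _
    simp only [map_sum, map_mul, MvPolynomial.eval_C, Matrix.of_apply]
  refine ⟨D.det, ?_, fun v hv c hc hcv => ?_⟩
  · rw [hD]
    have : (Matrix.of fun a a' => ∑ k, K a k * MvPolynomial.eval v₀ (M k a')) = 1 := by
      ext a a'
      rw [Matrix.of_apply, hK, Matrix.one_apply]
    rw [this, det_one]
    exact one_ne_zero
  · rw [hD] at hv
    have h1 := b.sum_repr ⟨c, hc⟩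
    set g := b.repr ⟨c, hc⟩ with hg
    have h2 : (Matrix.of fun a a' => ∑ k, K a k * MvPolynomial.eval v (M k a')) *ᵥ (g : _ → 𝕜)
        = 0 := by
      ext a
      simp only [mulVec, dotProduct, Matrix.of_apply, Finset.sum_mul, Pi.zero_apply]
      rw [Finset.sum_comm]
      refine Finset.sum_eq_zero fun k _ => ?_
      have h3 := hM v k g
      rw [h1, hcv k] at h3
      rw [← mul_zero (K a k), ← h3, Finset.mul_sum]
      exact Finset.sum_congr rfl fun a' _ => by ring
    have h4 := Matrix.eq_zero_of_mulVec_eq_zero hv h2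
    have h5 : (⟨c, hc⟩ : S) = 0 := by
      rw [← h1]
      exact Finset.sum_eq_zero fun a _ => by rw [congrFun h4 a]; simp
    exact congrArg Subtype.val h5

/-- The image of an affine space under a polynomial map is irreducible. If `g` vanishes where `q ≠
0`, then the pullback of `g * q` is zero, and polynomials form a domain, so one of the pullbacks is
zero; that of `q` is not. -/
theorem holdsGenerically_of_poly {R : ℕ} {σ : Type*} {Y : Set (Fin R → ι → 𝕜)}
    {Q : (Fin R → ι → 𝕜) → Prop} (π : Fin R → ι → MvPolynomial σ 𝕜)
    (hY : Y = Set.range fun (y : σ → 𝕜) a j => MvPolynomial.eval y (π a j))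
    (q : MvPolynomial (Fin R × ι) 𝕜) (hq : ∃ v ∈ Y, evalTuple v q ≠ 0)
    (hQ : ∀ v ∈ Y, evalTuple v q ≠ 0 → Q v) : HoldsGenerically Y Q := by
  have hcomp : ∀ (g : MvPolynomial (Fin R × ι) 𝕜) (y : σ → 𝕜),
      MvPolynomial.eval y (MvPolynomial.aeval (fun z : Fin R × ι => π z.1 z.2) g) =
        evalTuple (fun a j => MvPolynomial.eval y (π a j)) g := fun g y => eval_aeval_eq _ _ _
  refine ⟨{v ∈ Y | evalTuple v q ≠ 0}, ⟨⟨{v | evalTuple v q = 0}, ⟨{q}, by simp⟩, ?_⟩, ?_⟩,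
    fun v hv => hQ v hv.1 hv.2⟩
  · ext v
    simp
  · rintro Z ⟨S, rfl⟩ hS v hv g hg
    have h0 : MvPolynomial.aeval (fun z : Fin R × ι => π z.1 z.2) (g * q) = 0 := by
      apply MvPolynomial.funext
      intro y
      rw [hcomp, map_zero, evalTuple, map_mul]
      by_cases hy : evalTuple (fun a j => MvPolynomial.eval y (π a j)) q = 0
      · rw [show MvPolynomial.eval _ q = 0 from hy, mul_zero]
      · have := hS ⟨by rw [hY]; exact ⟨y, rfl⟩, hy⟩ g hg
        rw [show MvPolynomial.eval _ g = 0 from this, zero_mul]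
    rw [map_mul, mul_eq_zero] at h0
    rcases h0 with h0 | h0
    · rw [hY] at hv
      obtain ⟨y, rfl⟩ := hv
      have := hcomp g y
      rw [h0, map_zero] at this
      exact this.symm
    · obtain ⟨w, hw, hwq⟩ := hq
      rw [hY] at hw
      obtain ⟨y, rfl⟩ := hw
      have := hcomp q y
      rw [h0, map_zero] at this
      exact absurd this.symm hwq

end Generic
end EntangledSubspace

namespace EntangledSubspace

/-! ## The bound on the dimension -/

section Bound

variable {m : ℕ} {n : Fin m → ℕ}

theorem totalDim_pos (hn : ∀ i, 0 < n i) : 0 < totalDim n := Finset.prod_pos fun i _ => hn i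

theorem card_index : Fintype.card (∀ i, Fin (n i)) = totalDim n := by
  simp [totalDim]

theorem dimBound_eq (n : Fin m → ℕ) :
    dimBound n = ((totalDim n : ℝ) + 1) / 2 - ∏ i, (((n i : ℝ) + 1) / 2) := by
  rw [dimBound, Finset.prod_div_distrib]
  simp

/-- Each binomial coefficient is `n i * ((n i + 1) / 2)`, so `N` factors out of both terms. -/
theorem sub_prod_choose_eq (n : Fin m → ℕ) :
    ((totalDim n + 1).choose 2 : ℝ) - ∏ i, ((n i + 1).choose 2 : ℝ) =
      totalDim n * dimBound n := by
  simp only [Nat.cast_choose_two, dimBound_eq]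
  have : ∀ i, ((n i + 1 : ℕ) : ℝ) * (((n i + 1 : ℕ) : ℝ) - 1) / 2 =
      n i * (((n i : ℝ) + 1) / 2) := fun i => by
    push_cast; ring
  simp only [this, Finset.prod_mul_distrib]
  rw [mul_sub, totalDim]
  push_cast
  ring

theorem numQuadrics_cast (n : Fin m → ℕ) : (numQuadrics n : ℝ) = totalDim n * dimBound n := by
  rw [← sub_prod_choose_eq, numQuadrics, Nat.cast_sub]
  · push_cast
    rfl
  · have := Fintype.card_le_of_surjective _ (splitPair_surjective (n := n))
    simpa [Sym2.card, totalDim] using this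

theorem mul_totalDim_le_numQuadrics {R : ℕ} (h : (R : ℝ) ≤ dimBound n) :
    R * totalDim n ≤ numQuadrics n := by
  have : (R * totalDim n : ℝ) ≤ numQuadrics n := by
    rw [numQuadrics_cast, mul_comm]
    exact mul_le_mul_of_nonneg_left h (Nat.cast_nonneg _)
  exact_mod_cast this

theorem one_add_sum_le_prod_one_add {ι : Type*} (s : Finset ι) {x : ι → ℝ} (hx : ∀ i, 0 ≤ x i) :
    1 + ∑ i ∈ s, x i ≤ ∏ i ∈ s, (1 + x i) := by
  classical
  induction s using Finset.induction_on with
  | empty => simp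
  | insert a s ha ih =>
    rw [Finset.sum_insert ha, Finset.prod_insert ha]
    have := mul_nonneg (hx a) (Finset.sum_nonneg fun i (_ : i ∈ s) => hx i)
    nlinarith [hx a, mul_le_mul_of_nonneg_left ih (by linarith [hx a] : 0 ≤ 1 + x a)]

/-- The number `1 + ∑ (n i - 1)` counts the multi-indices that differ from a given one in at most
one place, so at least `R` others remain. The proof gives even `2 * R` in place of `R`, from `∏ (1 +
x i) ≥ 1 + ∑ x i` with `x i = (n i - 1) / 2`. -/
theorem add_le_totalDim (hn : ∀ i, 0 < n i) {R : ℕ} (h : (R : ℝ) ≤ dimBound n) :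
    R + (1 + ∑ i, (n i - 1)) ≤ totalDim n := by
  have h1 := one_add_sum_le_prod_one_add Finset.univ (x := fun i : Fin m => ((n i - 1 : ℕ) : ℝ) / 2)
    fun i => by positivity
  have h2 : ∀ i, 1 + ((n i - 1 : ℕ) : ℝ) / 2 = ((n i : ℝ) + 1) / 2 := fun i => by
    rw [Nat.cast_sub (hn i)]; push_cast; ring
  simp only [h2] at h1
  rw [dimBound_eq] at h
  rw [← Finset.sum_div] at h1
  have h3 : (2 * R + (1 + ∑ i, (n i - 1)) : ℕ) ≤ totalDim n := by
    have : ((2 * R + (1 + ∑ i, (n i - 1)) : ℕ) : ℝ) ≤ totalDim n := by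
      push_cast at h1 ⊢
      linarith
    exact_mod_cast this
  omega

/-- If only two factors `a`, `b` exceed `1`, the bound equals `(a - 1) * (b - 1) / 4 ≥ a * b / 16`,
with equality for `a = b = 2`. With a third such factor, `(n + 1) / 2 ≤ 3 / 4 * n` used three times
bounds the subtracted product by `27 / 64 * N`, and `1 / 2 - 27 / 64 > 1 / 16`. -/
theorem totalDim_div_le_dimBound (hn : ∀ i, 0 < n i) {i j : Fin m} (hij : i ≠ j)
    (hi : 2 ≤ n i) (hj : 2 ≤ n j) : 1 / 16 * (totalDim n : ℝ) ≤ dimBound n := by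
  have hij' : j ∈ Finset.univ.erase i := by simp [hij.symm]
  have hn' : ∀ k, (1 : ℝ) ≤ n k := fun k => by exact_mod_cast hn k
  have hi' : (2 : ℝ) ≤ n i := by exact_mod_cast hi
  have hj' : (2 : ℝ) ≤ n j := by exact_mod_cast hj
  have hle : ∀ s : Finset (Fin m), ∏ k ∈ s, (((n k : ℝ) + 1) / 2) ≤ ∏ k ∈ s, (n k : ℝ) :=
    fun s => Finset.prod_le_prod (fun k _ => by linarith [hn' k]) fun k _ => by linarith [hn' k]
  rw [dimBound_eq, totalDim, Nat.cast_prod, ← Finset.mul_prod_erase _ _ (Finset.mem_univ i),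
    ← Finset.mul_prod_erase _ _ (Finset.mem_univ i), ← Finset.mul_prod_erase _ _ hij',
    ← Finset.mul_prod_erase _ _ hij']
  set s := (Finset.univ.erase i).erase j
  by_cases hs : ∀ k ∈ s, n k = 1
  · have h1 : ∏ k ∈ s, (n k : ℝ) = 1 := Finset.prod_eq_one fun k hk => by simp [hs k hk]
    have h2 : ∏ k ∈ s, (((n k : ℝ) + 1) / 2) = 1 := Finset.prod_eq_one fun k hk => by
      rw [hs k hk]; norm_num
    rw [h1, h2]
    nlinarith [mul_nonneg (sub_nonneg.2 hi') (sub_nonneg.2 hj')]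
  · push Not at hs
    obtain ⟨k, hk, hk1⟩ := hs
    have hk2 : (2 : ℝ) ≤ n k := by
      have : 2 ≤ n k := by have := hn k; omega
      exact_mod_cast this
    have h1 : ∏ k ∈ s, (((n k : ℝ) + 1) / 2) ≤ 3 / 4 * ∏ k ∈ s, (n k : ℝ) := by
      rw [← Finset.mul_prod_erase _ _ hk, ← Finset.mul_prod_erase _ _ hk, ← mul_assoc]
      refine mul_le_mul (by linarith) (hle _) (Finset.prod_nonneg fun k _ => ?_) (by linarith)
      linarith [hn' k]
    set q := ∏ k ∈ s, (((n k : ℝ) + 1) / 2)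
    set Q := ∏ k ∈ s, (n k : ℝ)
    have hQ : 0 ≤ Q := Finset.prod_nonneg fun k _ => by linarith [hn' k]
    have h2 : ((n j : ℝ) + 1) / 2 * q ≤ (3 / 4 * n j) * (3 / 4 * Q) := by
      refine mul_le_mul (by linarith) h1 (Finset.prod_nonneg fun k _ => ?_) (by linarith)
      linarith [hn' k]
    have h3 : ((n i : ℝ) + 1) / 2 * (((n j : ℝ) + 1) / 2 * q) ≤
        (3 / 4 * n i) * ((3 / 4 * n j) * (3 / 4 * Q)) := by
      refine mul_le_mul (by linarith) h2 (mul_nonneg (by linarith) ?_) (by linarith)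
      exact Finset.prod_nonneg fun k _ => by linarith [hn' k]
    have h4 : 0 ≤ (n i : ℝ) * (n j * Q) := mul_nonneg (by linarith) (mul_nonneg (by linarith) hQ)
    nlinarith

end Bound

end EntangledSubspace

namespace EntangledSubspace

/-! ## Generic subspaces and planted product tensors -/

section Perp

variable {𝕜 : Type*} [RCLike 𝕜] {ι : Type*} [Fintype ι] [DecidableEq ι] {R p : ℕ}
  {f : Fin p → MvPolynomial ι 𝕜}

theorem sum_smul_vecMulVec_mem_quadricsPerp_iff {v : Fin R → ι → 𝕜} {c : Fin R → Fin R → 𝕜} :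
    ∑ a, ∑ b, c a b • vecMulVec (v a) (v b) ∈ quadricsPerp f ↔
      ∀ k, ∑ a, ∑ b, c a b * bilin (quadMatrix (f k)) (v a) (v b) = 0 := by
  refine forall_congr' fun k => ?_
  rw [← Fintype.sum_prod_type' (f := fun a b => c a b * bilin (quadMatrix (f k)) (v a) (v b)),
    ← Fintype.sum_prod_type' (f := fun a b => c a b • vecMulVec (v a) (v b))]
  simp only [Matrix.sum_apply, Matrix.smul_apply, vecMulVec_apply, smul_eq_mul, bilin,
    Finset.mul_sum]
  rw [Finset.sum_comm_cycle]
  exact Eq.congr_left (Finset.sum_congr rfl fun a _ => Finset.sum_congr rfl fun j _ =>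
    Finset.sum_congr rfl fun l _ => by ring)

theorem bilin_quadMatrix_self {q : MvPolynomial ι 𝕜} (hq : q.IsHomogeneous 2) (x : ι → 𝕜) :
    bilin (quadMatrix q) x x = MvPolynomial.eval x q := (eval_eq_sum_quadMatrix hq x).symm

theorem bilin_sum_right {κ : Type*} (s : Finset κ) (M : Matrix ι ι 𝕜) (x : ι → 𝕜) (d : κ → 𝕜)
    (v : κ → ι → 𝕜) : bilin M x (∑ b ∈ s, d b • v b) = ∑ b ∈ s, d b * bilin M x (v b) := by
  simp only [bilin_eq, mulVec_sum, dotProduct_sum, mulVec_smul, dotProduct_smul, smul_eq_mul]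

theorem sum_mul_bilin_eq_zero {v : Fin R → ι → 𝕜} {d : Fin R → 𝕜} (hd : ∑ a, d a • v a = 0)
    (M : Matrix ι ι 𝕜) : ∑ a, ∑ b, d a * d b * bilin M (v a) (v b) = 0 := by
  refine Finset.sum_eq_zero fun a _ => ?_
  simp only [mul_assoc, ← Finset.mul_sum]
  rw [← bilin_sum_right, hd]
  simp [bilin]

/-- A linear relation `d` among the vectors yields the symmetric relation `d a * d b`. -/
theorem linearIndependent_of_symmetric_injective {v : Fin R → ι → 𝕜}
    (h : ∀ c : Fin R → Fin R → 𝕜, (∀ a b, c a b = c b a) →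
      (∀ k, ∑ a, ∑ b, c a b * bilin (quadMatrix (f k)) (v a) (v b) = 0) → c = 0) :
    LinearIndependent 𝕜 v := by
  rw [Fintype.linearIndependent_iff]
  intro d hd a
  have := congrFun (congrFun (h (fun a b => d a * d b) (fun a b => mul_comm _ _) fun k =>
    sum_mul_bilin_eq_zero hd _) a) a
  simpa using this

theorem certSpace_eq_bot_of_symmetric_injective {v : Fin R → ι → 𝕜}
    (h : ∀ c : Fin R → Fin R → 𝕜, (∀ a b, c a b = c b a) →
      (∀ k, ∑ a, ∑ b, c a b * bilin (quadMatrix (f k)) (v a) (v b) = 0) → c = 0) :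
    certSpace v f = ⊥ := by
  rw [Submodule.eq_bot_iff]
  rintro M ⟨hM, hM'⟩
  obtain ⟨c, hc, rfl⟩ := mem_symSquare_span_iff.1 hM
  rw [h c hc (sum_smul_vecMulVec_mem_quadricsPerp_iff.1 hM')]
  simp

variable {o : Fin R} {v : Fin R → ι → 𝕜}

/-- The form vanishes at `(v o, v o)`, so the entry `c o o` can be subtracted without disturbing the
relations, and the hypothesis applies to the rest. -/
theorem eq_zero_of_symmetric_injective_off
    (h : ∀ c : Fin R → Fin R → 𝕜, (∀ a b, c a b = c b a) → c o o = 0 →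
      (∀ k, ∑ a, ∑ b, c a b * bilin (quadMatrix (f k)) (v a) (v b) = 0) → c = 0)
    (h0 : ∀ k, bilin (quadMatrix (f k)) (v o) (v o) = 0) (c : Fin R → Fin R → 𝕜)
    (hc : ∀ a b, c a b = c b a)
    (hk : ∀ k, ∑ a, ∑ b, c a b * bilin (quadMatrix (f k)) (v a) (v b) = 0) (a b : Fin R) :
    c a b = if a = o ∧ b = o then c o o else 0 := by
  have h1 := h (fun a b => c a b - if a = o ∧ b = o then c o o else 0)
    (fun a b => by simp only [hc a b, and_comm]) (by simp) fun k => by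
      simp only [sub_mul, Finset.sum_sub_distrib, hk, ite_and, ite_mul, zero_mul]
      simp [h0]
  exact sub_eq_zero.1 (congrFun (congrFun h1 a) b)

theorem linearIndependent_of_symmetric_injective_off
    (h : ∀ c : Fin R → Fin R → 𝕜, (∀ a b, c a b = c b a) → c o o = 0 →
      (∀ k, ∑ a, ∑ b, c a b * bilin (quadMatrix (f k)) (v a) (v b) = 0) → c = 0)
    (h0 : ∀ k, bilin (quadMatrix (f k)) (v o) (v o) = 0) (hv : v o ≠ 0) :
    LinearIndependent 𝕜 v := by
  rw [Fintype.linearIndependent_iff]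
  intro d hd
  have h1 := eq_zero_of_symmetric_injective_off h h0 (fun a b => d a * d b)
    (fun a b => mul_comm _ _) fun k => sum_mul_bilin_eq_zero hd _
  have h2 : ∀ a, a ≠ o → d a = 0 := fun a ha => by simpa [ha] using h1 a a
  intro a
  by_cases ha : a = o
  · rw [Finset.sum_eq_single o (fun b _ hb => by rw [h2 b hb, zero_smul]) (by simp)] at hd
    rw [ha]
    exact (smul_eq_zero.1 hd).resolve_right hv
  · exact h2 a ha

theorem certSpace_eq_span_of_symmetric_injective_off
    (h : ∀ c : Fin R → Fin R → 𝕜, (∀ a b, c a b = c b a) → c o o = 0 →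
      (∀ k, ∑ a, ∑ b, c a b * bilin (quadMatrix (f k)) (v a) (v b) = 0) → c = 0)
    (h0 : ∀ k, bilin (quadMatrix (f k)) (v o) (v o) = 0) :
    certSpace v f = Submodule.span 𝕜 {vecMulVec (v o) (v o)} := by
  apply le_antisymm
  · rintro M ⟨hM, hM'⟩
    obtain ⟨c, hc, rfl⟩ := mem_symSquare_span_iff.1 hM
    have h1 := eq_zero_of_symmetric_injective_off h h0 c hc
      (sum_smul_vecMulVec_mem_quadricsPerp_iff.1 hM')
    refine Submodule.mem_span_singleton.2 ⟨c o o, ?_⟩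
    rw [Finset.sum_eq_single o _ (by simp), Finset.sum_eq_single o _ (by simp)]
    · intro b _ hb
      rw [h1, if_neg (by tauto), zero_smul]
    · intro a _ ha
      exact Finset.sum_eq_zero fun b _ => by rw [h1, if_neg (by tauto), zero_smul]
  · rw [Submodule.span_le, Set.singleton_subset_iff]
    refine ⟨Submodule.subset_span ⟨v o, Submodule.subset_span ⟨o, rfl⟩, rfl⟩, fun k => ?_⟩
    exact h0 k

theorem certSpace_congr {u v : Fin R → ι → 𝕜}
    (h : Submodule.span 𝕜 (Set.range u) = Submodule.span 𝕜 (Set.range v)) :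
    certSpace u f = certSpace v f := by
  rw [certSpace, certSpace, h]

end Perp

theorem ae_seedMeasure_ne_zero (𝕜 : Type*) [RCLike 𝕜] {R : ℕ} (i : Fin R) :
    ∀ᵐ w ∂(seedMeasure 𝕜 R), w.1 i ≠ 0 ∧ w.2 i ≠ 0 := by
  have h : ∀ᵐ φ ∂(Measure.pi fun _ : Fin R => (Measure.addHaar : Measure 𝕜)), φ i ≠ 0 := by
    rw [ae_iff]
    simpa using Measure.pi_hyperplane (fun _ : Fin R => (Measure.addHaar : Measure 𝕜)) i 0
  exact (Measure.quasiMeasurePreserving_fst.ae h).and (Measure.quasiMeasurePreserving_snd.ae h)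

/-! ### Generic and planted subspaces for the variety of product tensors. -/

section Segre

variable {𝕜 : Type*} [RCLike 𝕜] {m : ℕ} {n : Fin m → ℕ}
  {f : Fin (numQuadrics n) → MvPolynomial (∀ i, Fin (n i)) 𝕜}

/-- Here `W` has no rows, and the count needed is `(R - 1) * N < R * N ≤ p`. -/
theorem holdsGenerically_trivial (hm : 0 < m) (hn : ∀ i, 0 < n i)
    (hf : CutsOutByQuadrics f (productTensors 𝕜 n)) {R : ℕ} (hR : (R : ℝ) ≤ dimBound n) :
    HoldsGenerically (Set.univ : Set (Fin R → Tensor 𝕜 n)) fun v =>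
      LinearIndependent 𝕜 v ∧
      (Submodule.span 𝕜 (Set.range v) : Set (Tensor 𝕜 n)) ∩ productTensors 𝕜 n = {0} ∧
      ∀ u : Fin R → Tensor 𝕜 n, LinearIndependent 𝕜 u →
        Submodule.span 𝕜 (Set.range u) = Submodule.span 𝕜 (Set.range v) →
        ∀ (φ γ : Fin R → 𝕜) (out : Outcome (Tensor 𝕜 n)),
          Alg2RunIrreducible u f φ γ out → out = .trivial := by
  have hRp := mul_totalDim_le_numQuadrics hR
  have hN := totalDim_pos hn
  obtain ⟨q, hq0, hq⟩ := exists_poly_symmetric_eq_zero (r := R) (τ := Empty)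
    (fun k => quadMatrix_comm (f k))
    (linearIndependent_quadMatrix hf.homogeneous hf.linearIndependent) Empty.elim (by
      intro hR0
      rw [card_index, Fintype.card_empty, add_zero]
      refine lt_of_lt_of_le ?_ hRp
      exact Nat.mul_lt_mul_of_pos_right (by omega) hN)
  refine holdsGenerically_of_poly (σ := Fin R × ∀ i, Fin (n i))
    (fun a j => MvPolynomial.X (a, j)) ?_ q ?_ ?_
  · symm
    rw [Set.eq_univ_iff_forall]
    intro v
    exact ⟨fun z => v z.1 z.2, by simp⟩
  · by_contra! h
    refine hq0 (MvPolynomial.funext fun x => ?_)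
    have := h (fun a j => x (a, j)) (Set.mem_univ _)
    rw [map_zero]
    exact this
  · intro v _ hv
    have h1 : ∀ c : Fin R → Fin R → 𝕜, (∀ a b, c a b = c b a) →
        (∀ k, ∑ a, ∑ b, c a b * bilin (quadMatrix (f k)) (v a) (v b) = 0) → c = 0 :=
      fun c hc hk => hq v hv c Empty.elim hc fun k => by simpa using hk k
    have h2 := certSpace_eq_bot_of_symmetric_injective h1
    refine ⟨linearIndependent_of_symmetric_injective h1, ?_, ?_⟩
    · ext x
      constructor
      · rintro ⟨hx, hx'⟩
        exact ((Alg1Run.trivial (φ := 0) (γ := 0) h2).correct hf).1 rfl x hx hx'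
      · rintro rfl
        refine ⟨Submodule.zero_mem _, 0, funext fun j => ?_⟩
        exact Finset.prod_eq_zero (Finset.mem_univ ⟨0, hm⟩) rfl
    · intro u _ huv φ γ out hout
      exact (alg2RunIrreducible_iff.1 hout).eq_trivial (by rw [certSpace_congr huv, h2])

/-- The quadrics through the Segre variety see every coordinate of a tensor that is not tangent to
the Segre variety at the basis tensor `o`. -/
theorem eq_zero_of_bilin_single_eq_zero (hf : CutsOutByQuadrics f (productTensors 𝕜 n))
    {o j : ∀ i, Fin (n i)} {i i' : Fin m} (hii : i ≠ i') (hi : j i ≠ o i) (hi' : j i' ≠ o i')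
    {w : Tensor 𝕜 n} (hw : ∀ k, bilin (quadMatrix (f k)) (Pi.single o 1) w = 0) : w j = 0 := by
  have hlin : ∀ q ∈ Submodule.span 𝕜 (Set.range f),
      bilin (quadMatrixLin q) (Pi.single o 1) w = 0 := by
    intro q hq
    induction hq using Submodule.span_induction with
    | mem q hq => obtain ⟨k, rfl⟩ := hq; exact hw k
    | zero => simp [bilin]
    | add q q' _ _ h h' =>
      rw [map_add, bilin_eq, add_mulVec, dotProduct_add, ← bilin_eq, ← bilin_eq, h, h', add_zero]
    | smul c q _ h =>
      rw [map_smul, bilin_eq, smul_mulVec, dotProduct_smul, ← bilin_eq, h, smul_zero]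
  -- The minor contains the monomial `x_o x_j`. Because `j` differs from `o` at both `i` and `i'`,
  -- its other monomial does not involve `x_o`. So its polar form at the basis tensor `o` is half
  -- the `j`-th coordinate.
  have h1 := hlin _ (quadOfCoeffs_mem_span hf (swapMinor_mem_ker o j i))
  have hoj : o ≠ j := fun h => hi (by rw [h])
  have h2 : ∀ l, quadMatrix (quadOfCoeffs (swapMinor (𝕜 := 𝕜) o j i)) o l =
      if l = j then 1 / 2 else 0 := by
    intro l
    have h3 : s(o, l) ≠ s(Function.update o i (j i), Function.update j i (o i)) := by
      intro h
      rw [Sym2.eq_iff] at h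
      rcases h with ⟨h, -⟩ | ⟨h, -⟩
      · have := congrFun h i
        rw [Function.update_self] at this
        exact hi this.symm
      · have := congrFun h i'
        rw [Function.update_of_ne hii.symm] at this
        exact hi' this.symm
    have h4 : quadCoeff (quadOfCoeffs (swapMinor (𝕜 := 𝕜) o j i)) o l = if l = j then 1 else 0 := by
      rw [quadCoeff_eq, coeff_quadOfCoeffs, swapMinor, Pi.sub_apply, Pi.single_apply,
        Pi.single_apply, if_neg h3, sub_zero]
      simp [hoj]
    rw [quadMatrix, h4]
    by_cases hl : l = j
    · simp [hl, hoj]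
    · simp [hl]
  have h3 : bilin (quadMatrixLin (quadOfCoeffs (swapMinor (𝕜 := 𝕜) o j i))) (Pi.single o 1) w =
      1 / 2 * w j := by
    rw [bilin_eq, single_one_dotProduct, mulVec, dotProduct]
    have : ∀ l, quadMatrixLin (quadOfCoeffs (swapMinor (𝕜 := 𝕜) o j i)) o l =
      if l = j then 1 / 2 else 0 := h2
    simp [this]
  rw [h3] at h1
  simpa using h1

/-- The excluded indices are `o` itself and those obtained from `o` by changing one entry. There are
at most `1 + ∑ (n i - 1)` of them, and `add_le_totalDim` leaves room for `R` others. -/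
theorem exists_embedding_off {R : ℕ} (hn : ∀ i, 0 < n i) (hR : (R : ℝ) ≤ dimBound n) {r : ℕ}
    (hr : r ≤ R) (o : ∀ i, Fin (n i)) :
    ∃ e : Fin r → ∀ i, Fin (n i), Function.Injective e ∧
      ∀ b, ∃ i i', i ≠ i' ∧ e b i ≠ o i ∧ e b i' ≠ o i' := by
  classical
  let good := {j : ∀ i, Fin (n i) // ∃ i i', i ≠ i' ∧ j i ≠ o i ∧ j i' ≠ o i'}
  have hbad : Fintype.card {j : ∀ i, Fin (n i) // ¬ ∃ i i', i ≠ i' ∧ j i ≠ o i ∧ j i' ≠ o i'} ≤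
      1 + ∑ i, (n i - 1) := by
    have hc : Fintype.card (Option (Σ i, {x : Fin (n i) // x ≠ o i})) = 1 + ∑ i, (n i - 1) := by
      simp [Fintype.card_subtype_compl, add_comm]
    let g : Option (Σ i, {x : Fin (n i) // x ≠ o i}) → ∀ i, Fin (n i) := fun z =>
      z.elim o fun x => Function.update o x.1 x.2
    rw [← hc, Fintype.card_subtype]
    refine (Finset.card_le_card (t := Finset.univ.image g) fun j hj => ?_).trans
      Finset.card_image_le
    simp only [Finset.mem_filter_univ] at hj
    push Not at hj
    rw [Finset.mem_image]
    by_cases h : ∃ i, j i ≠ o i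
    · obtain ⟨i, hi⟩ := h
      refine ⟨some ⟨i, j i, hi⟩, Finset.mem_univ _, funext fun i' => ?_⟩
      change Function.update o i (j i) i' = j i'
      by_cases hii : i = i'
      · subst hii; simp
      · rw [Function.update_of_ne (Ne.symm hii), hj i i' hii hi]
    · push Not at h
      exact ⟨none, Finset.mem_univ _, funext fun i => (h i).symm⟩
  have hcard : Fintype.card (Fin r) ≤ Fintype.card good := by
    have h1 := Fintype.card_subtype_compl
      (fun j : ∀ i, Fin (n i) => ∃ i i', i ≠ i' ∧ j i ≠ o i ∧ j i' ≠ o i')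
    have h2 := add_le_totalDim hn hR
    rw [card_index] at h1
    rw [Fintype.card_fin]
    have h3 : Fintype.card good ≤ totalDim n := by
      rw [← card_index]; exact Fintype.card_subtype_le _
    simp only [good] at h3 ⊢
    omega
  obtain ⟨e⟩ := Function.Embedding.nonempty_of_card_le hcard
  exact ⟨fun b => e b, fun a b h => e.injective (Subtype.ext h), fun b => (e b).2⟩

/-- A generic choice of the vectors beside a planted product tensor admits only one relation. -/
theorem exists_planted_start (hn : ∀ i, 0 < n i)
    (hf : CutsOutByQuadrics f (productTensors 𝕜 n)) {r : ℕ}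
    (hR : ((r + 1 : ℕ) : ℝ) ≤ dimBound n) (o : ∀ i, Fin (n i)) :
    ∃ v : Fin (r + 1) → Tensor 𝕜 n, v 0 = Pi.single o 1 ∧
      ∀ c : Fin (r + 1) → Fin (r + 1) → 𝕜, (∀ a b, c a b = c b a) → c 0 0 = 0 →
        (∀ k, ∑ a, ∑ b, c a b * bilin (quadMatrix (f k)) (v a) (v b) = 0) → c = 0 := by
  have hRp := mul_totalDim_le_numQuadrics hR
  have hN := totalDim_pos hn
  set x₀ : Tensor 𝕜 n := Pi.single o 1 with hx₀
  -- The rows of `W` are the values of the forms on `x₀` and each basis tensor, so they absorb all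
  -- cross terms between `x₀` and the other vectors. The count is `(r - 1) * N + N < (r + 1) * N ≤
  -- p`.
  obtain ⟨q₁, hq₁, h₁⟩ := exists_poly_symmetric_eq_zero (r := r) (τ := ∀ i, Fin (n i))
    (fun k => quadMatrix_comm (f k))
    (linearIndependent_quadMatrix hf.homogeneous hf.linearIndependent)
    (fun t k => bilin (quadMatrix (f k)) x₀ (Pi.single t 1)) (by
      intro hr
      rw [card_index]
      refine lt_of_lt_of_le ?_ hRp
      obtain ⟨s, rfl⟩ := Nat.exists_eq_succ_of_ne_zero hr.ne'
      rw [Nat.succ_sub_one]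
      have : (s.succ + 1) * totalDim n = s * totalDim n + totalDim n + totalDim n := by
        rw [Nat.succ_eq_add_one]; ring
      omega)
  obtain ⟨e, he, he'⟩ := exists_embedding_off hn hR (Nat.le_succ r) o
  have heval : ∀ (d : Fin r × (∀ i, Fin (n i)) → 𝕜) (y : Fin r → 𝕜) k,
      ∑ b, y b * MvPolynomial.eval d (∑ j, ∑ l, MvPolynomial.C (quadMatrix (f k) j l * x₀ j) *
        MvPolynomial.X (b, l)) =
      bilin (quadMatrix (f k)) x₀ (∑ b, y b • fun l => d (b, l)) := by
    intro d y k
    rw [bilin_sum_right]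
    refine Finset.sum_congr rfl fun b _ => ?_
    simp only [map_sum, map_mul, MvPolynomial.eval_C, MvPolynomial.eval_X, bilin]
    congr 1
    exact Finset.sum_congr rfl fun j _ => Finset.sum_congr rfl fun l _ => by ring
  -- Injectivity of `y ↦ B_k(x₀, ∑ y b • v b)` is witnessed by distinct basis tensors at positions
  -- outside the tangent directions of `o`.
  obtain ⟨q₂, hq₂, h₂⟩ := exists_poly_injective (⊤ : Submodule 𝕜 (Fin r → 𝕜))
    (fun (k : Fin (numQuadrics n)) (b : Fin r) => ∑ j, ∑ l,
      MvPolynomial.C (quadMatrix (f k) j l * x₀ j) *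
        (MvPolynomial.X (b, l) : MvPolynomial (Fin r × ∀ i, Fin (n i)) 𝕜))
    (fun z => Pi.single (M := fun _ => 𝕜) (e z.1) 1 z.2) (by
      intro y _ hy
      simp only [heval] at hy
      funext b
      obtain ⟨i, i', hii, hi, hi'⟩ := he' b
      have := eq_zero_of_bilin_single_eq_zero hf hii hi hi' hy
      simpa [Finset.sum_apply, Pi.single_apply, he.eq_iff] using this)
  have hq₂' : q₂ ≠ 0 := by
    rintro rfl
    exact hq₂ (map_zero _)
  obtain ⟨d, hd⟩ : ∃ d, MvPolynomial.eval d (q₁ * q₂) ≠ 0 := by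
    by_contra! h
    exact mul_ne_zero hq₁ hq₂' (MvPolynomial.funext (by simpa using h))
  rw [map_mul] at hd
  have h₁ := h₁ (fun a j => d (a, j)) (left_ne_zero_of_mul hd)
  have h₂ := h₂ d (right_ne_zero_of_mul hd)
  simp only [heval] at h₂
  set v : Fin r → Tensor 𝕜 n := fun a j => d (a, j) with hv
  refine ⟨Fin.cons x₀ v, rfl, fun c hc hc0 hk => ?_⟩
  -- The relation is split off at index `0`: the corner vanishes by `c 0 0 = 0`, and the two halves
  -- of the cross terms agree by symmetry, whence the factor `-2`.
  have hexp : ∀ k, ∑ a : Fin r, ∑ b : Fin r, c a.succ b.succ * bilin (quadMatrix (f k)) (v a) (v b)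
      = -2 * bilin (quadMatrix (f k)) x₀ (∑ b : Fin r, c 0 b.succ • v b) := by
    intro k
    have := hk k
    simp only [Fin.sum_univ_succ, Fin.cons_zero, Fin.cons_succ, hc0, zero_mul, zero_add,
      Finset.sum_add_distrib] at this
    rw [bilin_sum_right]
    have h3 : ∀ b : Fin r, c b.succ 0 * bilin (quadMatrix (f k)) (v b) x₀ =
        c 0 b.succ * bilin (quadMatrix (f k)) x₀ (v b) := fun b => by
      rw [hc, bilin_comm (quadMatrix_comm _)]
    simp only [h3] at this
    linear_combination this
  -- The coordinates of `-2 • ∑ c 0 b • v b` are the coefficients of the combination of the rows of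
  -- `W`.
  have hc' := h₁ (fun a b => c a.succ b.succ) (-2 * ∑ b : Fin r, c 0 b.succ • v b)
    (fun a b => hc _ _) fun k => by
      rw [hexp]
      conv_lhs => rw [show (∑ b : Fin r, c 0 b.succ • v b) =
        ∑ t, (∑ b : Fin r, c 0 b.succ • v b) t • (Pi.single t 1 : Tensor 𝕜 n) from
          pi_eq_sum_univ' _, bilin_sum_right]
      rw [Finset.mul_sum]
      refine Finset.sum_congr rfl fun t _ => ?_
      simp only [Pi.mul_apply]
      rw [← mul_assoc]
      rfl
  have hc'' := h₂ (fun b => c 0 b.succ) trivial fun k => by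
    have := hexp k
    have h3 : ∀ a b : Fin r, c a.succ b.succ = 0 := fun a b => congrFun (congrFun hc' a) b
    simp only [h3, zero_mul, Finset.sum_const_zero] at this
    simpa using this.symm
  have h4 : ∀ b : Fin r, c 0 b.succ = 0 := fun b => congrFun hc'' b
  funext a b
  refine Fin.cases ?_ (fun a => ?_) a <;> refine Fin.cases ?_ (fun b => ?_) b
  · exact hc0
  · exact h4 b
  · rw [hc]; exact h4 a
  · exact congrFun (congrFun hc' a) b

/-- The special tuple of `exists_planted_start` provides a point of `X × V^r` at which the openness
polynomial of `exists_poly_injective` does not vanish. Where it does not vanish and `v 0 ≠ 0`,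
`certSpace` is the line spanned by `v 0 ⊗ v 0`. -/
theorem holdsGenerically_planted (hn : ∀ i, 0 < n i)
    (hf : CutsOutByQuadrics f (productTensors 𝕜 n)) {R : ℕ} (hR0 : 0 < R)
    (hR : (R : ℝ) ≤ dimBound n) :
    HoldsGenerically {v : Fin R → Tensor 𝕜 n | v ⟨0, hR0⟩ ∈ productTensors 𝕜 n} fun v =>
      LinearIndependent 𝕜 v ∧
      ∀ u : Fin R → Tensor 𝕜 n, LinearIndependent 𝕜 u →
        Submodule.span 𝕜 (Set.range u) = Submodule.span 𝕜 (Set.range v) →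
        ∀ᵐ w ∂(seedMeasure 𝕜 R), ∀ out : Outcome (Tensor 𝕜 n),
          Alg2RunIrreducible u f w.1 w.2 out →
            ∃ c : 𝕜, c ≠ 0 ∧ out = .found [c • v ⟨0, hR0⟩] := by
  obtain ⟨r, rfl⟩ := Nat.exists_eq_succ_of_ne_zero hR0.ne'
  let o : ∀ i, Fin (n i) := fun i => ⟨0, hn i⟩
  obtain ⟨v₀, hv₀, h₀⟩ := exists_planted_start hn hf hR o
  let S : Submodule 𝕜 (Fin (r + 1) × Fin (r + 1) → 𝕜) :=
    { carrier := {c | (∀ a b, c (a, b) = c (b, a)) ∧ c (0, 0) = 0}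
      add_mem' := fun h h' => ⟨fun a b => by simp [h.1 a b, h'.1 a b], by simp [h.2, h'.2]⟩
      zero_mem' := by simp
      smul_mem' := fun t c h => ⟨fun a b => by simp [h.1 a b], by simp [h.2]⟩ }
  have heval : ∀ (d : Fin (r + 1) × (∀ i, Fin (n i)) → 𝕜) (c : Fin (r + 1) × Fin (r + 1) → 𝕜) k,
      ∑ t : Fin (r + 1) × Fin (r + 1), c t * MvPolynomial.eval d (∑ j, ∑ l,
        MvPolynomial.C (quadMatrix (f k) j l) *
          (MvPolynomial.X (t.1, j) * MvPolynomial.X (t.2, l))) =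
      ∑ a, ∑ b, c (a, b) * bilin (quadMatrix (f k)) (fun l => d (a, l)) (fun l => d (b, l)) := by
    intro d c k
    rw [Fintype.sum_prod_type]
    simp only [map_sum, map_mul, MvPolynomial.eval_C, MvPolynomial.eval_X, bilin]
  obtain ⟨q, hq, hinj⟩ := exists_poly_injective S
    (fun (k : Fin (numQuadrics n)) t => ∑ j, ∑ l, MvPolynomial.C (quadMatrix (f k) j l) *
      ((MvPolynomial.X (t.1, j) : MvPolynomial (Fin (r + 1) × ∀ i, Fin (n i)) 𝕜) *
        MvPolynomial.X (t.2, l)))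
    (fun z => v₀ z.1 z.2) (by
      intro c hc hk
      simp only [heval] at hk
      have := h₀ (fun a b => c (a, b)) hc.1 hc.2 hk
      funext t
      exact congrFun (congrFun this t.1) t.2)
  -- The parameters are the factors of the planted tensor and the coordinates of the other vectors.
  -- The extra factor, the coordinate of `v 0` at `o`, excludes `v 0 = 0`, which is also a product
  -- tensor.
  refine holdsGenerically_of_poly (σ := (Σ i, Fin (n i)) ⊕ (Fin (r + 1) × ∀ i, Fin (n i)))
    (fun a j => if a = 0 then ∏ i, MvPolynomial.X (Sum.inl ⟨i, j i⟩)
      else MvPolynomial.X (Sum.inr (a, j))) ?_ (q * MvPolynomial.X (0, o)) ?_ ?_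
  · ext v
    constructor
    · rintro ⟨x, hx⟩
      refine ⟨Sum.elim (fun z => x z.1 z.2) fun z => v z.1 z.2, ?_⟩
      funext a j
      by_cases ha : a = 0
      · have := congrFun hx j
        simp only [ha, if_true, map_prod, MvPolynomial.eval_X, Sum.elim_inl]
        exact this
      · simp [ha]
    · rintro ⟨y, rfl⟩
      refine ⟨fun i l => y (Sum.inl ⟨i, l⟩), funext fun j => ?_⟩
      change _ = MvPolynomial.eval y (if (0 : Fin (r + 1)) = 0 then _ else _)
      simp [productTensor]
  · refine ⟨v₀, ?_, ?_⟩
    · refine ⟨fun i => Pi.single (o i) 1, ?_⟩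
      change _ = v₀ 0
      rw [hv₀]
      funext j
      simp only [productTensor, Pi.single_apply]
      by_cases hj : j = o
      · simp [hj]
      · rw [if_neg hj]
        obtain ⟨i, hi⟩ := Function.ne_iff.1 hj
        exact Finset.prod_eq_zero (Finset.mem_univ i) (if_neg hi)
    · rw [evalTuple, map_mul, MvPolynomial.eval_X, hv₀, Pi.single_eq_same, mul_one]
      exact hq
  · intro v hvX hv
    rw [evalTuple, map_mul, MvPolynomial.eval_X] at hv
    have hv0 : v 0 ≠ 0 := fun h => right_ne_zero_of_mul hv (by rw [h]; rfl)
    have h1 : ∀ c : Fin (r + 1) → Fin (r + 1) → 𝕜, (∀ a b, c a b = c b a) → c 0 0 = 0 →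
        (∀ k, ∑ a, ∑ b, c a b * bilin (quadMatrix (f k)) (v a) (v b) = 0) → c = 0 := by
      intro c hc hc0 hk
      have := hinj _ (left_ne_zero_of_mul hv) (fun z => c z.1 z.2) ⟨hc, hc0⟩ fun k => by
        rw [heval]; exact hk k
      funext a b
      exact congrFun this (a, b)
    have h2 : ∀ k, bilin (quadMatrix (f k)) (v 0) (v 0) = 0 := by
      intro k
      rw [bilin_quadMatrix_self (hf.homogeneous k)]
      have : v 0 ∈ {x | ∀ i, MvPolynomial.eval x (f i) = 0} := by rw [hf.zeroSet]; exact hvX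
      exact this k
    refine ⟨linearIndependent_of_symmetric_injective_off h1 h2 hv0, fun u _ huv => ?_⟩
    have hcert : certSpace u f = Submodule.span 𝕜 {vecMulVec (v 0) (v 0)} := by
      rw [certSpace_congr huv, certSpace_eq_span_of_symmetric_injective_off h1 h2]
    filter_upwards [ae_seedMeasure_ne_zero 𝕜 (0 : Fin (r + 1))] with w hw out hout
    exact (alg2RunIrreducible_iff.1 hout).eq_found_of_planted hR0 hv0 hcert hw.1 hw.2

end Segre

end EntangledSubspace

namespace EntangledSubspace

/-! ## The program

The counters `5`, `6`, `4` hold `R ^ 2`, the dimension of the certificate space and the number of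
nonzero eigenvalues. -/

namespace SExp

/-- The content of a cell with indices in counters. -/
def at' (t : ℕ) (xs : List ℕ) : SExp := cell ⟨t, xs.map .var⟩

def add (e f : SExp) : SExp := arith .add e f

def sub (e f : SExp) : SExp := arith .sub e f

def mul (e f : SExp) : SExp := arith .mul e f

end SExp

namespace CertProg

open SExp

/-- Array `6` holds the products `u a ⊗ u b`, with `(a, b)` at position `a * R + b`. -/
def squares : Prog :=
  .seq (.setNat 5 (.const 0)) (.loop 10 (.var 1) (.loop 11 (.var 1)
    (.seq (fill 6 (mul (at' 0 [10, 12]) (at' 0 [11, 13])) 12 [0, 0] [.var 5])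
      (.setNat 5 (.add (.var 5) (.const 1))))))

/-- The values of the doubled quadrics on the products. -/
def values : SExp :=
  add (sum 0 (sum 0 (mul (at' 1 [10, 12, 13]) (at' 6 [11, 12, 13]))))
    (sum 0 (mul (at' 1 [10, 12, 12]) (at' 6 [11, 12, 12])))

/-- The Gram matrix of the linear conditions that define the certificate space. -/
def gramian : SExp :=
  add (sum 2 (mul (conj (at' 7 [12, 10])) (at' 7 [12, 11])))
    (sum 0 (sum 0 (mul (conj (sub (at' 6 [10, 12, 13]) (at' 6 [10, 13, 12])))
      (sub (at' 6 [11, 12, 13]) (at' 6 [11, 13, 12])))))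

/-- The matrix for a null vector of the Gram matrix. -/
def lift : SExp := sum 5 (mul (at' 9 [13, 10]) (at' 6 [13, 11, 12]))

/-- Array `12` holds a basis of the certificate space. -/
def basis : Prog :=
  .seq squares (.seq (fill 7 values 10 [2, 5] []) (.seq (fill 8 gramian 10 [5, 5] [])
    (.seq (.diagonalize (.var 5) 8 9 10 11)
      (collect 6 5 10 (at' 10 [10]) (fill 12 lift 11 [0, 0] [.var 6])))))

/-- The contraction of the basis with the functional in array `t`. -/
def contraction (t : ℕ) : SExp := sum 6 (mul (at' t [12]) (at' 12 [12, 10, 11]))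

def normal : SExp := sum 0 (mul (conj (at' 14 [12, 10])) (at' 14 [12, 11]))

def pseudoinverse : SExp :=
  sum 0 (sum 0 (mul (mul (mul (at' 16 [10, 12]) (inv (at' 17 [12]))) (at' 18 [12, 13]))
    (conj (at' 14 [11, 13]))))

def quotient : SExp := sum 0 (mul (at' 13 [10, 12]) (at' 19 [12, 11]))

/-- The value `1` if the `x`-th eigenvalue is not zero, and `0` otherwise. -/
def nonzero (x : ℕ) : SExp := mul (at' 22 [x]) (inv (at' 22 [x]))

/-- The eigenvectors are tested because the oracle's answer is meaningless when the matrix is not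
diagonalizable. The factor `d i` in this test and the next one exempts the zero eigenvalues. -/
def eigenTest : SExp :=
  mul (at' 22 [10]) (sub (sum 0 (mul (at' 20 [11, 12]) (at' 21 [12, 10])))
    (mul (at' 22 [10]) (at' 21 [11, 10])))

/-- Each summand is `1` if the two eigenvalues agree and `0` otherwise, so the sum is the
multiplicity, to be compared with `1`. -/
def simpleTest : SExp :=
  mul (at' 22 [10]) (sub (sum 0 (sub one (mul (sub (at' 22 [10]) (at' 22 [11]))
    (inv (sub (at' 22 [10]) (at' 22 [11])))))) one)

/-- The coefficient of the square of the `i`-th eigenvector in `T k`, namely `T k` evaluated at row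
`i` of the inverse. The counter numbers presuppose nesting level `14`, with `k` in counter `10` and
`i` in counter `13`. -/
def weight : SExp :=
  sum 0 (sum 0 (mul (mul (at' 23 [13, 14]) (at' 12 [10, 14, 15])) (at' 23 [13, 15])))

def squareTest : SExp :=
  sub (at' 12 [10, 11, 12]) (sum 0 (mul (nonzero 13)
    (mul weight (mul (at' 21 [11, 13]) (at' 21 [12, 13])))))

/-- Simultaneous diagonalization: array `21`, `22`, `23` hold a diagonalization of
`T(φ) T(γ)⁺`. -/
def diagonalization : Prog :=
  .seq (fill 13 (contraction 2) 10 [0, 0] []) (.seq (fill 14 (contraction 3) 10 [0, 0] [])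
    (.seq (fill 15 normal 10 [0, 0] []) (.seq (.diagonalize (.var 0) 15 16 17 18)
      (.seq (fill 19 pseudoinverse 10 [0, 0] []) (.seq (fill 20 quotient 10 [0, 0] [])
        (.diagonalize (.var 0) 20 21 22 23))))))

/-- Array `4` holds the eigenvectors for the nonzero eigenvalues. -/
def select : Prog :=
  collect 4 0 10 (sub one (nonzero 10)) (fill 4 (at' 21 [11, 10]) 11 [0] [.var 4])

/-- Test all conditions on the eigenvectors. -/
def certify : Prog :=
  .seq (check 27 eigenTest 10 [0, 0]) (.seq (check 27 simpleTest 10 [0])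
    (check 27 squareTest 10 [6, 0, 0]))

def verdict : Prog :=
  .ifLt (.var 4) (.var 6) (.setNat 3 (.const 2)) (.ifLt (.var 6) (.var 4) (.setNat 3 (.const 2))
    (.ifZero ⟨27, []⟩ (.setNat 3 (.const 1)) (.setNat 3 (.const 2))))

/-- Output the eigenvectors for nonzero eigenvalues, if they satisfy all conditions. -/
def answer : Prog := .seq select (.seq certify verdict)

/-- The program for Algorithm 2. -/
def main : Prog :=
  .seq basis (.ifLt (.const 0) (.var 6)
    (.ifLt (.var 1) (.var 6) (.setNat 3 (.const 2)) (.seq diagonalization answer)) .skip)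

end CertProg

/-! ### Effect of the individual instructions of the program. -/

section Exec

variable {𝕜 : Type*} [RCLike 𝕜] (O : DiagOracle 𝕜)

open CertProg

@[simp]
theorem SExp.eval_at (arr : ℕ → List ℕ → 𝕜) (t : ℕ) (xs : List ℕ) (k : ℕ) (ν : ℕ → ℕ) :
    (SExp.at' t xs).eval arr k ν = arr t (xs.map ν) := by
  simp [SExp.at', SExp.eval, Function.comp_def, NExp.eval]

@[simp]
theorem SExp.eval_add (arr : ℕ → List ℕ → 𝕜) (e f : SExp) (k : ℕ) (ν : ℕ → ℕ) :
    (SExp.add e f).eval arr k ν = e.eval arr k ν + f.eval arr k ν := rfl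

@[simp]
theorem SExp.eval_sub (arr : ℕ → List ℕ → 𝕜) (e f : SExp) (k : ℕ) (ν : ℕ → ℕ) :
    (SExp.sub e f).eval arr k ν = e.eval arr k ν - f.eval arr k ν := rfl

@[simp]
theorem SExp.eval_mul (arr : ℕ → List ℕ → 𝕜) (e f : SExp) (k : ℕ) (ν : ℕ → ℕ) :
    (SExp.mul e f).eval arr k ν = e.eval arr k ν * f.eval arr k ν := rfl

theorem forall₂_two {ν : ℕ → ℕ} {x y a b : ℕ} (ha : a < ν x) (hb : b < ν y) :
    List.Forall₂ (fun w x => w < ν x) [a, b] [x, y] :=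
  .cons ha (.cons hb .nil)

theorem exec_values (s : Config 𝕜) {i x : ℕ} (hi : i < s.nat 2) (hx : x < s.nat 5) :
    ((fill 7 values 10 [2, 5] []).exec O s).arr 7 [i, x] =
      ∑ j ∈ Finset.range (s.nat 0), ∑ k ∈ Finset.range (s.nat 0),
        s.arr 1 [i, j, k] * s.arr 6 [x, j, k] +
      ∑ j ∈ Finset.range (s.nat 0), s.arr 1 [i, j, j] * s.arr 6 [x, j, j] := by
  refine ((exec_fill O (by decide) rfl rfl rfl (by decide) rfl s).1 _
    (forall₂_two hi hx)).trans ?_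
  simp [SExp.evalAt, values, SExp.eval]

theorem exec_gramian (s : Config 𝕜) {x y : ℕ} (hx : x < s.nat 5) (hy : y < s.nat 5) :
    ((fill 8 gramian 10 [5, 5] []).exec O s).arr 8 [x, y] =
      ∑ i ∈ Finset.range (s.nat 2), star (s.arr 7 [i, x]) * s.arr 7 [i, y] +
      ∑ j ∈ Finset.range (s.nat 0), ∑ k ∈ Finset.range (s.nat 0),
        star (s.arr 6 [x, j, k] - s.arr 6 [x, k, j]) *
          (s.arr 6 [y, j, k] - s.arr 6 [y, k, j]) := by
  refine ((exec_fill O (by decide) rfl rfl rfl (by decide) rfl s).1 _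
    (forall₂_two hx hy)).trans ?_
  simp [SExp.evalAt, gramian, SExp.eval]

theorem exec_contraction (s : Config 𝕜) {t : ℕ} (t' : ℕ) (ht : t = 13 ∨ t = 14)
    (ht' : t' = 2 ∨ t' = 3) {j k : ℕ} (hj : j < s.nat 0)
    (hk : k < s.nat 0) :
    ((fill t (contraction t') 10 [0, 0] []).exec O s).arr t [j, k] =
      ∑ i ∈ Finset.range (s.nat 6), s.arr t' [i] * s.arr 12 [i, j, k] := by
  refine ((exec_fill O (by omega) (by rcases ht' with rfl | rfl <;> rfl)
    (by rcases ht' with rfl | rfl <;> rfl)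
    (by rcases ht with rfl | rfl <;> rcases ht' with rfl | rfl <;> rfl)
    (by decide) rfl s).1 _ (forall₂_two hj hk)).trans ?_
  simp [SExp.evalAt, contraction, SExp.eval]

theorem exec_normal (s : Config 𝕜) {j k : ℕ} (hj : j < s.nat 0) (hk : k < s.nat 0) :
    ((fill 15 normal 10 [0, 0] []).exec O s).arr 15 [j, k] =
      ∑ x ∈ Finset.range (s.nat 0), star (s.arr 14 [x, j]) * s.arr 14 [x, k] := by
  refine ((exec_fill O (by decide) rfl rfl rfl (by decide) rfl s).1 _
    (forall₂_two hj hk)).trans ?_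
  simp [SExp.evalAt, normal, SExp.eval]

theorem exec_pseudoinverse (s : Config 𝕜) {j k : ℕ} (hj : j < s.nat 0) (hk : k < s.nat 0) :
    ((fill 19 pseudoinverse 10 [0, 0] []).exec O s).arr 19 [j, k] =
      ∑ x ∈ Finset.range (s.nat 0), ∑ y ∈ Finset.range (s.nat 0),
        s.arr 16 [j, x] * (s.arr 17 [x])⁻¹ * s.arr 18 [x, y] * star (s.arr 14 [k, y]) := by
  refine ((exec_fill O (by decide) rfl rfl rfl (by decide) rfl s).1 _
    (forall₂_two hj hk)).trans ?_
  simp [SExp.evalAt, pseudoinverse, SExp.eval]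

theorem exec_quotient (s : Config 𝕜) {j k : ℕ} (hj : j < s.nat 0) (hk : k < s.nat 0) :
    ((fill 20 quotient 10 [0, 0] []).exec O s).arr 20 [j, k] =
      ∑ x ∈ Finset.range (s.nat 0), s.arr 13 [j, x] * s.arr 19 [x, k] := by
  refine ((exec_fill O (by decide) rfl rfl rfl (by decide) rfl s).1 _
    (forall₂_two hj hk)).trans ?_
  simp [SExp.evalAt, quotient, SExp.eval]

theorem exec_squares (s : Config 𝕜) :
    (squares.exec O s).nat 5 = s.nat 1 * s.nat 1 ∧
      ∀ q < s.nat 1 * s.nat 1, ∀ j < s.nat 0, ∀ k < s.nat 0,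
        (squares.exec O s).arr 6 [q, j, k] =
          s.arr 0 [q / s.nat 1, j] * s.arr 0 [q % s.nat 1, k] := by
  set R := s.nat 1 with hR
  set N := s.nat 0 with hN
  -- Counter `5` is the number of products written so far; during the inner loop it equals `a * R +
  -- b`.
  let J : ℕ → Config 𝕜 → Prop := fun n u => u.nat 5 = n ∧ u.nat 1 = R ∧ u.nat 0 = N ∧
    u.arr 0 = s.arr 0 ∧ ∀ q < n, ∀ j < N, ∀ k < N,
      u.arr 6 [q, j, k] = s.arr 0 [q / R, j] * s.arr 0 [q % R, k]
  have hJ : ∀ n (u : Config 𝕜) x i, 10 ≤ x → J n u → J n ((u.setNat x i).tick 1) := by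
    rintro n u x i hx ⟨h1, h2, h3, h4, h5⟩
    refine ⟨?_, ?_, ?_, h4, h5⟩ <;>
      simpa [Config.tick, Config.setNat, Function.update_apply, show ¬ 5 = x by omega,
        show ¬ 1 = x by omega, show ¬ 0 = x by omega]
  set s₀ : Config 𝕜 := (Prog.setNat 5 (.const 0)).exec O s with hs₀
  have key := exec_loop_induction O (x := 10) (e := .var 1) (s := s₀)
    (c := .loop 11 (.var 1) (.seq
      (fill 6 (.mul (.at' 0 [10, 12]) (.at' 0 [11, 13])) 12 [0, 0] [.var 5])
      (.setNat 5 (.add (.var 5) (.const 1))))) (fun a u => J (a * R) u)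
    ⟨by simp [hs₀, Prog.exec, Config.setNat, Config.tick, NExp.eval], rfl, rfl, rfl, by simp⟩ (by
    intro a _ u hu
    set v := (u.setNat 10 a).tick 1 with hv
    have hva : v.nat 10 = a := by simp [hv, Config.tick, Config.setNat]
    have hvJ : J (a * R) v := hJ _ _ _ _ le_rfl hu
    have key2 := exec_loop_induction O (x := 11) (e := .var 1) (s := v) (c := .seq
      (fill 6 (.mul (.at' 0 [10, 12]) (.at' 0 [11, 13])) 12 [0, 0] [.var 5])
      (.setNat 5 (.add (.var 5) (.const 1))))
      (fun b w => J (a * R + b) w ∧ w.nat 10 = a) ⟨hvJ, hva⟩ (by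
      rintro b hb w ⟨hw, hwa⟩
      have hb : b < R := by rw [← hvJ.2.1]; exact hb
      obtain ⟨h1, h2, h3, h4, h5⟩ := hJ _ _ 11 b (by omega) hw
      set z := (w.setNat 11 b).tick 1 with hz
      have hza : z.nat 10 = a := by simpa [hz, Config.tick, Config.setNat] using hwa
      have hzb : z.nat 11 = b := by simp [hz, Config.tick, Config.setNat]
      obtain ⟨f1, f2⟩ := exec_fill O (t := 6)
        (e := .mul (.at' 0 [10, 12]) (.at' 0 [11, 13])) (k := 12) (xs := [0, 0]) (pre := [.var 5])
        (by decide) rfl rfl rfl (by decide) rfl z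
      have hn : ∀ x < 12, ((fill 6 (.mul (.at' 0 [10, 12]) (.at' 0 [11, 13])) 12 [0, 0]
          [.var 5]).exec O z).nat x = z.nat x := fun x hx => exec_nat_eq O (keepsNat_fill hx _ _ _) z
      have ha : ((fill 6 (.mul (.at' 0 [10, 12]) (.at' 0 [11, 13])) 12 [0, 0]
          [.var 5]).exec O z).arr 0 = z.arr 0 :=
        exec_arr_eq O (keepsArr_fill (by decide) (by decide) _ _ _ _) z
      simp only [Prog.exec]
      refine ⟨⟨?_, ?_, ?_, ?_, ?_⟩, ?_⟩
      · simp [Config.tick, Config.setNat, NExp.eval, hn, h1, add_assoc]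
      · simp [Config.tick, Config.setNat, hn, h2]
      · simp [Config.tick, Config.setNat, hn, h3]
      · exact ha.trans h4
      · intro q hq j hj k hk
        by_cases hqe : q = a * R + b
        · have := f1 [j, k] (forall₂_two (by rwa [h3]) (by rwa [h3]))
          simp only [List.map_cons, List.map_nil, NExp.eval, h1, List.cons_append,
            List.nil_append] at this
          rw [hqe]
          refine this.trans ?_
          have hd : (a * R + b) / R = a := by
            rw [Nat.add_div_of_dvd_right (Dvd.intro_left a rfl), Nat.mul_div_cancel _ (by omega),
              Nat.div_eq_of_lt hb, add_zero]
          have hm : (a * R + b) % R = b := by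
            rw [add_comm, Nat.add_mul_mod_self_right, Nat.mod_eq_of_lt hb]
          rw [hd, hm]
          simp [SExp.evalAt, hza, hzb, h4]
        · refine (f2 [q, j, k] fun ws _ h => ?_).trans (h5 q (by omega) j hj k hk)
          simp only [List.map_cons, List.map_nil, NExp.eval, h1, List.cons_append,
            List.nil_append, List.cons.injEq] at h
          exact hqe h.1
      · simp [Config.tick, Config.setNat, hn, hza])
    have hv1 : NExp.eval v.nat (.var 1) = R := hvJ.2.1
    rw [hv1] at key2
    rw [Nat.succ_mul]
    exact key2.1)
  have hs1 : NExp.eval s₀.nat (.var 1) = R := rfl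
  rw [hs1] at key
  exact ⟨key.1, key.2.2.2.2⟩

end Exec

end EntangledSubspace

namespace EntangledSubspace

/-! ### The certificate space as the kernel of a Gram matrix. -/

section CertBasis

variable {𝕜 : Type*} [RCLike 𝕜] {ι : Type*} [Fintype ι] [DecidableEq ι] {R p : ℕ}
  {u : Fin R → ι → 𝕜} {f : Fin p → MvPolynomial ι 𝕜}

theorem eq_zero_of_sum_smul_vecMulVec_eq_zero (hu : LinearIndependent 𝕜 u)
    {c : Fin R → Fin R → 𝕜} (h : ∑ a, ∑ b, c a b • vecMulVec (u a) (u b) = 0) : c = 0 := by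
  obtain ⟨K, hK⟩ := exists_dual hu
  funext a b
  have h1 : K a ⬝ᵥ ((∑ a, ∑ b, c a b • vecMulVec (u a) (u b)) *ᵥ K b) = c a b := by
    have h2 : ∀ a b, K a ⬝ᵥ u b = if a = b then 1 else 0 := hK
    have h3 : ∀ a b, u a ⬝ᵥ K b = if b = a then 1 else 0 := fun a b => by rw [dotProduct_comm, h2]
    simp [Matrix.sum_mulVec, smul_mulVec, dotProduct_sum, vecMulVec_mulVec, h2, h3]
  rw [← h1, h]
  simp

/-- The tensors `u a ⊗ u b` are independent, so symmetry of the matrix is symmetry of the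
coefficients. Membership in `S²(U)` thus becomes a linear condition on matrix entries, which the
program can use. -/
theorem mem_symSquare_span_iff_symm (hu : LinearIndependent 𝕜 u) {c : Fin R → Fin R → 𝕜} :
    ∑ a, ∑ b, c a b • vecMulVec (u a) (u b) ∈ symSquare (Submodule.span 𝕜 (Set.range u)) ↔
      (∑ a, ∑ b, c a b • vecMulVec (u a) (u b)).IsSymm := by
  have htr : ∀ c : Fin R → Fin R → 𝕜, (∑ a, ∑ b, c a b • vecMulVec (u a) (u b))ᵀ =
      ∑ a, ∑ b, c b a • vecMulVec (u a) (u b) := by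
    intro c
    simp only [transpose_sum, transpose_smul, transpose_vecMulVec]
    exact Finset.sum_comm
  rw [mem_symSquare_span_iff]
  constructor
  · rintro ⟨d, hd, h⟩
    rw [h, Matrix.IsSymm, htr]
    simp only [hd]
  · intro h
    refine ⟨c, fun a b => ?_, rfl⟩
    rw [Matrix.IsSymm, htr, ← sub_eq_zero, ← Finset.sum_sub_distrib] at h
    simp only [← Finset.sum_sub_distrib, ← sub_smul] at h
    have := congrFun (congrFun (eq_zero_of_sum_smul_vecMulVec_eq_zero hu h) b) a
    exact sub_eq_zero.1 this

/-- Doubling clears the halves in the matrix of a quadric, so the conditions are expressed by the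
monomial coefficients, which are the input. -/
theorem two_mul_sum_quadMatrix (q : MvPolynomial ι 𝕜) (M : Matrix ι ι 𝕜) :
    2 * ∑ j, ∑ k, quadMatrix q j k * M j k =
      ∑ j, ∑ k, quadCoeff q j k * M j k + ∑ j, quadCoeff q j j * M j j := by
  rw [Finset.mul_sum, ← Finset.sum_add_distrib]
  refine Finset.sum_congr rfl fun j _ => ?_
  have : quadCoeff q j j * M j j = ∑ k, if j = k then quadCoeff q j k * M j k else 0 := by simp
  rw [this, Finset.mul_sum, ← Finset.sum_add_distrib]
  refine Finset.sum_congr rfl fun k _ => ?_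
  rw [quadMatrix]
  split_ifs <;> ring

variable {κ : Type*} [Fintype κ] [DecidableEq κ]

open ComplexOrder in
/-- The null vectors of a Gram matrix of the conditions "symmetric" and "annihilated by `f`" give
a basis of the certificate space. -/
theorem exists_basis_certSpace (g : κ ≃ Fin R × Fin R) (hu : LinearIndependent 𝕜 u)
    {W : κ → Matrix ι ι 𝕜} (hW : ∀ q, W q = vecMulVec (u (g q).1) (u (g q).2))
    {F : Fin p → κ → 𝕜} (hF : ∀ i q, F i q =
      ∑ j, ∑ k, quadCoeff (f i) j k * W q j k + ∑ j, quadCoeff (f i) j j * W q j j)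
    {G : Matrix κ κ 𝕜} (hG : ∀ q r, G q r = ∑ i, star (F i q) * F i r +
      ∑ j, ∑ k, star (W q j k - W q k j) * (W r j k - W r k j)) :
    (∃ P l Q, P * Q = 1 ∧ G = P * diagonal l * Q) ∧
    ∀ (P : Matrix κ κ 𝕜) (l : κ → 𝕜) (Q : Matrix κ κ 𝕜), P * Q = 1 → G = P * diagonal l * Q →
      ∀ {s : ℕ} (σ : Fin s ≃ {q // l q = 0}),
      ∃ T : Module.Basis (Fin s) 𝕜 (certSpace u f),
        ∀ i, (T i : Matrix ι ι 𝕜) = ∑ q, P q (σ i) • W q := by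
  -- The rows of `E` are all the conditions on coefficients `c`: annihilation by each quadric and
  -- symmetry of `∑ c q • W q`. As `G = Eᴴ E`, both have the same kernel, and `G` is Hermitian,
  -- hence diagonalizable.
  let E : Matrix (Fin p ⊕ ι × ι) κ 𝕜 :=
    fun x q => Sum.elim (fun i => F i q) (fun jk => W q jk.1 jk.2 - W q jk.2 jk.1) x
  have hGE : G = Eᴴ * E := by
    ext q r
    rw [hG, Matrix.mul_apply, Fintype.sum_sum_type, Fintype.sum_prod_type]
    rfl
  have hsum : ∀ c : κ → 𝕜, ∑ q, c q • W q =
      ∑ a, ∑ b, c (g.symm (a, b)) • vecMulVec (u a) (u b) := by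
    intro c
    rw [← Fintype.sum_prod_type' (f := fun a b => c (g.symm (a, b)) • vecMulVec (u a) (u b)),
      ← g.sum_comp]
    simp [hW]
  have hinj : ∀ c : κ → 𝕜, ∑ q, c q • W q = 0 → c = 0 := by
    intro c hc
    rw [hsum] at hc
    have := eq_zero_of_sum_smul_vecMulVec_eq_zero hu hc
    funext q
    simpa using congrFun (congrFun this (g q).1) (g q).2
  have hker : ∀ c : κ → 𝕜, G *ᵥ c = 0 ↔ ∑ q, c q • W q ∈ certSpace u f := by
    intro c
    rw [hGE, conjTranspose_mul_self_mulVec_eq_zero, certSpace, Submodule.mem_inf]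
    have h1 : ∀ i, (E *ᵥ c) (Sum.inl i) =
        2 * ∑ j, ∑ k, quadMatrix (f i) j k * (∑ q, c q • W q) j k := by
      intro i
      have h2 : (E *ᵥ c) (Sum.inl i) = ∑ q, c q * (2 * ∑ j, ∑ k, quadMatrix (f i) j k * W q j k) := by
        simp only [mulVec, dotProduct, E, Sum.elim_inl, hF, two_mul_sum_quadMatrix]
        exact Finset.sum_congr rfl fun q _ => mul_comm _ _
      rw [h2]
      simp only [Matrix.sum_apply, Matrix.smul_apply, smul_eq_mul, Finset.mul_sum]
      symm
      rw [Finset.sum_comm_cycle]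
      exact Finset.sum_congr rfl fun q _ => Finset.sum_congr rfl fun j _ =>
        Finset.sum_congr rfl fun k _ => by ring
    have h2 : ∀ j k, (E *ᵥ c) (Sum.inr (j, k)) =
        (∑ q, c q • W q) j k - (∑ q, c q • W q) k j := by
      intro j k
      simp only [mulVec, dotProduct, E, Sum.elim_inr, Matrix.sum_apply, Matrix.smul_apply,
        smul_eq_mul, ← Finset.sum_sub_distrib]
      exact Finset.sum_congr rfl fun q _ => by ring
    have h3 : (∑ q, c q • W q) ∈ symSquare (Submodule.span 𝕜 (Set.range u)) ↔
        (∑ q, c q • W q).IsSymm := by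
      rw [hsum]
      exact mem_symSquare_span_iff_symm hu
    rw [h3]
    constructor
    · intro h
      refine ⟨Matrix.IsSymm.ext fun j k => ?_, fun i => ?_⟩
      · have := congrFun h (Sum.inr (k, j))
        rw [h2] at this
        exact sub_eq_zero.1 this
      · have := congrFun h (Sum.inl i)
        rw [h1] at this
        simpa using this
    · rintro ⟨h, h'⟩
      funext x
      rcases x with i | ⟨j, k⟩
      · rw [h1, h' i, mul_zero]; rfl
      · rw [h2, h.apply, sub_self]; rfl
  refine ⟨exists_diagonalization_of_isHermitian (by
    rw [hGE]; exact isHermitian_conjTranspose_mul_self E), fun P l Q hPQ hGP s σ => ?_⟩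
  have hQP : Q * P = 1 := mul_eq_one_comm.1 hPQ
  have hcol : ∀ i, G *ᵥ (fun q => P q (σ i)) = 0 := by
    intro i
    have h1 : (fun q => P q (σ i)) = P *ᵥ Pi.single (σ i : κ) 1 := by
      rw [mulVec_single_one]; rfl
    rw [h1, hGP, mulVec_mulVec, Matrix.mul_assoc _ Q P, hQP, Matrix.mul_one, ← mulVec_mulVec]
    have h2 : diagonal l *ᵥ Pi.single (σ i : κ) 1 = 0 := by
      funext q
      rw [mulVec_diagonal]
      by_cases hq : q = σ i
      · rw [hq, (σ i).2]; simp
      · simp [hq]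
    rw [h2, mulVec_zero]
  let t : Fin s → certSpace u f := fun i => ⟨∑ q, P q (σ i) • W q, (hker _).1 (hcol i)⟩
  have hsumt : ∀ d : Fin s → 𝕜, ∑ i, d i • ∑ q, P q (σ i) • W q =
      ∑ q, (∑ i, d i * P q (σ i)) • W q := by
    intro d
    simp only [Finset.smul_sum, smul_smul, Finset.sum_smul]
    exact Finset.sum_comm
  have hli : LinearIndependent 𝕜 t := by
    rw [Fintype.linearIndependent_iff]
    intro d hd i
    have h1 := congrArg Subtype.val hd
    simp only [Submodule.coe_sum, Submodule.coe_smul, t, ZeroMemClass.coe_zero, hsumt] at h1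
    have h2 := hinj _ h1
    have h3 : ∑ q, Q (σ i) q * ∑ i', d i' * P q (σ i') = d i := by
      simp only [Finset.mul_sum]
      rw [Finset.sum_comm]
      have h4 : ∀ i', ∑ q, Q (σ i) q * (d i' * P q (σ i')) = if i = i' then d i' else 0 := by
        intro i'
        have h5 : ∑ q, Q (σ i) q * P q (σ i') = if i = i' then 1 else 0 := by
          rw [← Matrix.mul_apply, hQP, Matrix.one_apply]
          simp only [Subtype.ext_iff.symm, σ.injective.eq_iff]
        rw [← mul_one (d i'), ← mul_ite_zero, ← h5, Finset.mul_sum]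
        exact Finset.sum_congr rfl fun q _ => by ring
      simp [h4]
    rw [← h3]
    exact Finset.sum_eq_zero fun q _ => by rw [congrFun h2 q, Pi.zero_apply, mul_zero]
  have hspan : ⊤ ≤ Submodule.span 𝕜 (Set.range t) := by
    rintro ⟨M, hM⟩ -
    obtain ⟨c₀, -, hc₀⟩ := mem_symSquare_span_iff.1 hM.1
    set c : κ → 𝕜 := fun q => c₀ (g q).1 (g q).2 with hc
    have hMc : M = ∑ q, c q • W q := by
      rw [hsum, hc₀]
      simp [hc]
    have h1 := (hker c).2 (hMc ▸ hM)
    set y := Q *ᵥ c with hy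
    have hcy : c = P *ᵥ y := by rw [hy, mulVec_mulVec, hPQ, one_mulVec]
    -- The coordinates of a null vector in the eigenbasis vanish at the nonzero eigenvalues, so the
    -- columns for the eigenvalue zero span the kernel.
    have hly : ∀ q, l q * y q = 0 := by
      intro q
      have h2 := congrArg (Q *ᵥ ·) h1
      simp only [mulVec_zero] at h2
      rw [hGP, mulVec_mulVec, ← Matrix.mul_assoc, ← Matrix.mul_assoc, hQP, Matrix.one_mul,
        ← mulVec_mulVec, ← hy] at h2
      rw [← mulVec_diagonal]
      exact congrFun h2 q
    rw [Submodule.mem_span_range_iff_exists_fun]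
    refine ⟨fun i => y (σ i), Subtype.ext ?_⟩
    simp only [Submodule.coe_sum, Submodule.coe_smul, t, hsumt]
    rw [hMc]
    refine Finset.sum_congr rfl fun q _ => ?_
    congr 1
    classical
    rw [σ.sum_comp (fun z : {q // l q = 0} => y z * P q z), congrFun hcy q, mulVec, dotProduct,
      ← Finset.sum_subtype (Finset.univ.filter fun z => l z = 0) (by simp)
        (fun z => y z * P q z), Finset.sum_filter]
    refine Finset.sum_congr rfl fun z _ => ?_
    split_ifs with hz
    · exact mul_comm _ _
    · rw [(mul_eq_zero.1 (hly z)).resolve_left hz, mul_zero]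
  refine ⟨Module.Basis.mk hli hspan, fun i => ?_⟩
  rw [Module.Basis.mk_apply]

end CertBasis

/-- Numbering of the indices with a given property. -/
theorem exists_equiv_filter_range (N : ℕ) (q : ℕ → Bool) :
    ∃ σ : Fin ((List.range N).filter q).length ≃ {i : Fin N // q i = true},
      ∀ a, ((σ a : Fin N) : ℕ) = ((List.range N).filter q)[a] := by
  have hmem : ∀ a : Fin ((List.range N).filter q).length,
      ((List.range N).filter q)[a] < N ∧ q ((List.range N).filter q)[a] = true := fun a => by
    have := List.getElem_mem (l := (List.range N).filter q) a.2
    rwa [List.mem_filter, List.mem_range] at this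
  refine ⟨Equiv.ofBijective (fun a => ⟨⟨_, (hmem a).1⟩, (hmem a).2⟩) ⟨fun a b h => ?_, ?_⟩,
    fun a => rfl⟩
  · have h1 : ((List.range N).filter q)[a] = ((List.range N).filter q)[b] := by
      simpa using h
    exact Fin.ext ((List.nodup_range.filter _).getElem_inj_iff.1 h1)
  · rintro ⟨i, hi⟩
    have h1 : (i : ℕ) ∈ (List.range N).filter q := by
      rw [List.mem_filter, List.mem_range]; exact ⟨i.2, hi⟩
    obtain ⟨a, ha, h2⟩ := List.getElem_of_mem h1
    exact ⟨⟨a, ha⟩, by simp [h2]⟩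

theorem sum_range_equiv {𝕜 ι : Type*} [AddCommMonoid 𝕜] [Fintype ι] {N : ℕ} (e : ι ≃ Fin N)
    (g : ℕ → 𝕜) : ∑ x ∈ Finset.range N, g x = ∑ j, g (e j) := by
  rw [Finset.sum_range, ← e.sum_comp]

section Exec

variable {𝕜 : Type*} [RCLike 𝕜] (O : DiagOracle 𝕜)

/-- The oracle works on `Fin N`; its answer is transported along `e`. The matrices `P`, `d`, `Q` are
always defined, but they form a diagonalization only if the input is diagonalizable, whence the
implication at the end. -/
theorem exec_diagonalize {ι : Type*} [Fintype ι] [DecidableEq ι] {N : ℕ} (e : ι ≃ Fin N)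
    {x a v l w : ℕ} (hvl : v ≠ l) (hvw : v ≠ w) (hlw : l ≠ w) (s : Config 𝕜) (hx : s.nat x = N)
    {M : Matrix ι ι 𝕜} (hM : ∀ j k, s.arr a [e j, e k] = M j k) :
    ∃ (P : Matrix ι ι 𝕜) (d : ι → 𝕜) (Q : Matrix ι ι 𝕜),
      (∀ j k, ((Prog.diagonalize (.var x) a v l w).exec O s).arr v [e j, e k] = P j k) ∧
      (∀ j, ((Prog.diagonalize (.var x) a v l w).exec O s).arr l [e j] = d j) ∧
      (∀ j k, ((Prog.diagonalize (.var x) a v l w).exec O s).arr w [e j, e k] = Q j k) ∧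
      ((∃ (P : Matrix ι ι 𝕜) (d : ι → 𝕜) (Q : Matrix ι ι 𝕜), P * Q = 1 ∧ M = P * diagonal d * Q) →
        P * Q = 1 ∧ M = P * diagonal d * Q) := by
  subst hx
  have hM' : s.readMatrix (s.nat x) a = M.submatrix e.symm e.symm := by
    ext j k
    rw [submatrix_apply, ← hM, e.apply_symm_apply, e.apply_symm_apply]
    rfl
  have htr : ∀ (A P : Matrix ι ι 𝕜) (d : ι → 𝕜) (Q : Matrix ι ι 𝕜),
      Diagonalizes (A.submatrix e.symm e.symm) (P.submatrix e.symm e.symm) (d ∘ e.symm)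
        (Q.submatrix e.symm e.symm) ↔ P * Q = 1 ∧ A = P * diagonal d * Q := by
    intro A P d Q
    rw [Diagonalizes, ← submatrix_diagonal_equiv, submatrix_mul_equiv, submatrix_mul_equiv,
      submatrix_mul_equiv]
    have hinj : ∀ B C : Matrix ι ι 𝕜,
        B.submatrix e.symm e.symm = C.submatrix e.symm e.symm ↔ B = C := by
      intro B C
      exact (Matrix.reindex e e).injective.eq_iff
    rw [hinj, ← submatrix_one_equiv e.symm, hinj]
  refine ⟨(O.vectors _ (s.readMatrix (s.nat x) a)).submatrix e e,
    O.values _ (s.readMatrix (s.nat x) a) ∘ e,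
    (O.inverse _ (s.readMatrix (s.nat x) a)).submatrix e e, ?_, ?_, ?_, ?_⟩
  · intro j k
    simp [Prog.exec, Config.writeMatrix, Config.writeVector, Config.tick, NExp.eval,
      Function.update_of_ne hvl, Function.update_of_ne hvw]
  · intro j
    simp [Prog.exec, Config.writeMatrix, Config.writeVector, Config.tick, NExp.eval,
      Function.update_of_ne hlw]
  · intro j k
    simp [Prog.exec, Config.writeMatrix, Config.writeVector, Config.tick, NExp.eval]
  · rintro ⟨P, d, Q, h⟩
    have h1 := O.spec _ _ ⟨_, _, _, (htr M P d Q).2 h⟩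
    rw [← hM'] at h1
    rw [← htr, ← hM']
    simpa [Function.comp_assoc, submatrix_submatrix] using h1

end Exec

end EntangledSubspace

namespace EntangledSubspace

/-! ### Correctness of the stages of the program. -/

section Exec

variable {𝕜 : Type*} [RCLike 𝕜] (O : DiagOracle 𝕜) {ι : Type*} [Fintype ι] [DecidableEq ι]
  {N R p r : ℕ} (e : ι ≃ Fin N)

open CertProg

theorem forall_lt_equiv {q : ℕ → Prop} : (∀ a < N, q a) ↔ ∀ j, q (e j) :=
  ⟨fun h j => h _ (e j).2, fun h a ha => by simpa using h (e.symm ⟨a, ha⟩)⟩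

theorem forall_forall₂_cons {ν : ℕ → ℕ} {x : ℕ} {xs : List ℕ} {q : List ℕ → Prop} :
    (∀ ws, List.Forall₂ (fun w x => w < ν x) ws (x :: xs) → q ws) ↔
      ∀ a < ν x, ∀ ws, List.Forall₂ (fun w x => w < ν x) ws xs → q (a :: ws) := by
  constructor
  · exact fun h a ha ws hws => h _ (.cons ha hws)
  · rintro h ws hws
    cases hws with
    | cons h1 h2 => exact h _ h1 _ h2

theorem exec_basis {u : Fin R → ι → 𝕜} (hu : LinearIndependent 𝕜 u)
    (f : Fin p → MvPolynomial ι 𝕜) (s : Config 𝕜) (h0 : s.nat 0 = N) (h1 : s.nat 1 = R)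
    (h2 : s.nat 2 = p) (ha0 : ∀ (a : Fin R) j, s.arr 0 [a, e j] = u a j)
    (ha1 : ∀ (i : Fin p) j k, s.arr 1 [i, e j, e k] = quadCoeff (f i) j k) :
    ∃ T : Module.Basis (Fin ((basis.exec O s).nat 6)) 𝕜 (certSpace u f),
      ∀ (i : Fin ((basis.exec O s).nat 6)) j k,
        (basis.exec O s).arr 12 [i, e j, e k] = (T i : Matrix ι ι 𝕜) j k := by
  classical
  let W : Fin (R * R) → Matrix ι ι 𝕜 := fun q =>
    vecMulVec (u (finProdFinEquiv.symm q).1) (u (finProdFinEquiv.symm q).2)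
  let F : Fin p → Fin (R * R) → 𝕜 := fun i q =>
    ∑ j, ∑ k, quadCoeff (f i) j k * W q j k + ∑ j, quadCoeff (f i) j j * W q j j
  let G : Matrix (Fin (R * R)) (Fin (R * R)) 𝕜 := fun q r => ∑ i, star (F i q) * F i r +
    ∑ j, ∑ k, star (W q j k - W q k j) * (W r j k - W r k j)
  obtain ⟨hdiag, hbasis⟩ := exists_basis_certSpace (f := f) (F := F) (G := G)
    finProdFinEquiv.symm hu (fun q => rfl) (fun i q => rfl) (fun q r => rfl)
  -- the four stages
  set s₁ := squares.exec O s with hs₁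
  obtain ⟨n5, m6⟩ := exec_squares O s
  rw [← hs₁, h1] at n5
  have n0 : s₁.nat 0 = N := (exec_nat_eq O (x := 0) (c := squares) rfl s).trans h0
  have n2 : s₁.nat 2 = p := (exec_nat_eq O (x := 2) (c := squares) rfl s).trans h2
  have m1 : s₁.arr 1 = s.arr 1 := exec_arr_eq O (t := 1) (c := squares) rfl s
  have m6' : ∀ (q : Fin (R * R)) j k, s₁.arr 6 [q, e j, e k] = W q j k := by
    intro q j k
    rw [hs₁, m6 q (by rw [h1]; exact q.2) _ (by rw [h0]; exact (e j).2) _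
      (by rw [h0]; exact (e k).2), h1]
    exact congrArg₂ (· * ·) (ha0 (finProdFinEquiv.symm q).1 j) (ha0 (finProdFinEquiv.symm q).2 k)
  set s₂ := (fill 7 values 10 [2, 5] []).exec O s₁ with hs₂
  have hn2 : ∀ x < 10, s₂.nat x = s₁.nat x := fun x hx => exec_nat_eq O (keepsNat_fill hx _ _ _) _
  have m7 : ∀ (i : Fin p) (q : Fin (R * R)), s₂.arr 7 [i, q] = F i q := by
    intro i q
    rw [hs₂, exec_values O s₁ (by rw [n2]; exact i.2) (by rw [n5]; exact q.2), n0]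
    simp only [sum_range_equiv e, m6', m1, ha1]
    rfl
  have m6₂ : s₂.arr 6 = s₁.arr 6 := exec_arr_eq O (keepsArr_fill (by decide) (by decide) _ _ _ _) _
  set s₃ := (fill 8 gramian 10 [5, 5] []).exec O s₂ with hs₃
  have hn3 : ∀ x < 10, s₃.nat x = s₁.nat x := fun x hx =>
    (exec_nat_eq O (keepsNat_fill hx _ _ _) _).trans (hn2 x hx)
  have m6₃ : s₃.arr 6 = s₁.arr 6 :=
    (exec_arr_eq O (keepsArr_fill (by decide) (by decide) _ _ _ _) _).trans m6₂
  have m8 : ∀ q r : Fin (R * R), s₃.arr 8 [q, r] = G q r := by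
    intro q r
    rw [hs₃, exec_gramian O s₂ (by rw [hn2 5 (by omega), n5]; exact q.2)
      (by rw [hn2 5 (by omega), n5]; exact r.2), hn2 0 (by omega), hn2 2 (by omega), n0, n2]
    simp only [sum_range_equiv e, sum_range_equiv (Equiv.refl (Fin p)), Equiv.refl_apply, m6₂, m6',
      m7]
    rfl
  obtain ⟨P, l, Q, hP, hl, -, hspec⟩ := exec_diagonalize O (Equiv.refl (Fin (R * R))) (x := 5)
    (a := 8) (v := 9) (l := 10) (w := 11) (by decide) (by decide) (by decide) s₃
    ((hn3 5 (by omega)).trans n5) (M := G) m8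
  obtain ⟨hPQ, hGP⟩ := hspec hdiag
  simp only [Equiv.refl_apply] at hP hl
  set s₄ := (Prog.diagonalize (.var 5) 8 9 10 11).exec O s₃ with hs₄
  have hn4 : ∀ x < 10, s₄.nat x = s₁.nat x := hn3
  have m6₄ : s₄.arr 6 = s₁.arr 6 := (exec_arr_eq O (by decide) s₃).trans m6₃
  obtain ⟨c1, c2⟩ := exec_collect O (r := 6) (x := 5) (k := 10) (test := .at' 10 [10])
    (body := fill 12 lift 11 [0, 0] [.var 6]) (by decide) (by decide) rfl rfl
    (keepsNat_fill (by decide) _ _ _) (fun y hy => keepsNat_fill (by omega) _ _ _)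
    (by
      intro t ht
      have h : (10 != t) = false := ht
      obtain rfl : 10 = t := by simpa using h
      rfl) s₄
    (by
      intro arr ν ν' h
      simp [h 10 (by omega) (by omega)])
    (fun arr a i => ∀ j < N, ∀ k < N, arr 12 [a, j, k] =
      ∑ q ∈ Finset.range (R * R), s₄.arr 9 [q, i] * s₄.arr 6 [q, j, k])
    (by
      intro arr arr' a i h hrow j hj k hk
      rw [← h 12 (by decide)]
      exact hrow j hj k hk)
    (by
      intro w hwa hwn
      have w0 : w.nat 0 = N := ((hwn 0 (by omega) (by omega)).trans (hn4 0 (by omega))).trans n0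
      have w5 : w.nat 5 = R * R := ((hwn 5 (by omega) (by omega)).trans (hn4 5 (by omega))).trans n5
      have w9 : w.arr 9 = s₄.arr 9 := hwa 9 (by decide) rfl
      have w6 : w.arr 6 = s₄.arr 6 := hwa 6 (by decide) rfl
      obtain ⟨f1, f2⟩ := exec_fill O (t := 12) (e := lift) (k := 11) (xs := [0, 0])
        (pre := [.var 6]) (by decide) rfl rfl rfl (by decide) rfl w
      refine ⟨fun j hj k hk => ?_, fun a i ha hrow j hj k hk => ?_⟩
      · refine (f1 [j, k] (forall₂_two (by rwa [w0]) (by rwa [w0]))).trans ?_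
        simp [SExp.evalAt, lift, SExp.eval, w5, w9, w6]
      · refine (f2 [a, j, k] fun ws _ h => ?_).trans (hrow j hj k hk)
        exact absurd (List.cons.inj h).1 ha.ne)
  have hrun : basis.exec O s = (collect 6 5 10 (.at' 10 [10])
    (fill 12 lift 11 [0, 0] [.var 6])).exec O s₄ := rfl
  rw [hn4 5 (by omega), n5] at c1 c2
  set q : ℕ → Bool := fun i => decide ((SExp.at' 10 [10]).eval s₄.arr (10 + 1)
    (Function.update s₄.nat 10 i) = 0) with hq
  obtain ⟨σ, hσ⟩ := exists_equiv_filter_range (R * R) q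
  have hq' : ∀ i : Fin (R * R), q i = true ↔ l i = 0 := by
    intro i
    simp [hq, hl]
  obtain ⟨T, hT⟩ := hbasis P l Q hPQ hGP (σ.trans (Equiv.subtypeEquivRight hq'))
  rw [hrun, c1]
  refine ⟨T, fun i j k => ?_⟩
  have hσi : ((List.range (R * R)).filter q)[(i : ℕ)] = ((σ i : Fin (R * R)) : ℕ) := (hσ i).symm
  rw [c2 i i.2 _ (e j).2 _ (e k).2, hT, sum_range_equiv (Equiv.refl (Fin (R * R))), hσi,
    Matrix.sum_apply]
  simp only [Equiv.refl_apply, hP, m6₄, m6', Matrix.smul_apply, smul_eq_mul]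
  rfl

/-- The first oracle call concerns the Hermitian matrix `T(γ)ᴴ T(γ)`, so its answer, and with it the
pseudoinverse, is unconditionally right. The second concerns `T(φ) T(γ)⁺`, about which nothing is
known in advance. -/
theorem exec_diagonalization (T : Fin r → Matrix ι ι 𝕜) (φ γ : Fin r → 𝕜) (s : Config 𝕜)
    (h0 : s.nat 0 = N) (h6 : s.nat 6 = r)
    (hT : ∀ (i : Fin r) j k, s.arr 12 [i, e j, e k] = T i j k)
    (hφ : ∀ i : Fin r, s.arr 2 [i] = φ i) (hγ : ∀ i : Fin r, s.arr 3 [i] = γ i) :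
    ∃ (Y P : Matrix ι ι 𝕜) (d : ι → 𝕜) (Q : Matrix ι ι 𝕜), IsPseudoinverse (contract T γ) Y ∧
      (∀ j k, (diagonalization.exec O s).arr 20 [e j, e k] = (contract T φ * Y) j k) ∧
      (∀ j k, (diagonalization.exec O s).arr 21 [e j, e k] = P j k) ∧
      (∀ j, (diagonalization.exec O s).arr 22 [e j] = d j) ∧
      (∀ j k, (diagonalization.exec O s).arr 23 [e j, e k] = Q j k) ∧
      ((∃ (P : Matrix ι ι 𝕜) (d : ι → 𝕜) (Q : Matrix ι ι 𝕜),
        P * Q = 1 ∧ contract T φ * Y = P * diagonal d * Q) →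
        P * Q = 1 ∧ contract T φ * Y = P * diagonal d * Q) := by
  have hlt : ∀ {t : Config 𝕜}, t.nat 0 = N → ∀ j, (e j : ℕ) < t.nat 0 := fun h j => by
    rw [h]; exact (e j).2
  set s₁ := (fill 13 (contraction 2) 10 [0, 0] []).exec O s with hs₁
  have n1 : s₁.nat 0 = N := (exec_nat_eq O (keepsNat_fill (by decide) _ _ _) _).trans h0
  have n1' : s₁.nat 6 = r := (exec_nat_eq O (keepsNat_fill (by decide) _ _ _) _).trans h6
  have f1 : ∀ t, t ≠ 30 → t ≠ 13 → s₁.arr t = s.arr t := fun t h h' =>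
    exec_arr_eq O (keepsArr_fill h h' _ _ _ _) _
  have m13 : ∀ j k, s₁.arr 13 [e j, e k] = contract T φ j k := by
    intro j k
    rw [hs₁, exec_contraction O s 2 (.inl rfl) (.inl rfl) (hlt h0 j) (hlt h0 k), h6,
      sum_range_equiv (Equiv.refl (Fin r))]
    simp [contract, Matrix.sum_apply, hT, hφ]
  set s₂ := (fill 14 (contraction 3) 10 [0, 0] []).exec O s₁ with hs₂
  have n2 : s₂.nat 0 = N := (exec_nat_eq O (keepsNat_fill (by decide) _ _ _) _).trans n1
  have f2 : ∀ t, t ≠ 30 → t ≠ 14 → s₂.arr t = s₁.arr t := fun t h h' =>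
    exec_arr_eq O (keepsArr_fill h h' _ _ _ _) _
  have m14 : ∀ j k, s₂.arr 14 [e j, e k] = contract T γ j k := by
    intro j k
    rw [hs₂, exec_contraction O s₁ 3 (.inr rfl) (.inr rfl) (hlt n1 j) (hlt n1 k), n1',
      sum_range_equiv (Equiv.refl (Fin r)), f1 3 (by decide) (by decide),
      f1 12 (by decide) (by decide)]
    simp [contract, Matrix.sum_apply, hT, hγ]
  set s₃ := (fill 15 normal 10 [0, 0] []).exec O s₂ with hs₃
  have n3 : s₃.nat 0 = N := (exec_nat_eq O (keepsNat_fill (by decide) _ _ _) _).trans n2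
  have f3 : ∀ t, t ≠ 30 → t ≠ 15 → s₃.arr t = s₂.arr t := fun t h h' =>
    exec_arr_eq O (keepsArr_fill h h' _ _ _ _) _
  have m15 : ∀ j k, s₃.arr 15 [e j, e k] = ((contract T γ)ᴴ * contract T γ) j k := by
    intro j k
    rw [hs₃, exec_normal O s₂ (hlt n2 j) (hlt n2 k), n2, sum_range_equiv e]
    simp [Matrix.mul_apply, m14]
  obtain ⟨P₁, l₁, Q₁, hP₁, hl₁, hQ₁, hspec₁⟩ := exec_diagonalize O e (x := 0) (a := 15) (v := 16)
    (l := 17) (w := 18) (by decide) (by decide) (by decide) s₃ n3 m15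
  obtain ⟨hPQ₁, hH⟩ := hspec₁ (exists_diagonalization_of_isHermitian
    (isHermitian_conjTranspose_mul_self _))
  have hY := isPseudoinverse_of_diagonalization hPQ₁ hH
  set Y := P₁ * diagonal (fun i => (l₁ i)⁻¹) * Q₁ * (contract T γ)ᴴ with hYdef
  set s₄ := (Prog.diagonalize (.var 0) 15 16 17 18).exec O s₃ with hs₄
  have n4 : s₄.nat 0 = N := n3
  have m13₄ : s₄.arr 13 = s₁.arr 13 := (exec_arr_eq O (by decide) s₃).trans
    ((f3 13 (by decide) (by decide)).trans (f2 13 (by decide) (by decide)))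
  have m14₄ : s₄.arr 14 = s₂.arr 14 := (exec_arr_eq O (by decide) s₃).trans
    (f3 14 (by decide) (by decide))
  set s₅ := (fill 19 pseudoinverse 10 [0, 0] []).exec O s₄ with hs₅
  have n5 : s₅.nat 0 = N := (exec_nat_eq O (keepsNat_fill (by decide) _ _ _) _).trans n4
  have m13₅ : s₅.arr 13 = s₁.arr 13 :=
    (exec_arr_eq O (keepsArr_fill (by decide) (by decide) _ _ _ _) _).trans m13₄
  have m19 : ∀ j k, s₅.arr 19 [e j, e k] = Y j k := by
    intro j k
    rw [hs₅, exec_pseudoinverse O s₄ (hlt n4 j) (hlt n4 k), n4]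
    simp only [sum_range_equiv e, hP₁, hl₁, hQ₁, m14₄, m14]
    have h : ∀ y, (P₁ * diagonal (fun i => (l₁ i)⁻¹) * Q₁) j y =
        ∑ x, P₁ j x * (l₁ x)⁻¹ * Q₁ x y := fun y => by
      rw [Matrix.mul_apply]
      simp only [Matrix.mul_diagonal]
    rw [hYdef, Matrix.mul_apply]
    simp only [h, conjTranspose_apply, Finset.sum_mul]
    exact Finset.sum_comm
  set s₆ := (fill 20 quotient 10 [0, 0] []).exec O s₅ with hs₆
  have n6 : s₆.nat 0 = N := (exec_nat_eq O (keepsNat_fill (by decide) _ _ _) _).trans n5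
  have m20 : ∀ j k, s₆.arr 20 [e j, e k] = (contract T φ * Y) j k := by
    intro j k
    rw [hs₆, exec_quotient O s₅ (hlt n5 j) (hlt n5 k), n5]
    simp only [sum_range_equiv e, m13₅, m13, m19, Matrix.mul_apply]
  obtain ⟨P, d, Q, hP, hd, hQ, hspec⟩ := exec_diagonalize O e (x := 0) (a := 20) (v := 21)
    (l := 22) (w := 23) (by decide) (by decide) (by decide) s₆ n6 m20
  have hrun : diagonalization.exec O s = (Prog.diagonalize (.var 0) 20 21 22 23).exec O s₆ := rfl
  rw [hrun]
  refine ⟨Y, P, d, Q, hY, fun j k => ?_, hP, hd, hQ, hspec⟩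
  rw [exec_arr_eq O (by decide) s₆]
  exact m20 j k

/-- The conditions on the eigenvectors that the program tests. -/
def IsCertified (T : Fin r → Matrix ι ι 𝕜) (M P : Matrix ι ι 𝕜) (d : ι → 𝕜)
    (Q : Matrix ι ι 𝕜) : Prop :=
  (∀ i j, d i * (∑ x, M j x * P x i - d i * P j i) = 0) ∧
  (∀ i, d i * (∑ j, (1 - (d i - d j) * (d i - d j)⁻¹) - 1) = 0) ∧
  ∀ k j j', T k j j' - ∑ i, d i * (d i)⁻¹ *
    ((∑ x, ∑ y, Q i x * T k x y * Q i y) * (P j i * P j' i)) = 0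

theorem exec_select (P : Matrix ι ι 𝕜) (d : ι → 𝕜) (s : Config 𝕜) (h0 : s.nat 0 = N)
    (hP : ∀ j k, s.arr 21 [e j, e k] = P j k) (hd : ∀ j, s.arr 22 [e j] = d j) :
    (select.exec O s).nat 4 = Nat.card {i // d i ≠ 0} ∧
      ∃ σ : Fin (Nat.card {i // d i ≠ 0}) ≃ {i // d i ≠ 0},
        ∀ (a : Fin (Nat.card {i // d i ≠ 0})) j, (select.exec O s).arr 4 [a, e j] = P j (σ a) := by
  classical
  obtain ⟨k1, k2⟩ := exec_collect O (r := 4) (x := 0) (k := 10) (test := .sub .one (nonzero 10))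
    (body := fill 4 (.at' 21 [11, 10]) 11 [0] [.var 4]) (by decide) (by decide) rfl rfl
    (keepsNat_fill (by decide) _ _ _) (fun y hy => keepsNat_fill (by omega) _ _ _)
    (by
      intro t ht
      have h : (true && ((22 != t) && (22 != t))) = false := ht
      obtain rfl : 22 = t := by simpa using h
      rfl) s
    (by
      intro arr ν ν' h
      simp [nonzero, SExp.eval, h 10 (by omega) (by omega)])
    (fun arr a i => ∀ j < N, arr 4 [a, j] = s.arr 21 [j, i])
    (by
      intro arr arr' a i h hrow j hj
      rw [← h 4 (by decide)]
      exact hrow j hj)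
    (by
      intro w hwa hwn
      have w0 : w.nat 0 = N := (hwn 0 (by omega) (by omega)).trans h0
      have w21 : w.arr 21 = s.arr 21 := hwa 21 (by decide) rfl
      obtain ⟨f1, f2⟩ := exec_fill O (t := 4) (e := .at' 21 [11, 10]) (k := 11) (xs := [0])
        (pre := [.var 4]) (by decide) rfl rfl rfl (by decide) rfl w
      refine ⟨fun j hj => ?_, fun a i ha hrow j hj => ?_⟩
      · refine (f1 [j] (.cons (by rwa [w0]) .nil)).trans ?_
        simp [SExp.evalAt, w21]
      · refine (f2 [a, j] fun ws _ h => ?_).trans (hrow j hj)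
        exact absurd (List.cons.inj h).1 ha.ne)
  have hrun : select.exec O s = (collect 4 0 10 (.sub .one (nonzero 10))
    (fill 4 (.at' 21 [11, 10]) 11 [0] [.var 4])).exec O s := rfl
  rw [h0, ← hrun] at k1 k2
  set q : ℕ → Bool := fun i => decide (SExp.eval s.arr (.sub .one (nonzero 10)) (10 + 1)
    (Function.update s.nat 10 i) = 0) with hq
  obtain ⟨σ, hσ⟩ := exists_equiv_filter_range N q
  have hq' : ∀ i : ι, d i ≠ 0 ↔ q (e i) = true := by
    intro i
    by_cases hi : d i = 0
    · simp [hq, nonzero, SExp.eval, hd, hi]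
    · simp [hq, nonzero, SExp.eval, hd, hi]
  let τ := σ.trans (e.subtypeEquiv hq').symm
  have hcard : ((List.range N).filter q).length = Nat.card {i // d i ≠ 0} := by
    rw [← Nat.card_congr τ, Nat.card_fin]
  refine ⟨k1.trans hcard, (finCongr hcard.symm).trans τ, fun a j => ?_⟩
  have hτ : ((List.range N).filter q)[(finCongr hcard.symm a : ℕ)] =
      (e (τ (finCongr hcard.symm a)) : ℕ) := by
    rw [← Fin.getElem_fin, ← hσ]
    simp [τ]
  refine (k2 a (by rw [hcard]; exact a.2) _ (e j).2).trans (Eq.trans ?_ (hP _ _))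
  exact congrArg (fun x => s.arr 21 [_, x]) hτ

theorem exec_certify (T : Fin r → Matrix ι ι 𝕜) (M P : Matrix ι ι 𝕜) (d : ι → 𝕜)
    (Q : Matrix ι ι 𝕜) (s : Config 𝕜) (h0 : s.nat 0 = N) (h6 : s.nat 6 = r)
    (hT : ∀ (i : Fin r) j k, s.arr 12 [i, e j, e k] = T i j k)
    (hM : ∀ j k, s.arr 20 [e j, e k] = M j k) (hP : ∀ j k, s.arr 21 [e j, e k] = P j k)
    (hd : ∀ j, s.arr 22 [e j] = d j) (hQ : ∀ j k, s.arr 23 [e j, e k] = Q j k)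
    (h27 : s.arr 27 [] = 0) :
    (certify.exec O s).arr 27 [] = 0 ↔ IsCertified T M P d Q := by
  set s₂ := (check 27 eigenTest 10 [0, 0]).exec O s with hs₂
  have f2 : ∀ t, t ≠ 30 → t ≠ 27 → s₂.arr t = s.arr t := fun t h h' =>
    exec_arr_eq O (keepsArr_check h h' _ _ _) _
  have n2 : ∀ x < 10, s₂.nat x = s.nat x := fun x h => exec_nat_eq O (keepsNat_check h _ _) _
  set s₃ := (check 27 simpleTest 10 [0]).exec O s₂ with hs₃
  have f3 : ∀ t, t ≠ 30 → t ≠ 27 → s₃.arr t = s.arr t := fun t h h' =>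
    (exec_arr_eq O (keepsArr_check h h' _ _ _) _).trans (f2 t h h')
  have n3 : ∀ x < 10, s₃.nat x = s.nat x := fun x h =>
    (exec_nat_eq O (keepsNat_check h _ _) _).trans (n2 x h)
  have hrun : certify.exec O s = (check 27 squareTest 10 [6, 0, 0]).exec O s₃ := rfl
  have e1 := exec_check O (t := 27) (e := squareTest) (k := 10) (xs := [6, 0, 0]) (by decide) rfl
    rfl rfl (by decide) s₃
  have e2 := exec_check O (t := 27) (e := simpleTest) (k := 10) (xs := [0]) (by decide) rfl
    rfl rfl (by decide) s₂
  have e3 := exec_check O (t := 27) (e := eigenTest) (k := 10) (xs := [0, 0]) (by decide) rfl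
    rfl rfl (by decide) s
  rw [← hs₃] at e2
  rw [← hs₂] at e3
  rw [hrun, e1, e2, e3, IsCertified]
  simp only [forall_forall₂_cons, List.forall₂_nil_right_iff, forall_eq, h27, true_and, h0,
    n2 0 (by omega), n3 0 (by omega), n3 6 (by omega), h6, forall_lt_equiv e,
    forall_lt_equiv (Equiv.refl (Fin r)), Equiv.refl_apply, and_assoc]
  clear_value s₂ s₃
  refine and_congr ?_ (and_congr ?_ ?_)
  · refine forall_congr' fun i => forall_congr' fun j => ?_
    simp [SExp.evalAt, eigenTest, SExp.eval, h0, sum_range_equiv e, hM, hP, hd]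
  · refine forall_congr' fun i => ?_
    simp [SExp.evalAt, simpleTest, SExp.eval, n2, h0, sum_range_equiv e, f2, hd]
  · refine forall_congr' fun k => forall_congr' fun j => forall_congr' fun j' => ?_
    simp [SExp.evalAt, squareTest, weight, nonzero, SExp.eval, n3, h0, sum_range_equiv e, f3,
      hd, hT, hQ, hP]

open Classical in
theorem exec_verdict (s : Config 𝕜) :
    (verdict.exec O s).nat 3 = if s.nat 4 = s.nat 6 ∧ s.arr 27 [] = 0 then 1 else 2 := by
  have hread : ((s.tick 1).tick 1).read ⟨27, []⟩ = s.arr 27 [] := rfl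
  have hnat : (s.tick 1).nat = s.nat := rfl
  simp only [verdict, Prog.exec, NExp.eval, hread, hnat]
  rcases lt_trichotomy (s.nat 4) (s.nat 6) with h | h | h
  · rw [if_pos h, if_neg (by omega)]
    simp [Config.tick, Config.setNat]
  · rw [if_neg (by omega), if_neg (by omega)]
    by_cases h0 : s.arr 27 [] = 0
    · rw [if_pos h0, if_pos ⟨h, h0⟩]
      simp [Config.tick, Config.setNat]
    · rw [if_neg h0, if_neg (by tauto)]
      simp [Config.tick, Config.setNat]
  · rw [if_neg (by omega), if_pos h, if_neg (by omega)]
    simp [Config.tick, Config.setNat]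

/-- Selection happens before the tests, so the vectors are in place in any case. The verdict
compares their number with the dimension of the certificate space and reads the flag. -/
theorem exec_answer (T : Fin r → Matrix ι ι 𝕜) (M P : Matrix ι ι 𝕜) (d : ι → 𝕜)
    (Q : Matrix ι ι 𝕜) (s : Config 𝕜) (h0 : s.nat 0 = N) (h6 : s.nat 6 = r)
    (hT : ∀ (i : Fin r) j k, s.arr 12 [i, e j, e k] = T i j k)
    (hM : ∀ j k, s.arr 20 [e j, e k] = M j k) (hP : ∀ j k, s.arr 21 [e j, e k] = P j k)
    (hd : ∀ j, s.arr 22 [e j] = d j) (hQ : ∀ j k, s.arr 23 [e j, e k] = Q j k)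
    (h27 : s.arr 27 [] = 0) :
    ((answer.exec O s).nat 3 = 1 ∧ (answer.exec O s).nat 4 = r ∧ IsCertified T M P d Q ∧
      ∃ σ : Fin r ≃ {i // d i ≠ 0}, ∀ (a : Fin r) j, (answer.exec O s).arr 4 [a, e j] = P j (σ a)) ∨
    ((answer.exec O s).nat 3 = 2 ∧
      ¬ (IsCertified T M P d Q ∧ Nat.card {i // d i ≠ 0} = r)) := by
  classical
  obtain ⟨k1, σ, hσ⟩ := exec_select O e P d s h0 hP hd
  set s₁ := select.exec O s with hs₁
  have f1 : ∀ t, t ≠ 30 → t ≠ 4 → s₁.arr t = s.arr t := fun t h h' => exec_arr_eq O (by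
    simp [select, collect, Prog.keepsArr, SExp.keepsArr_compile _ _ _ h, keepsArr_fill h h']) s
  have m0 : s₁.nat 0 = N := (exec_nat_eq O (x := 0) (c := select) rfl s).trans h0
  have m6 : s₁.nat 6 = r := (exec_nat_eq O (x := 6) (c := select) rfl s).trans h6
  have hcert := exec_certify O e T M P d Q s₁ m0 m6
    (by rwa [f1 12 (by decide) (by decide)]) (by rwa [f1 20 (by decide) (by decide)])
    (by rwa [f1 21 (by decide) (by decide)]) (by rwa [f1 22 (by decide) (by decide)])
    (by rwa [f1 23 (by decide) (by decide)]) (by rwa [f1 27 (by decide) (by decide)])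
  set s₂ := certify.exec O s₁ with hs₂
  have n4 : s₂.nat 4 = Nat.card {i // d i ≠ 0} :=
    (exec_nat_eq O (x := 4) (c := certify) rfl s₁).trans k1
  have n6 : s₂.nat 6 = r := (exec_nat_eq O (x := 6) (c := certify) rfl s₁).trans m6
  have f4 : s₂.arr 4 = s₁.arr 4 := exec_arr_eq O (t := 4) (c := certify) rfl s₁
  have hrun : answer.exec O s = verdict.exec O s₂ := rfl
  have hv := exec_verdict O s₂
  rw [← hrun, n4, n6] at hv
  simp only [hcert] at hv
  by_cases h : Nat.card {i // d i ≠ 0} = r ∧ IsCertified T M P d Q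
  · left
    rw [if_pos h] at hv
    obtain ⟨hr, hc⟩ := h
    subst hr
    refine ⟨hv, ?_, hc, σ, fun a j => ?_⟩
    · rw [hrun, exec_nat_eq O (x := 4) (c := verdict) rfl s₂, n4]
    · rw [hrun, exec_arr_eq O (t := 4) (c := verdict) rfl s₂, f4, hσ]
  · right
    rw [if_neg h] at hv
    exact ⟨hv, fun h' => h ⟨h'.2, h'.1⟩⟩

end Exec

end EntangledSubspace

namespace EntangledSubspace

/-! ### Soundness and completeness of the tests on eigenvectors. -/

section Certified

variable {𝕜 : Type*} [RCLike 𝕜] {ι : Type*} [Fintype ι] [DecidableEq ι] {r : ℕ}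
  {T : Fin r → Matrix ι ι 𝕜} {M P Q : Matrix ι ι 𝕜} {d : ι → 𝕜}

theorem sum_mul_inv_mul_eq_sum_subtype [DecidablePred fun i => d i ≠ 0] (g : ι → 𝕜) :
    ∑ i, d i * (d i)⁻¹ * g i = ∑ i : {i // d i ≠ 0}, g i := by
  rw [← Finset.sum_subtype (Finset.univ.filter fun i => d i ≠ 0) (by simp) g, Finset.sum_filter]
  refine Finset.sum_congr rfl fun i _ => ?_
  split_ifs with h
  · rw [mul_inv_cancel₀ h, one_mul]
  · rw [not_not.1 h, zero_mul, zero_mul]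

theorem sum_one_sub_mul_inv [DecidableEq 𝕜] (i : ι) :
    ∑ j, (1 - (d i - d j) * (d i - d j)⁻¹) = ((Finset.univ.filter fun j => d i = d j).card : 𝕜) := by
  rw [Finset.card_filter, Nat.cast_sum]
  refine Finset.sum_congr rfl fun j _ => ?_
  split_ifs with h
  · simp [h]
  · rw [mul_inv_cancel₀ (sub_ne_zero.2 h)]
    simp

/-- In characteristic zero the sum in the test is the number of `j` with `d j = d i`, and the test
says that it is `1`. -/
theorem IsCertified.eq_of_eq (h : IsCertified T M P d Q) {i j : ι} (hi : d i ≠ 0)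
    (hij : d i = d j) : i = j := by
  classical
  have h1 := (mul_eq_zero.1 (h.2.1 i)).resolve_left hi
  rw [sum_one_sub_mul_inv, sub_eq_zero] at h1
  have h2 : (Finset.univ.filter fun j => d i = d j).card = 1 := by exact_mod_cast h1
  exact Finset.card_le_one.1 h2.le i (by simp) j (by simp [hij])

theorem IsCertified.mulVec_col (h : IsCertified T M P d Q) {i : ι} (hi : d i ≠ 0) :
    (M *ᵥ fun j => P j i) = d i • fun j => P j i := by
  funext j
  exact sub_eq_zero.1 ((mul_eq_zero.1 (h.1 i j)).resolve_left hi)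

theorem IsCertified.eq_sum (h : IsCertified T M P d Q) (σ : Fin r ≃ {i // d i ≠ 0}) (k : Fin r) :
    T k = ∑ a, (∑ x, ∑ y, Q (σ a) x * T k x y * Q (σ a) y) •
      vecMulVec (fun j => P j (σ a)) (fun j => P j (σ a)) := by
  classical
  ext j j'
  have h1 := sub_eq_zero.1 (h.2.2 k j j')
  rw [h1, sum_mul_inv_mul_eq_sum_subtype (fun i =>
    (∑ x, ∑ y, Q i x * T k x y * Q i y) * (P j i * P j' i)), ← σ.sum_comp, Matrix.sum_apply]
  rfl

/-- Completeness: any genuine diagonalization passes the tests whenever a square decomposition by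
eigenvectors exists, since the columns of `P` for nonzero eigenvalues are multiples of those
eigenvectors. -/
theorem isCertified_of_hasSimpleNonzeroSpectrum (hPQ : P * Q = 1) (hM : M = P * diagonal d * Q)
    {l : Fin r → 𝕜} {v : Fin r → ι → 𝕜} (h : HasSimpleNonzeroSpectrum M l v)
    {z : Fin r → Fin r → 𝕜} (hT : ∀ k, T k = ∑ a, z a k • vecMulVec (v a) (v a)) :
    IsCertified T M P d Q ∧ Nat.card {i // d i ≠ 0} = r := by
  classical
  have hQP : Q * P = 1 := mul_eq_one_comm.1 hPQ
  obtain ⟨hcard, hinj, hsum⟩ := eq_sum_squares_of_diagonalization hPQ hM h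
  refine ⟨⟨fun i j => ?_, fun i => ?_, fun k j j' => ?_⟩, by rw [Nat.card_eq_fintype_card, hcard]⟩
  · have h1 : M * P = P * diagonal d := by
      rw [hM, Matrix.mul_assoc, hQP, Matrix.mul_one]
    have h2 := congrFun (congrFun h1 j) i
    rw [Matrix.mul_apply, Matrix.mul_diagonal] at h2
    rw [h2]
    ring
  · by_cases hi : d i = 0
    · rw [hi, zero_mul]
    · rw [sum_one_sub_mul_inv, Finset.card_eq_one.2 ⟨i, ?_⟩]
      · simp
      · ext j
        simp only [Finset.mem_filter_univ, Finset.mem_singleton]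
        exact ⟨fun hij => (hinj i j hi hij).symm, fun hij => by rw [hij]⟩
  · have h1 : T k = weightedSquares v fun a => z a k := hT k
    rw [sub_eq_zero, sum_mul_inv_mul_eq_sum_subtype (fun i =>
      (∑ x, ∑ y, Q i x * T k x y * Q i y) * (P j i * P j' i)), h1, hsum]

end Certified

/-! ### Correctness and running time of the whole program. -/

section Exec

variable {𝕜 : Type*} [RCLike 𝕜] (O : DiagOracle 𝕜) {ι : Type*} [Fintype ι] [DecidableEq ι]
  {N R p r : ℕ} (e : ι ≃ Fin N)

open CertProg

/-- The input configuration for tensors whose positions are numbered by `e`. -/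
noncomputable def inputOf (u : Fin R → ι → 𝕜) (f : Fin p → MvPolynomial ι 𝕜) (φ γ : Fin R → 𝕜) :
    Config 𝕜 :=
  inputConfig (N := N) (fun a j => u a (e.symm j))
    (fun i j k => quadCoeff (f i) (e.symm j) (e.symm k)) φ γ

theorem exec_basis_inputOf {u : Fin R → ι → 𝕜} (hu : LinearIndependent 𝕜 u)
    (f : Fin p → MvPolynomial ι 𝕜) (φ γ : Fin R → 𝕜) :
    ∃ T : Module.Basis (Fin ((basis.exec O (inputOf e u f φ γ)).nat 6)) 𝕜 (certSpace u f),
      ∀ (i : Fin ((basis.exec O (inputOf e u f φ γ)).nat 6)) j k,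
        (basis.exec O (inputOf e u f φ γ)).arr 12 [i, e j, e k] = (T i : Matrix ι ι 𝕜) j k :=
  exec_basis O e hu f _ rfl rfl rfl
    (fun a j => by simp [inputOf, inputConfig]) (fun i j k => by simp [inputOf, inputConfig])

/-- If the tests pass, the vectors themselves witness a successful run, without any trust in the
oracle. If they fail, no simple spectrum with a square decomposition can exist: it would make the
matrix diagonalizable, the oracle's answer correct, and the tests successful. -/
theorem exec_answer_diagonalization {u : Fin R → ι → 𝕜} {f : Fin p → MvPolynomial ι 𝕜}
    {φ γ : Fin R → 𝕜} (hne : certSpace u f ≠ ⊥) (hr : r ≤ R)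
    (T : Module.Basis (Fin r) 𝕜 (certSpace u f)) (s : Config 𝕜) (h0 : s.nat 0 = N)
    (h6 : s.nat 6 = r) (hT : ∀ (i : Fin r) j k, s.arr 12 [i, e j, e k] = (T i : Matrix ι ι 𝕜) j k)
    (hφ : ∀ i : Fin r, s.arr 2 [i] = φ (Fin.castLE hr i))
    (hγ : ∀ i : Fin r, s.arr 3 [i] = γ (Fin.castLE hr i)) (h27 : s.arr 27 [] = 0) :
    Alg1Run u f φ γ ((outputOutcome (N := N) (answer.exec O (diagonalization.exec O s))).map
      fun x j => x (e j)) := by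
  classical
  obtain ⟨Y, P, d, Q, hY, hM, hP, hd, hQ, hspec⟩ := exec_diagonalization O e
    (fun i => (T i : Matrix ι ι 𝕜)) (fun i => φ (Fin.castLE hr i)) (fun i => γ (Fin.castLE hr i))
    s h0 h6 hT hφ hγ
  have m12 : (diagonalization.exec O s).arr 12 = s.arr 12 :=
    exec_arr_eq O (t := 12) (c := diagonalization) rfl s
  have m27 : (diagonalization.exec O s).arr 27 [] = 0 :=
    (congrFun (exec_arr_eq O (t := 27) (c := diagonalization) rfl s) []).trans h27
  have p0 : (diagonalization.exec O s).nat 0 = N :=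
    (exec_nat_eq O (x := 0) (c := diagonalization) rfl s).trans h0
  have p6 : (diagonalization.exec O s).nat 6 = r :=
    (exec_nat_eq O (x := 6) (c := diagonalization) rfl s).trans h6
  rw [← m12] at hT
  generalize diagonalization.exec O s = s₂ at *
  have hans := exec_answer O e (fun i => (T i : Matrix ι ι 𝕜)) _ P d Q s₂ p0 p6
    hT hM hP hd hQ m27
  generalize answer.exec O s₂ = s₃ at *
  rcases hans with ⟨t3, t4, hc, σ, hσ⟩ | ⟨t3, hno⟩
  · have hmap : (outputOutcome (N := N) s₃).map (fun x j => x (e j)) =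
        .found (List.ofFn fun (a : Fin r) (j : ι) => P j (σ a)) := by
      rw [outputOutcome, t3, if_neg (by decide), if_pos rfl, t4, Outcome.map, List.map_ofFn]
      congr 2
      funext a j
      exact hσ a j
    rw [hmap]
    exact Alg1Run.of_decomposition hne hr T (fun i => hc.eq_sum σ i) hY (l := fun a => d (σ a))
      (fun a b hab => σ.injective (Subtype.ext (hc.eq_of_eq (σ a).2 hab))) (fun a => (σ a).2)
      fun a => hc.mulVec_col (σ a).2
  · rw [outputOutcome, t3, if_neg (by decide), if_neg (by decide)]
    refine Alg1Run.fail_of_not_exists hne hr T hY ?_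
    rintro ⟨l, v, z, hsimple, hdec⟩
    obtain ⟨hPQ, hMP⟩ := hspec hsimple.exists_diagonalization
    exact hno (isCertified_of_hasSimpleNonzeroSpectrum hPQ hMP hsimple hdec)

theorem exec_ifLt_of_lt {a b : NExp} {c d : Prog} {s : Config 𝕜} (h : a.eval s.nat < b.eval s.nat) :
    (Prog.ifLt a b c d).exec O s = c.exec O (s.tick 1) :=
  if_pos h

theorem exec_ifLt_of_not_lt {a b : NExp} {c d : Prog} {s : Config 𝕜}
    (h : ¬a.eval s.nat < b.eval s.nat) :
    (Prog.ifLt a b c d).exec O s = d.exec O (s.tick 1) :=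
  if_neg h

theorem exec_branch {u : Fin R → ι → 𝕜} {f : Fin p → MvPolynomial ι 𝕜} {φ γ : Fin R → 𝕜}
    (s : Config 𝕜) (T : Module.Basis (Fin (s.nat 6)) 𝕜 (certSpace u f))
    (hT : ∀ (i : Fin (s.nat 6)) j k, s.arr 12 [i, e j, e k] = (T i : Matrix ι ι 𝕜) j k)
    (n0 : s.nat 0 = N) (n1 : s.nat 1 = R) (n3 : s.nat 3 = 0)
    (hφ : ∀ i : Fin R, s.arr 2 [i] = φ i) (hγ : ∀ i : Fin R, s.arr 3 [i] = γ i)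
    (h27 : s.arr 27 [] = 0) :
    Alg1Run u f φ γ ((outputOutcome (N := N) ((Prog.ifLt (.const 0) (.var 6)
      (.ifLt (.var 1) (.var 6) (.setNat 3 (.const 2)) (.seq diagonalization answer))
      .skip).exec O s)).map fun x j => x (e j)) := by
  have hfin : Module.finrank 𝕜 (certSpace u f) = s.nat 6 := by
    rw [Module.finrank_eq_card_basis T, Fintype.card_fin]
  by_cases h0 : 0 < s.nat 6
  · have hne : certSpace u f ≠ ⊥ := by
      intro h
      rw [h, finrank_bot] at hfin
      omega
    rw [exec_ifLt_of_lt O (s := s) (a := .const 0) (b := .var 6) h0]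
    by_cases hs : s.nat 1 < s.nat 6
    · have ht : (((Prog.setNat 3 (.const 2)).exec O ((s.tick 1).tick 1)).nat 3) = 2 := by
        simp [Prog.exec, NExp.eval, Config.tick, Config.setNat]
      rw [exec_ifLt_of_lt O (s := s.tick 1) (a := .var 1) (b := .var 6) hs, outputOutcome, ht, if_neg (by decide),
        if_neg (by decide)]
      refine .tooLarge ?_
      rw [hfin, ← n1]
      exact hs
    · have hr : s.nat 6 ≤ R := by
        rw [← n1]
        exact not_lt.1 hs
      rw [exec_ifLt_of_not_lt O (s := s.tick 1) (a := .var 1) (b := .var 6) hs]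
      exact exec_answer_diagonalization O e hne hr T ((s.tick 1).tick 1) n0 rfl hT
        (fun i => hφ (Fin.castLE hr i)) (fun i => hγ (Fin.castLE hr i)) h27
  · have ht : (Prog.skip.exec O (s.tick 1)).nat 3 = 0 := n3
    rw [exec_ifLt_of_not_lt O (s := s) (a := .const 0) (b := .var 6) h0, outputOutcome, if_pos ht]
    exact .trivial (Submodule.finrank_eq_zero.1 (by omega))

theorem exec_main {u : Fin R → ι → 𝕜} (hu : LinearIndependent 𝕜 u) (f : Fin p → MvPolynomial ι 𝕜)
    (φ γ : Fin R → 𝕜) :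
    Alg1Run u f φ γ ((outputOutcome (N := N) (main.exec O (inputOf e u f φ γ))).map
      fun x j => x (e j)) := by
  obtain ⟨T, hT⟩ := exec_basis_inputOf O e hu f φ γ
  exact exec_branch O e _ T hT
    (exec_nat_eq O (x := 0) (c := basis) rfl _) (exec_nat_eq O (x := 1) (c := basis) rfl _)
    (exec_nat_eq O (x := 3) (c := basis) rfl _)
    (fun i => (congrFun (exec_arr_eq O (t := 2) (c := basis) rfl _) _).trans
      (by simp [inputOf, inputConfig]))
    (fun i => (congrFun (exec_arr_eq O (t := 3) (c := basis) rfl _) _).trans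
      (by simp [inputOf, inputConfig]))
    (congrFun (exec_arr_eq O (t := 27) (c := basis) rfl _) _)

/-- The loop sizes in counters `5` and `6` are themselves computed, so the program is cut in three
at the points where they become final. There they are bounded by `R ^ 2 ≤ N ^ 2` and by the
dimension `N ^ 2` of the space of matrices; independence of `u` gives `R ≤ N`. -/
theorem steps_main_le {u : Fin R → ι → 𝕜} (hu : LinearIndependent 𝕜 u)
    (f : Fin p → MvPolynomial ι 𝕜) (hp : p ≤ N ^ 2) (φ γ : Fin R → 𝕜) :
    (main.exec O (inputOf e u f φ γ)).steps ≤ main.cost (N ^ 2) ∧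
      (main.exec O (inputOf e u f φ γ)).calls ≤ main.numCalls := by
  obtain ⟨T, -⟩ := exec_basis_inputOf O e hu f φ γ
  have hcard : Fintype.card ι = N := by rw [Fintype.card_congr e, Fintype.card_fin]
  set s := inputOf e u f φ γ with hs
  have hRN : R ≤ N := by
    have := hu.fintype_card_le_finrank
    rwa [Fintype.card_fin, Module.finrank_pi, hcard] at this
  have hN2 : N ≤ N ^ 2 := by
    rw [sq]; exact Nat.le_mul_self N
  have h6 : (basis.exec O s).nat 6 ≤ N ^ 2 := by
    have h1 := Module.finrank_eq_card_basis T
    have h2 := Submodule.finrank_le (certSpace u f)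
    rw [h1, Fintype.card_fin, Module.finrank_matrix, Module.finrank_self, hcard, mul_one, ← sq] at h2
    exact h2
  set rest : Prog := .seq (fill 7 values 10 [2, 5] []) (.seq (fill 8 gramian 10 [5, 5] [])
    (.seq (.diagonalize (.var 5) 8 9 10 11)
      (collect 6 5 10 (.at' 10 [10]) (fill 12 lift 11 [0, 0] [.var 6])))) with hrest
  set last : Prog := .ifLt (.const 0) (.var 6)
    (.ifLt (.var 1) (.var 6) (.setNat 3 (.const 2)) (.seq diagonalization answer)) .skip with hlast
  set s₁ := squares.exec O s with hs₁
  set s₂ := rest.exec O s₁ with hs₂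
  have a0 : s.nat 0 = N := rfl
  have a1 : s.nat 1 = R := rfl
  have a2 : s.nat 2 = p := rfl
  have b0 : s₁.nat 0 = N := exec_nat_eq O (x := 0) (c := squares) rfl s
  have b1 : s₁.nat 1 = R := exec_nat_eq O (x := 1) (c := squares) rfl s
  have b2 : s₁.nat 2 = p := exec_nat_eq O (x := 2) (c := squares) rfl s
  have b5 : s₁.nat 5 ≤ N ^ 2 := by
    rw [hs₁, (exec_squares O s).1, a1, sq]
    exact Nat.mul_le_mul hRN hRN
  have c0 : s₂.nat 0 = N := (exec_nat_eq O (x := 0) (c := rest) rfl s₁).trans b0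
  have c1 : s₂.nat 1 = R := (exec_nat_eq O (x := 1) (c := rest) rfl s₁).trans b1
  have c2 : s₂.nat 2 = p := (exec_nat_eq O (x := 2) (c := rest) rfl s₁).trans b2
  have c5 : s₂.nat 5 ≤ N ^ 2 := (exec_nat_eq O (x := 5) (c := rest) rfl s₁).trans_le b5
  have t1 := exec_steps_le O (L := [0, 1, 2]) (K := N ^ 2) (c := squares) rfl s (by
    intro x hx
    simp only [List.contains_eq_mem, List.mem_cons, List.not_mem_nil, or_false,
      decide_eq_true_eq] at hx
    rcases hx with rfl | rfl | rfl <;> omega)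
  have t2 := exec_steps_le O (L := [0, 1, 2, 5]) (K := N ^ 2) (c := rest) rfl s₁ (by
    intro x hx
    simp only [List.contains_eq_mem, List.mem_cons, List.not_mem_nil, or_false,
      decide_eq_true_eq] at hx
    rcases hx with rfl | rfl | rfl | rfl <;> omega)
  have t3 := exec_steps_le O (L := [0, 1, 2, 5, 6]) (K := N ^ 2) (c := last) rfl s₂ (by
    intro x hx
    simp only [List.contains_eq_mem, List.mem_cons, List.not_mem_nil, or_false,
      decide_eq_true_eq] at hx
    rcases hx with rfl | rfl | rfl | rfl | rfl
    · omega
    · omega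
    · omega
    · exact c5
    · exact h6)
  have hrun : main.exec O s = last.exec O s₂ := rfl
  have hcost : main.cost (N ^ 2) =
      squares.cost (N ^ 2) + rest.cost (N ^ 2) + last.cost (N ^ 2) := rfl
  have hcalls : main.numCalls = squares.numCalls + rest.numCalls + last.numCalls := rfl
  have hs0 : s.steps = 0 := rfl
  have hc0 : s.calls = 0 := rfl
  rw [← hs₁] at t1
  rw [← hs₂] at t2
  rw [hrun, hcost, hcalls]
  omega

end Exec

end EntangledSubspace

/-! ### The main theorem. -/

theorem corollary5p3 (𝕜 : Type*) [RCLike 𝕜] :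
    -- the two expressions for the bound agree
    (∀ (m : ℕ) (n : Fin m → ℕ), 0 < m → (∀ i, 0 < n i) →
      (((totalDim n + 1).choose 2 : ℝ) - ∏ i, ((n i + 1).choose 2 : ℝ)) / (totalDim n : ℝ)
        = dimBound n) ∧
    -- the bound is at least a constant multiple of the total dimension
    (∃ c : ℝ, 0 < c ∧ ∀ (m : ℕ) (n : Fin m → ℕ), (∀ i, 0 < n i) →
      (∃ i j, i ≠ j ∧ 2 ≤ n i ∧ 2 ≤ n j) → c * (totalDim n : ℝ) ≤ dimBound n) ∧
    ∃ (P : Prog) (C : ℕ), ∀ (m : ℕ) (n : Fin m → ℕ), 0 < m → (∀ i, 0 < n i) →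
      -- the product tensors are cut out by the expected number of independent quadrics
      (∃ f : Fin (numQuadrics n) → MvPolynomial (∀ i, Fin (n i)) 𝕜,
        CutsOutByQuadrics f (productTensors 𝕜 n)) ∧
      ∀ f : Fin (numQuadrics n) → MvPolynomial (∀ i, Fin (n i)) 𝕜,
        CutsOutByQuadrics f (productTensors 𝕜 n) →
        -- the program `P` carries out Algorithm 2 in polynomial time, on every input
        (∀ (O : DiagOracle 𝕜) (R : ℕ) (u : Fin R → Tensor 𝕜 n) (φ γ : Fin R → 𝕜),
          LinearIndependent 𝕜 u →
          (runOnTensors O P u f φ γ).steps ≤ C * totalDim n ^ C ∧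
          (runOnTensors O P u f φ γ).calls ≤ C ∧
          Alg2RunIrreducible u f φ γ (tensorOutcome (runOnTensors O P u f φ γ))) ∧
        -- the output of Algorithm 2 is correct, on every input
        (∀ (R : ℕ) (u : Fin R → Tensor 𝕜 n) (φ γ : Fin R → 𝕜) (out : Outcome (Tensor 𝕜 n)),
          LinearIndependent 𝕜 u → Alg2RunIrreducible u f φ γ out →
          (out = .trivial →
            ∀ x ∈ Submodule.span 𝕜 (Set.range u), x ∈ productTensors 𝕜 n → x = 0) ∧
          ∀ l, out = .found l → l ≠ [] ∧ ∀ x ∈ l, x ≠ 0 ∧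
            x ∈ Submodule.span 𝕜 (Set.range u) ∧ x ∈ productTensors 𝕜 n) ∧
        -- a generic subspace is completely entangled, and Algorithm 2 certifies this
        (∀ R : ℕ, (R : ℝ) ≤ dimBound n →
          HoldsGenerically (Set.univ : Set (Fin R → Tensor 𝕜 n)) fun v =>
            LinearIndependent 𝕜 v ∧
            (Submodule.span 𝕜 (Set.range v) : Set (Tensor 𝕜 n)) ∩ productTensors 𝕜 n = {0} ∧
            ∀ u : Fin R → Tensor 𝕜 n, LinearIndependent 𝕜 u →
              Submodule.span 𝕜 (Set.range u) = Submodule.span 𝕜 (Set.range v) →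
              ∀ (φ γ : Fin R → 𝕜) (out : Outcome (Tensor 𝕜 n)),
                Alg2RunIrreducible u f φ γ out → out = .trivial) ∧
        -- in a generic subspace with a planted product tensor, Algorithm 2 finds this tensor
        ∀ (R : ℕ) (hR : 0 < R), (R : ℝ) ≤ dimBound n →
          HoldsGenerically {v : Fin R → Tensor 𝕜 n | v ⟨0, hR⟩ ∈ productTensors 𝕜 n} fun v =>
            LinearIndependent 𝕜 v ∧
            ∀ u : Fin R → Tensor 𝕜 n, LinearIndependent 𝕜 u →
              Submodule.span 𝕜 (Set.range u) = Submodule.span 𝕜 (Set.range v) →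
              ∀ᵐ w ∂(seedMeasure 𝕜 R), ∀ out : Outcome (Tensor 𝕜 n),
                Alg2RunIrreducible u f w.1 w.2 out →
                  ∃ c : 𝕜, c ≠ 0 ∧ out = .found [c • v ⟨0, hR⟩] := by
  refine ⟨fun m n hm hn => ?_, ⟨1 / 16, by norm_num, fun m n hn ⟨i, j, hij, hi, hj⟩ =>
    totalDim_div_le_dimBound hn hij hi hj⟩, CertProg.main, ?_⟩
  · have hN : (totalDim n : ℝ) ≠ 0 := Nat.cast_ne_zero.2 (totalDim_pos hn).ne'
    rw [sub_prod_choose_eq, mul_div_cancel_left₀ _ hN]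
  obtain ⟨C, hC⟩ := cost_le CertProg.main
  -- All sizes are at most `N ^ 2`, which doubles the exponent `C`; the summand `3` covers the three
  -- oracle calls.
  refine ⟨2 * C + 3, fun m n hm hn => ⟨exists_cutsOutByQuadrics hm, fun f hf =>
    ⟨fun O R u φ γ hu => ?_, fun R u φ γ out hu h => (alg2RunIrreducible_iff.1 h).correct hf,
      fun R hR => holdsGenerically_trivial hm hn hf hR,
      fun R hR0 hR => holdsGenerically_planted hn hf hR0 hR⟩⟩⟩
  have hN := totalDim_pos hn
  -- The number of quadrics is at most `(N + 1) * N / 2`, which is at most `N ^ 2` because `N ≥ 1`.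
  have hp : numQuadrics n ≤ totalDim n ^ 2 := by
    refine (Nat.sub_le _ _).trans ?_
    rw [Nat.choose_two_right, Nat.add_sub_cancel]
    refine Nat.div_le_of_le_mul ?_
    nlinarith
  obtain ⟨h1, h2⟩ := steps_main_le O finPiFinEquiv hu f hp φ γ
  refine ⟨h1.trans ?_, h2.trans ?_, alg2RunIrreducible_iff.2 (exec_main O finPiFinEquiv hu f φ γ)⟩
  · refine (hC _ (Nat.one_le_pow _ _ hN)).trans ?_
    rw [← pow_mul]
    exact Nat.mul_le_mul (by omega) (Nat.pow_le_pow_right hN (by omega))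
  · have h3 : CertProg.main.numCalls = 3 := rfl
    omega
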